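/- Let $\mathbf k$ be a field of characteristic $0$ and let $P$ be a free $\mathbf k[\partial]$-module of finite rank. Write $\otimes=\otimes_{\mathbf k}$, let $\tau$ be the flip of $P\otimes P$, and let $\partial$ act on $P\otimes P$ as $\partial^{\otimes 2}=\partial\otimes I+I\otimes\partial$. Definitions. A $\lambda$-product on $P$ is a $\mathbf k$-bilinear map $(a,b)\mapsto a_\lambda b\in P[\lambda]$ with $(\partial a)_\lambda b=-\lambda\,a_\lambda b$ and $a_\lambda(\partial b)=(\partial+\lambda)a_\lambda b$. A Poisson conformal algebra $(P,[\cdot_\lambda\cdot],\cdot_\lambda\cdot)$ consists of two $\lambda$-products with $[a_\lambda b]=-[b_{-\lambda-\partial}a]$, $[a_\lambda[b_\mu c]]=[[a_\lambda b]_{\lambda+\mu}c]+[b_\mu[a_\lambda c]]$, $(a_\lambda b)_{\lambda+\mu}c=a_\lambda(b_\mu c)$, $a_\lambda b=b_{-\lambda-\partial}a$ and $[a_\lambda(b_\mu c)]=[a_\lambda b]_{\lambda+\mu}c+b_\mu[a_\lambda c]$. A Poisson conformal coalgebra $(P,\delta,\Delta)$ consists of two $\mathbf k[\partial]$-module homomorphisms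 $\delta,\Delta:P\to P\otimes P$ with $\delta=-\tau\delta$, $(I\otimes\delta)\delta-(\tau\otimes I)(I\otimes\delta)\delta=(\delta\otimes I)\delta$, $(I\otimes\Delta)\Delta=(\Delta\otimes I)\Delta$, $\Delta=\tau\Delta$ and $(I\otimes\Delta)\delta=(\delta\otimes I)\Delta+(\tau\otimes I)(I\otimes\delta)\Delta$. Put $\mathfrak{ad}(a)_\lambda b=[a_\lambda b]$, $\mathfrak L(a)_\lambda b=a_\lambda b$ and $\nu=-\lambda-\partial^{\otimes 2}$ (substituted to the left of the coefficients). A Poisson conformal bialgebra $(P,[\cdot_\lambda\cdot],\cdot_\lambda\cdot,\delta,\Delta)$ is a Poisson conformal algebra and a Poisson conformal coalgebra on $P$ such that, for all $a,b\in P$, $$\delta([a_\lambda b])=(\mathfrak{ad}(a)_\lambda\otimes I+I\otimes\mathfrak{ad}(a)_\lambda)\delta(b)-(\mathfrak{ad}(b)_\nu\otimes I+I\otimes\mathfrak{ad}(b)_\nu)\delta(a),$$ $$\Delta(a_\lambda b)=(I\otimes\mathfrak L(a)_\lambda)\Delta(b)+(\mathfrak L(b)_\nu\otimes I)\Delta(a),$$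 $$\delta(a_\lambda b)=(\mathfrak L(a)_\lambda\otimes I)\delta(b)+(\mathfrak L(b)_\nu\otimes I)\delta(a)+(I\otimes\mathfrak{ad}(a)_\lambda)\Delta(b)+(I\otimes\mathfrak{ad}(b)_\nu)\Delta(a),$$ $$\Delta([a_\lambda b])=(\mathfrak{ad}(a)_\lambda\otimes I+I\otimes\mathfrak{ad}(a)_\lambda)\Delta(b)-(I\otimes\mathfrak L(b)_\nu)\delta(a)+(\mathfrak L(b)_\nu\otimes I)\delta(a).$$ (The second identity makes $(P,\cdot_\lambda\cdot,\Delta)$ a commutative and cocommutative antisymmetric infinitesimal conformal bialgebra; the remaining, antisymmetry, axiom of such bialgebras is then automatic.) The conformal dual $P^{*c}$ is the set of $\mathbf k$-linear maps $f:P\to\mathbf k[\lambda]$ with $f_\lambda(\partial b)=\lambda f_\lambda(b)$, on which $(\partial f)_\lambda=-\lambda f_\lambda$. Theorem (double construction). Let $(P,[\cdot_\lambda\cdot],\cdot_\lambda\cdot,\delta,\Delta)$ be a Poisson conformal bialgebra in which $P$ is free of finite rank over $\mathbf k[\partial]$. Write $\delta(a)=\sum a_{[1]}\otimes a_{[2]}$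 and $\Delta(a)=\sum a_{(1)}\otimes a_{(2)}$. Equip the $\mathbf k[\partial]$-module $P\oplus P^{*c}$ with the $\lambda$-products $$[(a+f)_\lambda(b+g)]=\big([a_\lambda b]+\rho'(f)_\lambda b-\rho'(g)_{-\lambda-\partial}a\big)+\big([f_\lambda g]+\rho(a)_\lambda g-\rho(b)_{-\lambda-\partial}f\big),$$ $$(a+f)_\lambda(b+g)=\big(a_\lambda b+l'(f)_\lambda b+l'(g)_{-\lambda-\partial}a\big)+\big(f_\lambda g+l(a)_\lambda g+l(b)_{-\lambda-\partial}f\big)$$ for $a,b\in P$ and $f,g\in P^{*c}$, where $$[f_\lambda g]_\mu(a)=\sum f_\lambda(a_{[1]})g_{\mu-\lambda}(a_{[2]}),\qquad (f_\lambda g)_\mu(a)=\sum f_\lambda(a_{(1)})g_{\mu-\lambda}(a_{(2)}),$$ $$(\rho(a)_\lambda f)_\mu(b)=-f_{\mu-\lambda}([a_\lambda b]),\qquad (l(a)_\lambda f)_\mu(b)=f_{\mu-\lambda}(a_\lambda b),$$ $$\rho'(f)_\lambda a=-\sum f_\lambda(a_{[1]})\,a_{[2]},\qquad l'(f)_\lambda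 a=\sum f_\lambda(a_{(1)})\,a_{(2)}.$$ Then there are coproducts $\delta',\Delta'$ on $P\oplus P^{*c}$ which make it, together with these two $\lambda$-products, a Poisson conformal bialgebra, and this bialgebra is coboundary: for every $\mathbf k[\partial]$-basis $e_1,\dots,e_n$ of $P$, with dual basis $e_1^*,\dots,e_n^*$ of $P^{*c}$, and $r=\sum_{i=1}^n e_i\otimes e_i^*$, one has for all $x\in P\oplus P^{*c}$ $$\delta'(x)=(\mathfrak{ad}(x)_\lambda\otimes I+I\otimes\mathfrak{ad}(x)_\lambda)\,r\,\big|_{\lambda=-\partial^{\otimes2}},\qquad \Delta'(x)=(I\otimes\mathfrak L(x)_\lambda-\mathfrak L(x)_\lambda\otimes I)\,r\,\big|_{\lambda=-\partial^{\otimes2}}.$$ -/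

import Mathlib

open Polynomial TensorProduct

noncomputable section

namespace PoissonConformal

/-! ### Polynomials in formal variables with coefficients in a vector space

A `k[∂]`-module is a `k`-vector space with a compatible action of `k[X]`, where `X` acts as `∂`. -/

/-- `V[λ]`: the element `∑ λⁿ vₙ` is stored as `n ↦ vₙ`. -/
abbrev Lam (V : Type*) [AddCommGroup V] : Type _ := ℕ →₀ V

/-- `V[λ, μ] = (V[μ])[λ]`: the outer variable is `λ`, the inner one is `μ`. -/
abbrev Lam2 (V : Type*) [AddCommGroup V] : Type _ := Lam (Lam V)

section Poly

variable (k : Type*) [Field k]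

/-- The action of `∂` on a `k[∂]`-module. -/
def der (V : Type*) [AddCommGroup V] [Module k V] [Module k[X] V] [IsScalarTower k k[X] V] :
    Module.End k V :=
  Algebra.lsmul k k V (X : k[X])

variable (V : Type*) [AddCommGroup V] [Module k V]

/-- Constants `V → V[λ]`. -/
def const : V →ₗ[k] Lam V := Finsupp.lsingle 0

/-- Multiplication by `λ` on `V[λ]`. -/
def lam : Module.End k (Lam V) := Finsupp.lmapDomain V k Nat.succ

variable {k V} {W : Type*} [AddCommGroup W] [Module k W]

/-- A linear map applied to each coefficient, `V[λ] → W[λ]`. -/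
def coeffwise (f : V →ₗ[k] W) : Lam V →ₗ[k] Lam W := Finsupp.mapRange.linearMap f

/-- The substitution `λ ↦ T`: sends `∑ λⁿ vₙ` to `∑ Tⁿ (ι vₙ)`, where `T` is a linear operator on
`W` and `ι : V → W` carries the coefficients to `W`. -/
def subst (ι : V →ₗ[k] W) (T : Module.End k W) : Lam V →ₗ[k] W :=
  Finsupp.lsum k fun n => (T ^ n) ∘ₗ ι

variable (k V)

/-- Constants `V → V[λ, μ]`. -/
def const₂ : V →ₗ[k] Lam2 V := const k (Lam V) ∘ₗ const k V

/-- Multiplication by `λ` on `V[λ, μ]`. -/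
def lam₂ : Module.End k (Lam2 V) := lam k (Lam V)

/-- Multiplication by `μ` on `V[λ, μ]`. -/
def mu₂ : Module.End k (Lam2 V) := coeffwise (lam k V)

variable {k V}

@[simp] lemma subst_single (ι : V →ₗ[k] W) (T : Module.End k W) (n : ℕ) (v : V) :
    subst ι T (Finsupp.single n v) = (T ^ n) (ι v) := by
  simp [subst]

@[simp] lemma lam_single (n : ℕ) (v : V) :
    lam k V (Finsupp.single n v) = Finsupp.single (n + 1) v := by
  simp [lam]

@[simp] lemma coeffwise_single (f : V →ₗ[k] W) (n : ℕ) (v : V) :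
    coeffwise f (Finsupp.single n v) = Finsupp.single n (f v) := by
  simp [coeffwise]

lemma coeffwise_lam (f : V →ₗ[k] W) (p : Lam V) :
    coeffwise f (lam k V p) = lam k W (coeffwise f p) := by
  induction p using Finsupp.induction_linear with
  | zero => simp
  | add p q hp hq => simp only [map_add, hp, hq]
  | single n v => simp

lemma subst_lam (ι : V →ₗ[k] W) (T : Module.End k W) (p : Lam V) :
    subst ι T (lam k V p) = T (subst ι T p) := by
  induction p using Finsupp.induction_linear with
  | zero => simp
  | add p q hp hq => simp only [map_add, hp, hq]
  | single n v => simp [pow_succ']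

lemma subst_coeffwise (ι : V →ₗ[k] W) (T d : Module.End k W) (f : Module.End k V)
    (hd : Commute T d) (hf : ∀ v, ι (f v) = d (ι v)) (p : Lam V) :
    subst ι T (coeffwise f p) = d (subst ι T p) := by
  induction p using Finsupp.induction_linear with
  | zero => simp
  | add p q hp hq => simp only [map_add, hp, hq]
  | single n v =>
    have h := LinearMap.congr_fun (hd.pow_left n).eq (ι v)
    simpa [hf] using h

lemma commute_lam (f : Module.End k V) : Commute (lam k V) (coeffwise f) := by
  refine LinearMap.ext fun p => ?_
  simp [coeffwise_lam]

end Poly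

/-! ### Conformal sesquilinear maps -/

section Sesqui

variable (k : Type*) [Field k]
  (U : Type*) [AddCommGroup U] [Module k U] [Module k[X] U] [IsScalarTower k k[X] U]
  (V : Type*) [AddCommGroup V] [Module k V] [Module k[X] V] [IsScalarTower k k[X] V]
  (W : Type*) [AddCommGroup W] [Module k W] [Module k[X] W] [IsScalarTower k k[X] W]

/-- Conformal sesquilinear maps: `k`-bilinear maps `(u, v) ↦ u_λ v` from `U × V` to `W[λ]` with
`(∂u)_λ v = -λ u_λ v` and `u_λ (∂v) = (∂ + λ) u_λ v`.  For `U = V = W` these are the λ-products on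
`U`; for `V = W` they are the `k[∂]`-module homomorphisms from `U` to `gc(V)`. -/
def Conf : Submodule k (U →ₗ[k] V →ₗ[k] Lam W) where
  carrier := {f | (∀ u v, f (der k U u) v = -lam k W (f u v)) ∧
    ∀ u v, f u (der k V v) = (coeffwise (der k W) + lam k W) (f u v)}
  add_mem' := by
    rintro f g ⟨hf, hf'⟩ ⟨hg, hg'⟩
    refine ⟨fun u v => ?_, fun u v => ?_⟩
    · simp only [LinearMap.add_apply, map_add, hf, hg, neg_add]
    · rw [LinearMap.add_apply, LinearMap.add_apply, hf', hg', ← map_add]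
      rfl
  zero_mem' := by simp
  smul_mem' := by
    rintro c f ⟨hf, hf'⟩
    refine ⟨fun u v => ?_, fun u v => ?_⟩
    · simp only [LinearMap.smul_apply, hf, map_smul, smul_neg]
    · simp only [LinearMap.smul_apply, hf', map_smul]

variable {k U V W}

/-- The opposite map `(v, u) ↦ u_{-λ-∂} v`. -/
def opp (f : Conf k U V W) : Conf k V U W :=
  ⟨f.1.flip.compr₂ (subst (const k W) (-lam k W - coeffwise (der k W))), by
    have hc : ∀ w : W, const k W (der k W w) = coeffwise (der k W) (const k W w) := by
      intro w; simp [const]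
    have hcomm : Commute (-lam k W - coeffwise (der k W)) (coeffwise (der k W)) :=
      Commute.sub_left (Commute.neg_left (commute_lam (der k W))) (Commute.refl _)
    refine ⟨fun v u => ?_, fun v u => ?_⟩
    · simp only [LinearMap.compr₂_apply, LinearMap.flip_apply, f.2.2, LinearMap.add_apply,
        map_add, subst_lam, subst_coeffwise _ _ _ _ hcomm hc, LinearMap.sub_apply,
        LinearMap.neg_apply]
      abel
    · simp only [LinearMap.compr₂_apply, LinearMap.flip_apply, f.2.1, LinearMap.add_apply,
        map_neg, subst_lam, LinearMap.sub_apply, LinearMap.neg_apply]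
      abel⟩

variable
  {U' : Type*} [AddCommGroup U'] [Module k U'] [Module k[X] U'] [IsScalarTower k k[X] U']
  {V' : Type*} [AddCommGroup V'] [Module k V'] [Module k[X] V'] [IsScalarTower k k[X] V']
  {W' : Type*} [AddCommGroup W'] [Module k W'] [Module k[X] W'] [IsScalarTower k k[X] W']

/-- The conformal sesquilinear map `(u, v) ↦ γ ((α u)_λ (β v))`, for `k[∂]`-module homomorphisms
`α`, `β`, `γ`. -/
def pull (f : Conf k U V W) (α : U' →ₗ[k[X]] U) (β : V' →ₗ[k[X]] V) (γ : W →ₗ[k[X]] W') :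
    Conf k U' V' W' :=
  ⟨(f.1.compl₁₂ (α.restrictScalars k) (β.restrictScalars k)).compr₂
      (coeffwise (γ.restrictScalars k)), by
    have hα : ∀ u, α (der k U' u) = der k U (α u) := fun u => α.map_smul X u
    have hβ : ∀ u, β (der k V' u) = der k V (β u) := fun u => β.map_smul X u
    have hγ : ∀ p : Lam W, coeffwise (γ.restrictScalars k) (coeffwise (der k W) p) =
        coeffwise (der k W') (coeffwise (γ.restrictScalars k) p) := by
      intro p
      ext n
      simp [coeffwise, der]
    refine ⟨fun u v => ?_, fun u v => ?_⟩
    · simp only [LinearMap.compr₂_apply, LinearMap.compl₁₂_apply, LinearMap.coe_restrictScalars,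
        hα, f.2.1, map_neg, coeffwise_lam]
    · simp only [LinearMap.compr₂_apply, LinearMap.compl₁₂_apply, LinearMap.coe_restrictScalars,
        hβ, f.2.2, map_add, LinearMap.add_apply, coeffwise_lam, hγ]⟩

end Sesqui

/-! ### Poisson conformal algebras -/

section Algebras

variable {k : Type*} [Field k]
  {P : Type*} [AddCommGroup P] [Module k P] [Module k[X] P] [IsScalarTower k k[X] P]

/-- `a_s b` in `P[λ, μ]`, where `s` is one of the operators `λ`, `μ`, `λ + μ`. -/
def mulAt (B : Conf k P P P) (s : Module.End k (Lam2 P)) : P →ₗ[k] P →ₗ[k] Lam2 P :=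
  B.1.compr₂ (subst (const₂ k P) s)

/-- `(a_s b)'_t c` in `P[λ, μ]`; the inner product is `B`, the outer one is `B'`. -/
def nestL (B B' : Conf k P P P) (s t : Module.End k (Lam2 P)) (a b c : P) : Lam2 P :=
  subst ((mulAt B' t).flip c) s (B.1 a b)

/-- `a_s (b'_t c)` in `P[λ, μ]`; the outer product is `B`, the inner one is `B'`. -/
def nestR (B B' : Conf k P P P) (s t : Module.End k (Lam2 P)) (a b c : P) : Lam2 P :=
  subst (mulAt B s a) t (B'.1 b c)

/-- Associativity `(a_λ b)_{λ+μ} c = a_λ (b_μ c)`. -/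
def IsAssocConformal (mul : Conf k P P P) : Prop :=
  ∀ a b c : P, nestL mul mul (lam₂ k P) (lam₂ k P + mu₂ k P) a b c =
    nestR mul mul (lam₂ k P) (mu₂ k P) a b c

/-- Commutativity `a_λ b = b_{-λ-∂} a`. -/
def IsCommConformal (mul : Conf k P P P) : Prop :=
  ∀ a b : P, mul.1 a b = (opp mul).1 a b

/-- Lie conformal algebras: `[a_λ b] = -[b_{-λ-∂} a]` and
`[a_λ [b_μ c]] = [[a_λ b]_{λ+μ} c] + [b_μ [a_λ c]]`. -/
structure IsLieConformal (br : Conf k P P P) : Prop where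
  skew : ∀ a b : P, br.1 a b = -(opp br).1 a b
  jacobi : ∀ a b c : P, nestR br br (lam₂ k P) (mu₂ k P) a b c =
    nestL br br (lam₂ k P) (lam₂ k P + mu₂ k P) a b c +
      nestR br br (mu₂ k P) (lam₂ k P) b a c

/-- Poisson conformal algebras: a Lie conformal algebra and a commutative associative conformal
algebra with `[a_λ (b_μ c)] = [a_λ b]_{λ+μ} c + b_μ [a_λ c]`. -/
structure IsPoissonConformal (br mul : Conf k P P P) : Prop where
  lie : IsLieConformal br
  assoc : IsAssocConformal mul
  comm : IsCommConformal mul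
  leibniz : ∀ a b c : P, nestR br mul (lam₂ k P) (mu₂ k P) a b c =
    nestL br mul (lam₂ k P) (lam₂ k P + mu₂ k P) a b c +
      nestR mul br (mu₂ k P) (lam₂ k P) b a c

end Algebras

/-! ### Poisson conformal coalgebras and bialgebras -/

section Bialgebras

variable (k : Type*) [Field k]
  (P : Type*) [AddCommGroup P] [Module k P] [Module k[X] P] [IsScalarTower k k[X] P]

/-- The operator `∂ ⊗ I + I ⊗ ∂` on `P ⊗ P`, which is the action of `∂` on the `k[∂]`-module
`P ⊗ P`.  (Mathlib's own `k[X]`-action on `P ⊗[k] P` is on the left factor only; it is not used.) -/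
def der₂ : Module.End k (P ⊗[k] P) := (der k P).rTensor P + (der k P).lTensor P

/-- Coproducts: `k[∂]`-module homomorphisms `P → P ⊗ P`. -/
structure Coproduct where
  toFun : P →ₗ[k] P ⊗[k] P
  map_der : ∀ a, toFun (der k P a) = der₂ k P (toFun a)

variable {k P}

/-- `((I ⊗ d') d)(a)`. -/
def coR (d d' : Coproduct k P) (a : P) : P ⊗[k] (P ⊗[k] P) := d'.toFun.lTensor P (d.toFun a)

/-- `((d' ⊗ I) d)(a)`. -/
def coL (d d' : Coproduct k P) (a : P) : P ⊗[k] (P ⊗[k] P) :=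
  TensorProduct.assoc k P P P (d'.toFun.rTensor P (d.toFun a))

/-- `τ ⊗ I` on `P ⊗ P ⊗ P`. -/
def swap₁₂ : P ⊗[k] (P ⊗[k] P) →ₗ[k] P ⊗[k] (P ⊗[k] P) :=
  (TensorProduct.leftComm k P P P).toLinearMap

/-- Cocommutative associative conformal coalgebras. -/
structure IsCocommCoassoc (Δ : Coproduct k P) : Prop where
  coassoc : ∀ a, coR Δ Δ a = coL Δ Δ a
  cocomm : ∀ a, Δ.toFun a = TensorProduct.comm k P P (Δ.toFun a)

/-- Lie conformal coalgebras. -/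
structure IsLieConformalCoalgebra (δ : Coproduct k P) : Prop where
  coskew : ∀ a, δ.toFun a = -TensorProduct.comm k P P (δ.toFun a)
  cojacobi : ∀ a, coR δ δ a - swap₁₂ (coR δ δ a) = coL δ δ a

/-- Poisson conformal coalgebras:
`(I ⊗ Δ) δ(a) = (δ ⊗ I) Δ(a) + (τ ⊗ I)(I ⊗ δ) Δ(a)`. -/
structure IsPoissonConformalCoalgebra (δ Δ : Coproduct k P) : Prop where
  colie : IsLieConformalCoalgebra δ
  cocommCoassoc : IsCocommCoassoc Δ
  coleibniz : ∀ a, coR δ Δ a = coL Δ δ a + swap₁₂ (coR Δ δ a)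

/-- `(B(a)_λ ⊗ I) z` in `(P ⊗ P)[λ]`, where `B(a)_λ b = a_λ b`. -/
def onFst (B : Conf k P P P) (a : P) : P ⊗[k] P →ₗ[k] Lam (P ⊗[k] P) :=
  (TensorProduct.finsuppLeft k k P P ℕ).toLinearMap ∘ₗ (B.1 a).rTensor P

/-- `(I ⊗ B(a)_λ) z` in `(P ⊗ P)[λ]`, where `B(a)_λ b = a_λ b`. -/
def onSnd (B : Conf k P P P) (a : P) : P ⊗[k] P →ₗ[k] Lam (P ⊗[k] P) :=
  (TensorProduct.finsuppRight k k P P ℕ).toLinearMap ∘ₗ (B.1 a).lTensor P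

/-- The substitution `λ ↦ -λ - (∂ ⊗ I + I ⊗ ∂)` in `(P ⊗ P)[λ]`. -/
def reflect : Lam (P ⊗[k] P) →ₗ[k] Lam (P ⊗[k] P) :=
  subst (const k (P ⊗[k] P)) (-lam k (P ⊗[k] P) - coeffwise (der₂ k P))

/-- The substitution `λ ↦ -(∂ ⊗ I + I ⊗ ∂)`, from `(P ⊗ P)[λ]` to `P ⊗ P`. -/
def atNegDer : Lam (P ⊗[k] P) →ₗ[k] P ⊗[k] P := subst LinearMap.id (-der₂ k P)

/-- Lie conformal bialgebras. -/
structure IsLieConformalBialgebra (br : Conf k P P P) (δ : Coproduct k P) : Prop where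
  lie : IsLieConformal br
  colie : IsLieConformalCoalgebra δ
  compat : ∀ a b, coeffwise δ.toFun (br.1 a b) =
    (onFst br a (δ.toFun b) + onSnd br a (δ.toFun b)) -
      reflect (onFst br b (δ.toFun a) + onSnd br b (δ.toFun a))

/-- Commutative and cocommutative antisymmetric infinitesimal conformal bialgebras.  Here `mul`
gives the left multiplication `L(a)_λ b = a_λ b`, and `opp mul` the right multiplication
`R(a)_λ b = b_{-λ-∂} a`. -/
structure IsCommASIConformalBialgebra (mul : Conf k P P P) (Δ : Coproduct k P) : Prop where
  assoc : IsAssocConformal mul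
  comm : IsCommConformal mul
  cocommCoassoc : IsCocommCoassoc Δ
  compat : ∀ a b, coeffwise Δ.toFun (mul.1 a b) =
    onSnd mul a (Δ.toFun b) + reflect (onFst (opp mul) b (Δ.toFun a))
  antisymm : ∀ a b,
    reflect (onFst mul b (Δ.toFun a) - onSnd (opp mul) b (Δ.toFun a)) +
      coeffwise (TensorProduct.comm k P P).toLinearMap
        (onFst mul a (Δ.toFun b) - onSnd (opp mul) a (Δ.toFun b)) = 0

/-- Poisson conformal bialgebras. -/
structure IsPoissonConformalBialgebra (br mul : Conf k P P P) (δ Δ : Coproduct k P) : Prop where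
  poisson : IsPoissonConformal br mul
  copoisson : IsPoissonConformalCoalgebra δ Δ
  lieBialgebra : IsLieConformalBialgebra br δ
  asiBialgebra : IsCommASIConformalBialgebra mul Δ
  compat_mul : ∀ a b, coeffwise δ.toFun (mul.1 a b) =
    onFst mul a (δ.toFun b) + reflect (onFst mul b (δ.toFun a)) +
      onSnd br a (Δ.toFun b) + reflect (onSnd br b (Δ.toFun a))
  compat_br : ∀ a b, coeffwise Δ.toFun (br.1 a b) =
    (onFst br a (Δ.toFun b) + onSnd br a (Δ.toFun b)) -
      reflect (onSnd mul b (δ.toFun a)) + reflect (onFst mul b (δ.toFun a))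

/-- The coproducts `δ`, `Δ` are the coboundaries of `r ∈ P ⊗ P`:
`δ(a) = (ad(a)_λ ⊗ I + I ⊗ ad(a)_λ) r` and `Δ(a) = (I ⊗ L(a)_λ - L(a)_λ ⊗ I) r` at
`λ = -(∂ ⊗ I + I ⊗ ∂)`. -/
structure IsCoboundaryOf (br mul : Conf k P P P) (δ Δ : Coproduct k P) (r : P ⊗[k] P) : Prop where
  delta : ∀ a, δ.toFun a = atNegDer (onFst br a r + onSnd br a r)
  Delta : ∀ a, Δ.toFun a = atNegDer (onSnd mul a r - onFst mul a r)

end Bialgebras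

/-! ### The conformal dual -/

section Dual

variable (k : Type*) [Field k]
  (U : Type*) [AddCommGroup U] [Module k U] [Module k[X] U] [IsScalarTower k k[X] U]

/-- The `k`-linear maps `f : U → k[λ]` with `f_λ (∂ b) = λ f_λ b`. -/
def conformalDualSubmodule : Submodule k (U →ₗ[k] k[X]) where
  carrier := {f | ∀ b, f (der k U b) = X * f b}
  add_mem' := by
    intro f g hf hg b
    simp only [LinearMap.add_apply, hf b, hg b, mul_add]
  zero_mem' := by intro b; simp
  smul_mem' := by
    intro c f hf b
    simp only [LinearMap.smul_apply, hf b, mul_smul_comm]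

/-- The conformal dual `U^{*c}`. -/
def ConformalDual : Type _ := ↥(conformalDualSubmodule k U)

instance : AddCommGroup (ConformalDual k U) :=
  inferInstanceAs (AddCommGroup ↥(conformalDualSubmodule k U))

instance : Module k (ConformalDual k U) :=
  inferInstanceAs (Module k ↥(conformalDualSubmodule k U))

variable {k U}

/-- The underlying map `b ↦ f_λ b` of an element of the conformal dual. -/
def ConformalDual.toLin (f : ConformalDual k U) : U →ₗ[k] k[X] := f.1

@[ext] lemma ConformalDual.ext {f g : ConformalDual k U} (h : ∀ b, f.toLin b = g.toLin b) :
    f = g :=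
  Subtype.ext (LinearMap.ext h)

lemma ConformalDual.toLin_der (f : ConformalDual k U) (b : U) :
    f.toLin (der k U b) = X * f.toLin b :=
  f.2 b

@[simp] lemma ConformalDual.toLin_add (f g : ConformalDual k U) :
    (f + g).toLin = f.toLin + g.toLin := rfl

@[simp] lemma ConformalDual.toLin_smul (c : k) (f : ConformalDual k U) :
    (c • f).toLin = c • f.toLin := rfl

@[simp] lemma ConformalDual.toLin_zero : (0 : ConformalDual k U).toLin = 0 := rfl

@[simp] lemma ConformalDual.toLin_neg (f : ConformalDual k U) : (-f).toLin = -f.toLin := rfl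

variable (k U)

/-- The action of `∂` on the conformal dual, `(∂f)_λ = -λ f_λ`. -/
def dualDer : Module.End k (ConformalDual k U) where
  toFun f := ⟨-(LinearMap.mulLeft k (X : k[X]) ∘ₗ f.toLin), fun b => by
    rw [LinearMap.neg_apply, LinearMap.neg_apply, LinearMap.comp_apply, LinearMap.comp_apply,
      LinearMap.mulLeft_apply, LinearMap.mulLeft_apply, ConformalDual.toLin_der, mul_neg]⟩
  map_add' f g := by
    refine ConformalDual.ext fun b => ?_
    exact (congrArg Neg.neg (mul_add X (f.toLin b) (g.toLin b))).trans (neg_add _ _)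
  map_smul' c f := by
    refine ConformalDual.ext fun b => ?_
    exact (congrArg Neg.neg (mul_smul_comm c X (f.toLin b))).trans (smul_neg c _).symm

lemma dualDer_toLin (f : ConformalDual k U) (b : U) :
    (dualDer k U f).toLin b = -(X * f.toLin b) := rfl

/-- The `k[∂]`-module structure of the conformal dual, in which `X` acts as `dualDer`. -/
instance : Module k[X] (ConformalDual k U) :=
  Module.compHom (ConformalDual k U) (aeval (dualDer k U)).toRingHom

lemma ConformalDual.polySmul_def (p : k[X]) (f : ConformalDual k U) :
    p • f = aeval (dualDer k U) p f := rfl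

instance : IsScalarTower k k[X] (ConformalDual k U) where
  smul_assoc c p f := by simp [ConformalDual.polySmul_def]

lemma der_conformalDual : der k (ConformalDual k U) = dualDer k U := by
  refine LinearMap.ext fun f => ?_
  simp [der, ConformalDual.polySmul_def]

/-- The maps `F : U → k[λ, μ]` with `F(∂u) = μ F(u)`, where `k[λ, μ] = k[μ][λ]` has the outer
variable `λ = X` and the inner variable `μ = C X`. -/
def Family : Submodule k (U →ₗ[k] k[X][X]) where
  carrier := {F | ∀ u, F (der k U u) = C X * F u}
  add_mem' := by
    intro F G hF hG u
    simp only [LinearMap.add_apply, hF u, hG u, mul_add]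
  zero_mem' := by intro u; simp
  smul_mem' := by
    intro c F hF u
    simp only [LinearMap.smul_apply, hF u, mul_smul_comm]

variable {k U}

/-- The coefficient of `λⁿ` in a family, as an element of the conformal dual. -/
def Family.coeff (n : ℕ) : Family k U →ₗ[k] ConformalDual k U where
  toFun F := ⟨(Polynomial.lcoeff k[X] n).restrictScalars k ∘ₗ F.1, fun u => by
    simp [F.2 u]⟩
  map_add' F G := by
    refine ConformalDual.ext fun b => ?_
    change (F.1 b + G.1 b).coeff n = (F.1 b).coeff n + (G.1 b).coeff n
    simp
  map_smul' c F := by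
    refine ConformalDual.ext fun b => ?_
    change (c • F.1 b).coeff n = c • (F.1 b).coeff n
    simp

lemma Family.coeff_toLin (n : ℕ) (F : Family k U) (u : U) :
    (Family.coeff n F).toLin u = (F.1 u).coeff n := rfl

lemma ConformalDual.toLin_polySmul (f : ConformalDual k U) (p : k[X]) (u : U) :
    f.toLin (p • u) = p * f.toLin u := by
  induction p using Polynomial.induction_on' with
  | add p q hp hq => rw [add_smul, map_add, hp, hq, add_mul]
  | monomial n c =>
    have h : ∀ m : ℕ, f.toLin ((X ^ m : k[X]) • u) = X ^ m * f.toLin u := by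
      intro m
      induction m with
      | zero => simp
      | succ m ih =>
        have := f.toLin_der ((X ^ m : k[X]) • u)
        rw [ih] at this
        rw [pow_succ', mul_smul, mul_assoc]
        exact this
    rw [← smul_X_eq_monomial, smul_assoc, map_smul, h, smul_mul_assoc]

lemma Family.coeff_finite [Module.Finite k[X] U] (F : Family k U) :
    (Function.support fun n => Family.coeff n F).Finite := by
  obtain ⟨S, hS⟩ := Module.Finite.fg_top (R := k[X]) (M := U)
  refine (Set.finite_Iic (S.sup fun u => (F.1 u).natDegree)).subset fun n hn => ?_
  rw [Set.mem_Iic]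
  by_contra hlt
  refine hn (ConformalDual.ext fun u => ?_)
  have hu : u ∈ Submodule.span k[X] (S : Set U) := hS ▸ Submodule.mem_top
  induction hu using Submodule.span_induction with
  | mem x hx =>
    refine Polynomial.coeff_eq_zero_of_natDegree_lt (lt_of_le_of_lt ?_ (not_le.mp hlt))
    exact Finset.le_sup (f := fun u => (F.1 u).natDegree) hx
  | zero => simp
  | add x y _ _ hx hy => rw [map_add, map_add, hx, hy]
  | smul p x _ hx => rw [ConformalDual.toLin_polySmul, ConformalDual.toLin_polySmul, hx]

/-- A family `F : U → k[λ, μ]` as the polynomial `∑ λⁿ Fₙ` with coefficients in the conformal dual.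
It has finitely many terms because `U` is a finite `k[∂]`-module. -/
def Family.toLam [Module.Finite k[X] U] : Family k U →ₗ[k] Lam (ConformalDual k U) where
  toFun F := Finsupp.ofSupportFinite (fun n => Family.coeff n F) (Family.coeff_finite F)
  map_add' F G := by
    refine Finsupp.ext fun n => ?_
    exact map_add (Family.coeff n) F G
  map_smul' c F := by
    refine Finsupp.ext fun n => ?_
    exact map_smul (Family.coeff n) c F

lemma Family.toLam_apply [Module.Finite k[X] U] (F : Family k U) (n : ℕ) :
    Family.toLam F n = Family.coeff n F := rfl

lemma lam_apply_zero {V : Type*} [AddCommGroup V] [Module k V] (p : Lam V) : lam k V p 0 = 0 := by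
  simp [lam, Finsupp.lmapDomain, Finsupp.mapDomain_of_notMem_range]

lemma lam_apply_succ {V : Type*} [AddCommGroup V] [Module k V] (p : Lam V) (n : ℕ) :
    lam k V p (n + 1) = p n :=
  Finsupp.mapDomain_apply Nat.succ_injective p n

lemma Family.toLam_left [Module.Finite k[X] U] (F G : Family k U)
    (h : ∀ u, G.1 u = -(X * F.1 u)) : Family.toLam G = -lam k _ (Family.toLam F) := by
  refine Finsupp.ext fun n => ConformalDual.ext fun u => ?_
  cases n with
  | zero => simp [Family.toLam_apply, Family.coeff_toLin, lam_apply_zero, h]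
  | succ n => simp [Family.toLam_apply, Family.coeff_toLin, lam_apply_succ, h]

lemma Family.toLam_right [Module.Finite k[X] U] (F G : Family k U)
    (h : ∀ u, G.1 u = (X - C X) * F.1 u) :
    Family.toLam G = (coeffwise (der k (ConformalDual k U)) + lam k (ConformalDual k U)) (Family.toLam F) := by
  refine Finsupp.ext fun n => ConformalDual.ext fun u => ?_
  have hd : ∀ m, (coeffwise (der k (ConformalDual k U)) (Family.toLam F)) m =
      dualDer k U (Family.coeff m F) := by
    intro m
    simp [coeffwise, der_conformalDual, Family.toLam_apply]
  rw [LinearMap.add_apply, Finsupp.add_apply, hd]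
  cases n with
  | zero =>
    simp [Family.toLam_apply, Family.coeff_toLin, lam_apply_zero, h, dualDer_toLin, sub_mul]
  | succ n =>
    simp [Family.toLam_apply, Family.coeff_toLin, lam_apply_succ, h, dualDer_toLin, sub_mul]
    ring

/-- `u ↦ f_s u`, the substitution of `s ∈ k[λ, μ]` for the variable of `f`. -/
def ConformalDual.at (f : ConformalDual k U) (s : k[X][X]) : U →ₗ[k] k[X][X] :=
  (aeval s).toLinearMap ∘ₗ f.toLin

lemma ConformalDual.at_der (f : ConformalDual k U) (s : k[X][X]) (u : U) :
    f.at s (der k U u) = s * f.at s u := by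
  simp [ConformalDual.at, ConformalDual.toLin_der]

lemma ConformalDual.der_at (f : ConformalDual k U) (s : k[X][X]) (u : U) :
    (der k _ f).at s u = -(s * f.at s u) := by
  simp [ConformalDual.at, der_conformalDual, dualDer_toLin]

lemma ConformalDual.add_at (f g : ConformalDual k U) (s : k[X][X]) :
    (f + g).at s = f.at s + g.at s := by
  refine LinearMap.ext fun u => ?_
  simp [ConformalDual.at]

lemma ConformalDual.smul_at (c : k) (f : ConformalDual k U) (s : k[X][X]) :
    (c • f).at s = c • f.at s := by
  refine LinearMap.ext fun u => ?_
  simp [ConformalDual.at]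

end Dual

/-! ### The λ-products on the dual, and the actions between a module and its dual -/

section Double

variable {k : Type*} [Field k]
  {P : Type*} [AddCommGroup P] [Module k P] [Module k[X] P] [IsScalarTower k k[X] P]
  {V : Type*} [AddCommGroup V] [Module k V] [Module k[X] V] [IsScalarTower k k[X] V]

/-- The map `a ↦ ∑ f_λ(a₁) g_{μ-λ}(a₂)`, where `d(a) = ∑ a₁ ⊗ a₂`. -/
def dualProductFamily (d : Coproduct k P) (f g : ConformalDual k P) : Family k P :=
  ⟨LinearMap.mul' k k[X][X] ∘ₗ TensorProduct.map (f.at X) (g.at (C X - X)) ∘ₗ d.toFun, by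
    intro a
    simp only [LinearMap.comp_apply, d.map_der]
    induction d.toFun a using TensorProduct.induction_on with
    | zero => simp
    | add x y hx hy => simp only [map_add, hx, hy, mul_add]
    | tmul x y =>
      simp only [der₂, LinearMap.add_apply, LinearMap.rTensor_tmul, LinearMap.lTensor_tmul,
        map_add, TensorProduct.map_tmul, LinearMap.mul'_apply, ConformalDual.at_der]
      ring⟩

lemma dualProductFamily_apply (d : Coproduct k P) (f g : ConformalDual k P) (a : P) :
    (dualProductFamily d f g).1 a =
      LinearMap.mul' k k[X][X] (TensorProduct.map (f.at X) (g.at (C X - X)) (d.toFun a)) := rfl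

/-- The λ-product on `P^{*c}` dual to the coproduct `d`:
`(f_λ g)_μ(a) = ∑ f_λ(a₁) g_{μ-λ}(a₂)`, where `d(a) = ∑ a₁ ⊗ a₂`. -/
def dualProduct [Module.Finite k[X] P] (d : Coproduct k P) :
    Conf k (ConformalDual k P) (ConformalDual k P) (ConformalDual k P) :=
  ⟨LinearMap.mk₂ k (fun f g => Family.toLam (dualProductFamily d f g))
    (fun f f' g => by
      rw [← map_add]
      refine congrArg _ (Subtype.ext (LinearMap.ext fun a => ?_))
      change _ = (dualProductFamily d f g).1 a + (dualProductFamily d f' g).1 a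
      simp only [dualProductFamily_apply, ConformalDual.add_at, TensorProduct.map_add_left,
        LinearMap.add_apply, map_add])
    (fun c f g => by
      rw [← map_smul]
      refine congrArg _ (Subtype.ext (LinearMap.ext fun a => ?_))
      change _ = c • (dualProductFamily d f g).1 a
      simp only [dualProductFamily_apply, ConformalDual.smul_at, TensorProduct.map_smul_left,
        LinearMap.smul_apply, map_smul])
    (fun f g g' => by
      rw [← map_add]
      refine congrArg _ (Subtype.ext (LinearMap.ext fun a => ?_))
      change _ = (dualProductFamily d f g).1 a + (dualProductFamily d f g').1 a
      simp only [dualProductFamily_apply, ConformalDual.add_at, TensorProduct.map_add_right,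
        LinearMap.add_apply, map_add])
    (fun c f g => by
      rw [← map_smul]
      refine congrArg _ (Subtype.ext (LinearMap.ext fun a => ?_))
      change _ = c • (dualProductFamily d f g).1 a
      simp only [dualProductFamily_apply, ConformalDual.smul_at, TensorProduct.map_smul_right,
        LinearMap.smul_apply, map_smul]), by
    have hL : ∀ f g a, (dualProductFamily d (der k _ f) g).1 a =
        -(X * (dualProductFamily d f g).1 a) := by
      intro f g a
      simp only [dualProductFamily_apply]
      induction d.toFun a using TensorProduct.induction_on with
      | zero => simp
      | add x y hx hy => simp only [map_add, hx, hy]; ring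
      | tmul x y =>
        simp only [TensorProduct.map_tmul, LinearMap.mul'_apply, ConformalDual.der_at]
        ring
    have hR : ∀ f g a, (dualProductFamily d f (der k _ g)).1 a =
        -((C X - X) * (dualProductFamily d f g).1 a) := by
      intro f g a
      simp only [dualProductFamily_apply]
      induction d.toFun a using TensorProduct.induction_on with
      | zero => simp
      | add x y hx hy => simp only [map_add, hx, hy]; ring
      | tmul x y =>
        simp only [TensorProduct.map_tmul, LinearMap.mul'_apply, ConformalDual.der_at]
        ring
    refine ⟨fun f g => ?_, fun f g => ?_⟩
    · simp only [LinearMap.mk₂_apply]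
      exact Family.toLam_left _ _ (hL f g)
    · simp only [LinearMap.mk₂_apply]
      refine Family.toLam_right _ _ fun a => ?_
      rw [hR]
      ring⟩

/-- The map `v ↦ -f_{μ-λ}(u_λ v)`. -/
def dualActionFamily (B : Conf k P V V) (u : P) (f : ConformalDual k V) : Family k V :=
  ⟨-(subst (f.at (C X - X)) (LinearMap.mulLeft k X) ∘ₗ B.1 u), by
    intro v
    have hc : Commute (LinearMap.mulLeft k (X : k[X][X])) (LinearMap.mulLeft k (C X - X)) := by
      refine LinearMap.ext fun p => ?_
      simp only [Module.End.mul_apply, LinearMap.mulLeft_apply]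
      ring
    simp only [LinearMap.neg_apply, LinearMap.comp_apply, B.2.2, LinearMap.add_apply, map_add,
      subst_lam]
    rw [subst_coeffwise _ _ _ _ hc (fun v => f.at_der _ v)]
    simp only [LinearMap.mulLeft_apply]
    ring⟩

lemma dualActionFamily_apply (B : Conf k P V V) (u : P) (f : ConformalDual k V) (v : V) :
    (dualActionFamily B u f).1 v =
      -subst (f.at (C X - X)) (LinearMap.mulLeft k X) (B.1 u v) := rfl

lemma subst_add_left {V W : Type*} [AddCommGroup V] [Module k V] [AddCommGroup W] [Module k W]
    (i j : V →ₗ[k] W) (T : Module.End k W) (p : Lam V) :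
    subst (i + j) T p = subst i T p + subst j T p := by
  induction p using Finsupp.induction_linear with
  | zero => simp
  | add p q hp hq => simp only [map_add, hp, hq]; abel
  | single n v => simp

lemma subst_smul_left {V W : Type*} [AddCommGroup V] [Module k V] [AddCommGroup W] [Module k W]
    (c : k) (i : V →ₗ[k] W) (T : Module.End k W) (p : Lam V) :
    subst (c • i) T p = c • subst i T p := by
  induction p using Finsupp.induction_linear with
  | zero => simp
  | add p q hp hq => simp only [map_add, hp, hq, smul_add]
  | single n v => simp

lemma subst_mul_left {V : Type*} [AddCommGroup V] [Module k V] (i j : V →ₗ[k] k[X][X])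
    (s c : k[X][X]) (h : ∀ v, j v = c * i v) (p : Lam V) :
    subst j (LinearMap.mulLeft k s) p = c * subst i (LinearMap.mulLeft k s) p := by
  induction p using Finsupp.induction_linear with
  | zero => simp
  | add p q hp hq => simp only [map_add, hp, hq, mul_add]
  | single n v =>
    simp only [subst_single, LinearMap.pow_mulLeft, LinearMap.mulLeft_apply, h]
    ring

/-- The dual `B*` of an action `B` of `P` on `V`, which is the action of `P` on `V^{*c}` given by
`(B*(u)_λ f)_μ v = -f_{μ-λ}(B(u)_λ v)`. -/
def dualAction [Module.Finite k[X] V] (B : Conf k P V V) :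
    Conf k P (ConformalDual k V) (ConformalDual k V) :=
  ⟨LinearMap.mk₂ k (fun u f => Family.toLam (dualActionFamily B u f))
    (fun u u' f => by
      rw [← map_add]
      refine congrArg _ (Subtype.ext (LinearMap.ext fun v => ?_))
      change _ = (dualActionFamily B u f).1 v + (dualActionFamily B u' f).1 v
      simp only [dualActionFamily_apply, map_add, LinearMap.add_apply, neg_add])
    (fun c u f => by
      rw [← map_smul]
      refine congrArg _ (Subtype.ext (LinearMap.ext fun v => ?_))
      change _ = c • (dualActionFamily B u f).1 v
      simp only [dualActionFamily_apply, map_smul, LinearMap.smul_apply, smul_neg])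
    (fun u f f' => by
      rw [← map_add]
      refine congrArg _ (Subtype.ext (LinearMap.ext fun v => ?_))
      change _ = (dualActionFamily B u f).1 v + (dualActionFamily B u f').1 v
      simp only [dualActionFamily_apply, ConformalDual.add_at, subst_add_left, neg_add])
    (fun c u f => by
      rw [← map_smul]
      refine congrArg _ (Subtype.ext (LinearMap.ext fun v => ?_))
      change _ = c • (dualActionFamily B u f).1 v
      simp only [dualActionFamily_apply, ConformalDual.smul_at]
      rw [subst_smul_left, smul_neg]), by
    refine ⟨fun u f => ?_, fun u f => ?_⟩
    · simp only [LinearMap.mk₂_apply]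
      refine Family.toLam_left _ _ fun v => ?_
      simp only [dualActionFamily_apply, B.2.1, map_neg, subst_lam, LinearMap.mulLeft_apply]
      ring
    · simp only [LinearMap.mk₂_apply]
      refine Family.toLam_right _ _ fun v => ?_
      have hf : ∀ v, (der k _ f).at (C X - X) v = (X - C X) * f.at (C X - X) v := by
        intro v
        rw [f.der_at]
        ring
      simp only [dualActionFamily_apply]
      rw [subst_mul_left _ _ _ _ hf]
      ring⟩

/-- `∑ f_λ(xᵢ) yᵢ` in `P[λ]`, for `z = ∑ xᵢ ⊗ yᵢ`. -/
def contractFst (f : ConformalDual k P) : P ⊗[k] P →ₗ[k] Lam P :=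
  TensorProduct.lift (((aeval (lam k P)).toLinearMap ∘ₗ f.toLin).compl₂ (const k P))

lemma contractFst_tmul (f : ConformalDual k P) (x y : P) :
    contractFst f (x ⊗ₜ[k] y) = aeval (lam k P) (f.toLin x) (const k P y) := rfl

/-- The action of `P^{*c}` on `P` by contraction with a coproduct `d`: `(f, a) ↦ ∑ f_λ(a₁) a₂`,
where `d(a) = ∑ a₁ ⊗ a₂`.

Its negative is the coadjoint action of `P^{*c}`, with the λ-product `dualProduct d`, on
`P = (P^{*c})^{*c}`, where `a` is identified with `f ↦ f_{-λ}(a)`: it is the only `ρ` with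
`g_{-μ}(ρ(f)_λ a) = -(f_λ g)_{λ-μ}(a)` for all `g`, as the right-hand side is
`-∑ f_λ(a₁) g_{-μ}(a₂)`. -/
def contraction (d : Coproduct k P) : Conf k (ConformalDual k P) P P :=
  ⟨LinearMap.mk₂ k (fun f a => contractFst f (d.toFun a))
    (fun f f' a => by
      induction d.toFun a using TensorProduct.induction_on with
      | zero => simp
      | add x y hx hy => simp only [map_add, hx, hy]; abel
      | tmul x y => simp [contractFst_tmul])
    (fun c f a => by
      induction d.toFun a using TensorProduct.induction_on with
      | zero => simp
      | add x y hx hy => simp only [map_add, hx, hy, smul_add]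
      | tmul x y => simp [contractFst_tmul])
    (fun f a a' => by simp only [map_add])
    (fun c f a => by simp only [map_smul]), by
    refine ⟨fun f a => ?_, fun f a => ?_⟩
    · simp only [LinearMap.mk₂_apply]
      induction d.toFun a using TensorProduct.induction_on with
      | zero => simp
      | add x y hx hy => simp only [map_add, hx, hy, neg_add]
      | tmul x y => simp [contractFst_tmul, der_conformalDual, dualDer_toLin]
    · simp only [LinearMap.mk₂_apply, d.map_der]
      induction d.toFun a using TensorProduct.induction_on with
      | zero => simp
      | add x y hx hy => simp only [map_add, hx, hy]
      | tmul x y =>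
        have h : ∀ p : k[X], aeval (lam k P) p (const k P (der k P y)) =
            coeffwise (der k P) (aeval (lam k P) p (const k P y)) := by
          intro p
          have hp : Commute (aeval (lam k P) p) (coeffwise (der k P)) := by
            induction p using Polynomial.induction_on' with
            | add p q hp hq => rw [map_add]; exact hp.add_left hq
            | monomial n c =>
              rw [aeval_monomial]
              exact (Algebra.commute_algebraMap_left c _).mul_left
                ((commute_lam (der k P)).pow_left n)
          have := LinearMap.congr_fun hp.eq (const k P y)
          simpa [const] using this
        simp [der₂, contractFst_tmul, ConformalDual.toLin_der, h, add_comm]⟩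

/-- `(f_λ g)_μ(a) = g_{μ-λ}(∑ f_λ(a₁) a₂)`: the contraction is the transpose of the left
multiplication by `f` in `dualProduct d`. -/
lemma dualProductFamily_eq_contraction (d : Coproduct k P) (f g : ConformalDual k P) (a : P) :
    (dualProductFamily d f g).1 a =
      subst (g.at (C X - X)) (LinearMap.mulLeft k X) ((contraction d).1 f a) := by
  have key : ∀ (p : k[X]) (y : P),
      subst (g.at (C X - X)) (LinearMap.mulLeft k X) (aeval (lam k P) p (const k P y)) =
        aeval (X : k[X][X]) p * g.at (C X - X) y := by
    intro p y
    induction p using Polynomial.induction_on' with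
    | add p q hp hq => simp only [map_add, LinearMap.add_apply, hp, hq, add_mul]
    | monomial n c =>
      have h : ∀ m : ℕ, ((lam k P) ^ m) (const k P y) = Finsupp.single m y := by
        intro m
        induction m with
        | zero => rfl
        | succ m ih => rw [pow_succ', Module.End.mul_apply, ih, lam_single]
      rw [aeval_monomial, aeval_monomial, Module.End.mul_apply, h, Module.algebraMap_end_apply,
        map_smul, subst_single, LinearMap.pow_mulLeft, LinearMap.mulLeft_apply,
        Algebra.smul_def, mul_assoc]
  change _ = subst _ _ (contractFst f (d.toFun a))
  rw [dualProductFamily_apply]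
  induction d.toFun a using TensorProduct.induction_on with
  | zero => simp
  | add x y hx hy => simp only [map_add, hx, hy]
  | tmul x y =>
    rw [contractFst_tmul, key, TensorProduct.map_tmul, LinearMap.mul'_apply]
    rfl

/-! ### The double -/

variable {Q : Type*} [AddCommGroup Q] [Module k Q] [Module k[X] Q] [IsScalarTower k k[X] Q]

/-- The λ-product on `P ⊕ Q` built from λ-products on `P` and `Q`, actions `s` of `P` on `Q` and
`t` of `Q` on `P`, and a sign `ε`:
`(a + x)_λ (b + y) = (a_λ b + t(x)_λ b + ε t(y)_{-λ-∂} a) + (x_λ y + s(a)_λ y + ε s(b)_{-λ-∂} x)`.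
The sign is `-1` for Lie brackets and `1` for commutative products. -/
def bicross (ε : k) (m : Conf k P P P) (n : Conf k Q Q Q) (s : Conf k P Q Q) (t : Conf k Q P P) :
    Conf k (P × Q) (P × Q) (P × Q) :=
  let p₁ := LinearMap.fst k[X] P Q
  let p₂ := LinearMap.snd k[X] P Q
  let i₁ := LinearMap.inl k[X] P Q
  let i₂ := LinearMap.inr k[X] P Q
  (pull m p₁ p₁ i₁ + pull t p₂ p₁ i₁ + ε • pull (opp t) p₁ p₂ i₁) +
    (pull n p₂ p₂ i₂ + pull s p₁ p₂ i₂ + ε • pull (opp s) p₂ p₁ i₂)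

/-- The λ-bracket on `P ⊕ P^{*c}`: the matched pair of `(P, [·_λ ·])` and `P^{*c}`, with the
λ-bracket dual to `δ`, for the two coadjoint actions `ad*`. -/
def doubleBracket [Module.Finite k[X] P] (br : Conf k P P P) (δ : Coproduct k P) :
    Conf k (P × ConformalDual k P) (P × ConformalDual k P) (P × ConformalDual k P) :=
  bicross (-1) br (dualProduct δ) (dualAction br) ((-1 : k) • contraction δ)

/-- The λ-product on `P ⊕ P^{*c}`: the matched pair of `(P, ·_λ ·)` and `P^{*c}`, with the
λ-product dual to `Δ`, for the two actions `-L*`, where `L(a)_λ b = a_λ b`. -/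
def doubleProduct [Module.Finite k[X] P] (mul : Conf k P P P) (Δ : Coproduct k P) :
    Conf k (P × ConformalDual k P) (P × ConformalDual k P) (P × ConformalDual k P) :=
  bicross 1 mul (dualProduct Δ) ((-1 : k) • dualAction mul) (contraction Δ)

/-- The member `eᵢ*` of the dual `k[∂]`-basis, `eᵢ*_λ (∑ pⱼ(∂) eⱼ) = pᵢ(λ)`. -/
def dualBasis {ι : Type*} (e : Module.Basis ι k[X] P) (i : ι) : ConformalDual k P :=
  ⟨(e.coord i).restrictScalars k, fun b => (e.coord i).map_smul X b⟩

/-- `r = ∑ eᵢ ⊗ eᵢ*` in `(P ⊕ P^{*c}) ⊗ (P ⊕ P^{*c})`. -/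
def canonicalTensor {n : ℕ} (e : Module.Basis (Fin n) k[X] P) :
    (P × ConformalDual k P) ⊗[k] (P × ConformalDual k P) :=
  ∑ i, (e i, (0 : ConformalDual k P)) ⊗ₜ[k] ((0 : P), dualBasis e i)

end Double

end PoissonConformal

end

/-! The proof is the Manin triple argument, carried out in coordinates.

Coordinates. For a `k[∂]`-basis `eᵢ`, evaluate `λ` and `∂` at scalars. Sesquilinearity says that in
`a_λ b` the value of `λ` is the value of `-∂` on `a`, and that the value of `-∂` on the result is
the sum of its values on `a` and `b`; coproducts split values in the same way. So every leg of an
operation carries an index and a scalar, the scalars are conserved, and a conformal bialgebra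
behaves like an ordinary finite-dimensional one with structure constants depending on these scalars.
As `k` is infinite, evaluations separate polynomials, and the axioms are equivalent to scalar
identities (`Frame.isPoissonConformalBialgebra_iff`).

Forms. The pairing of `P` with `P^{*c}` turns a product on the double into a trilinear form `T(x, y,
z) = ⟨xy, z⟩`. The products in the theorem are those whose forms, `S` for the bracket and `T` for
the product, change by the sign `ε` (`-1` for `S`, `1` for `T`) under each transposition and vanish
on three vectors and on three covectors (`triform`, `sc_double`). Contracting two forms along dual
bases gives functions of four legs, written `(xy|zw)` below. Three identities hold for them: the
cyclic sum of `(xy|zw)` over `x, y, z` vanishes for `S, S`; the three pairings `(xy|zw)`, `(yz|xw)`,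
`(xz|yw)` agree for `T, T`; and the sum of `(xy|zw)` over the cyclic permutations of `y, z, w`
vanishes for `S, T`. Sorted by the number of covectors among the legs, their cases are exactly the
algebra axioms, the compatibility conditions and the coalgebra axioms of `P` (`glue_jacobi`,
`glue_assoc`, `glue_leibniz`).

Double. The coboundary of `r` has the same form as its structure constants, multiplied by a weight
that is `1` on two vectors, `-1` on two covectors and `0` otherwise (`dsc_coboundary`). The weights
on the two sides of a contraction add up to a constant (`typeWeight_swap`), so each axiom of the
double is a multiple of one of the three identities (`IsBialgebraConstants.double`). Finally, a
change of basis does not affect the coboundary of `r`, since `r` is evaluated only on functionals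
with opposite values of `∂` (`coboundary_canonicalTensor_eq`). -/

open Polynomial TensorProduct

noncomputable section

namespace PoissonConformal

/-! ### Evaluation functionals -/

section Eval

variable {k : Type*} [Field k]
  {V : Type*} [AddCommGroup V] [Module k V] {W : Type*} [AddCommGroup W] [Module k W]

/-- The functional `∑ λⁿ vₙ ↦ ∑ tⁿ φ(vₙ)` on `V[λ]`. -/
def ev (φ : V →ₗ[k] k) (t : k) : Lam V →ₗ[k] k := subst φ (t • LinearMap.id)

@[simp] lemma ev_single (φ : V →ₗ[k] k) (t : k) (n : ℕ) (v : V) :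
    ev φ t (Finsupp.single n v) = t ^ n * φ v := by
  have h : ∀ n : ℕ, ∀ x : k, ((t • LinearMap.id : k →ₗ[k] k) ^ n) x = t ^ n * x := by
    intro n
    induction n with
    | zero => simp
    | succ n ih => intro x; rw [pow_succ', Module.End.mul_apply, ih]; simp; ring
  simp [ev, h]

/-- A functional that turns the operator `T` into the scalar `t` turns the substitution `λ ↦ T` into
evaluation at `t`. This removes the substitutions `λ + μ`, `-λ - ∂` and `-∂^{⊗2}` from the axioms.
-/
lemma apply_subst (Φ : W →ₗ[k] k) (ι : V →ₗ[k] W) (T : Module.End k W) (t : k)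
    (h : ∀ w, Φ (T w) = t * Φ w) (x : Lam V) : Φ (subst ι T x) = ev (Φ ∘ₗ ι) t x := by
  have hn : ∀ n : ℕ, ∀ w, Φ ((T ^ n) w) = t ^ n * Φ w := by
    intro n
    induction n with
    | zero => simp
    | succ n ih => intro w; rw [pow_succ', Module.End.mul_apply, h, ih]; ring
  induction x using Finsupp.induction_linear with
  | zero => simp
  | add p q hp hq => simp only [map_add, hp, hq]
  | single n v => simp [hn]

lemma ev_lam (φ : V →ₗ[k] k) (t : k) (x : Lam V) : ev φ t (lam k V x) = t * ev φ t x := by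
  simp [ev, subst_lam]

lemma ev_coeffwise (φ : W →ₗ[k] k) (t : k) (f : V →ₗ[k] W) (x : Lam V) :
    ev φ t (coeffwise f x) = ev (φ ∘ₗ f) t x := by
  induction x using Finsupp.induction_linear with
  | zero => simp
  | add p q hp hq => simp only [map_add, hp, hq]
  | single n v => simp

lemma ev_const (φ : V →ₗ[k] k) (t : k) : ev φ t ∘ₗ const k V = φ := by
  ext v; simp [const]

lemma ev_add (φ ψ : V →ₗ[k] k) (t : k) (x : Lam V) : ev (φ + ψ) t x = ev φ t x + ev ψ t x :=
  subst_add_left _ _ _ _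

lemma ev_smul (c : k) (φ : V →ₗ[k] k) (t : k) (x : Lam V) : ev (c • φ) t x = c * ev φ t x :=
  subst_smul_left _ _ _ _

lemma ev_zero (t : k) (x : Lam V) : ev (0 : V →ₗ[k] k) t x = 0 := by
  simpa using ev_smul (0 : k) (0 : V →ₗ[k] k) t x

lemma ev_sum {κ : Type*} (s : Finset κ) (φ : κ → V →ₗ[k] k) (t : k) (x : Lam V) :
    ev (∑ j ∈ s, φ j) t x = ∑ j ∈ s, ev (φ j) t x := by
  classical
  induction s using Finset.induction_on with
  | empty => simp [ev_zero]
  | insert a s ha ih => rw [Finset.sum_insert ha, Finset.sum_insert ha, ev_add, ih]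

/-- The functional `x ⊗ y ↦ φ(x) ψ(y)`. -/
def tev (φ : V →ₗ[k] k) (ψ : W →ₗ[k] k) : V ⊗[k] W →ₗ[k] k :=
  LinearMap.mul' k k ∘ₗ TensorProduct.map φ ψ

@[simp] lemma tev_tmul (φ : V →ₗ[k] k) (ψ : W →ₗ[k] k) (x : V) (y : W) :
    tev φ ψ (x ⊗ₜ[k] y) = φ x * ψ y := by
  simp [tev]

lemma tev_sum_left {κ : Type*} (s : Finset κ) (c : κ → k) (φ : κ → V →ₗ[k] k) (ψ : W →ₗ[k] k)
    (z : V ⊗[k] W) : tev (∑ j ∈ s, c j • φ j) ψ z = ∑ j ∈ s, c j * tev (φ j) ψ z := by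
  induction z using TensorProduct.induction_on with
  | zero => simp
  | add x y hx hy => simp only [map_add, hx, hy, mul_add, Finset.sum_add_distrib]
  | tmul x y => simp [Finset.sum_mul, mul_assoc]

lemma tev_sum_right {κ : Type*} (s : Finset κ) (c : κ → k) (φ : V →ₗ[k] k) (ψ : κ → W →ₗ[k] k)
    (z : V ⊗[k] W) : tev φ (∑ j ∈ s, c j • ψ j) z = ∑ j ∈ s, c j * tev φ (ψ j) z := by
  induction z using TensorProduct.induction_on with
  | zero => simp
  | add x y hx hy => simp only [map_add, hx, hy, mul_add, Finset.sum_add_distrib]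
  | tmul x y => simp [Finset.mul_sum, mul_left_comm]

/-- A family of functionals separating the points of `V`. -/
def Separating {κ : Type*} (Φ : κ → V →ₗ[k] k) : Prop := ∀ v, (∀ j, Φ j v = 0) → v = 0

lemma Separating.ext {κ : Type*} {Φ : κ → V →ₗ[k] k} (h : Separating Φ) {v w : V}
    (hvw : ∀ j, Φ j v = Φ j w) : v = w :=
  sub_eq_zero.mp (h _ fun j => by rw [map_sub, hvw, sub_self])

/-- For a fixed functional the values are those of a polynomial in `t`, and over an infinite field a
polynomial with no nonzero value is zero. -/
lemma Separating.ev [Infinite k] {κ : Type*} {Φ : κ → V →ₗ[k] k} (h : Separating Φ) :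
    Separating fun x : κ × k => ev (Φ x.1) x.2 := by
  intro v hv
  refine Finsupp.ext fun n => h _ fun j => ?_
  have key : ∀ t : k, ∀ v : Lam V, PoissonConformal.ev (Φ j) t v =
      Polynomial.eval t (v.sum fun n w => Polynomial.monomial n (Φ j w)) := by
    intro t v
    induction v using Finsupp.induction_linear with
    | zero => simp
    | add p q hp hq =>
      rw [map_add, hp, hq, Finsupp.sum_add_index' (by simp) (by simp), Polynomial.eval_add]
    | single n w => simp [mul_comm]
  have h0 : (v.sum fun n w => Polynomial.monomial n (Φ j w)) = 0 := by
    refine Polynomial.funext fun t => ?_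
    rw [← key, hv (j, t), Polynomial.eval_zero]
  have := congrArg (fun q => Polynomial.coeff q n) h0
  simp only [Finsupp.sum, Polynomial.finsetSum_coeff, Polynomial.coeff_monomial,
    Polynomial.coeff_zero, Finset.sum_ite_eq'] at this
  by_cases hn : v n = 0
  · rw [hn, map_zero]
  · rwa [if_pos (Finsupp.mem_support_iff.mpr hn)] at this

lemma Separating.tev {κ κ' : Type*} {Φ : κ → V →ₗ[k] k} {Ψ : κ' → W →ₗ[k] k}
    (hΦ : Separating Φ) (hΨ : Separating Ψ) :
    Separating fun x : κ × κ' => tev (Φ x.1) (Ψ x.2) := by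
  classical
  intro z hz
  -- Write `z = ∑ bᵢ ⊗ wᵢ`. Then `Ψⱼ(wᵢ)` is the `i`-th coordinate of `(I ⊗ Ψⱼ) z`, a vector of `V`
  -- that all `Φₐ` annihilate by hypothesis.
  let b := Module.Basis.ofVectorSpace k V
  have key : ∀ j i, ∀ z : V ⊗[k] W,
      Ψ j (TensorProduct.equivFinsuppOfBasisLeft (N := W) b z i) =
        b.repr (TensorProduct.rid k V ((Ψ j).lTensor V z)) i := by
    intro j i z
    induction z using TensorProduct.induction_on with
    | zero => simp
    | add x y hx hy => simp only [map_add, Finsupp.add_apply, hx, hy]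
    | tmul x y => simp [mul_comm]
  have key' : ∀ a j, ∀ z : V ⊗[k] W,
      Φ a (TensorProduct.rid k V ((Ψ j).lTensor V z)) = PoissonConformal.tev (Φ a) (Ψ j) z := by
    intro a j z
    induction z using TensorProduct.induction_on with
    | zero => simp
    | add x y hx hy => simp only [map_add, hx, hy]
    | tmul x y => simp [mul_comm]
  refine (TensorProduct.equivFinsuppOfBasisLeft (N := W) b).map_eq_zero_iff.mp
    (Finsupp.ext fun i => hΨ _ fun j => ?_)
  rw [key, hΦ _ fun a => (key' a j z).trans (hz (a, j))]
  simp

end Eval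

/-! ### Frames -/

/-- A `k[∂]`-basis `vec`, with the functionals `coef i s`: the `i`-th coordinate at `∂ = -s`. -/
structure Frame (k : Type*) [Field k] (U : Type*) [AddCommGroup U] [Module k U] [Module k[X] U]
    [IsScalarTower k k[X] U] (ι : Type*) [DecidableEq ι] where
  vec : ι → U
  coef : ι → k → U →ₗ[k] k
  coef_der : ∀ i s u, coef i s (der k U u) = -s * coef i s u
  coef_vec : ∀ i s j, coef i s (vec j) = if i = j then 1 else 0
  separating : Separating fun x : ι × k => coef x.1 x.2
  span : ⊤ ≤ Submodule.span k[X] (Set.range vec)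

section Frame

variable {k : Type*} [Field k]
  {U : Type*} [AddCommGroup U] [Module k U] [Module k[X] U] [IsScalarTower k k[X] U]
  {ι : Type*} [Fintype ι] [DecidableEq ι]

lemma apply_polySmul (φ : U →ₗ[k] k) (s : k) (h : ∀ u, φ (der k U u) = s * φ u) (p : k[X])
    (u : U) : φ (p • u) = p.eval s * φ u := by
  induction p using Polynomial.induction_on' with
  | add p q hp hq => rw [add_smul, map_add, hp, hq, eval_add, add_mul]
  | monomial n c =>
    have h : ∀ m : ℕ, φ ((X ^ m : k[X]) • u) = s ^ m * φ u := by
      intro m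
      induction m with
      | zero => simp
      | succ m ih =>
        have := h ((X ^ m : k[X]) • u)
        rw [ih] at this
        rw [pow_succ', mul_smul, pow_succ', mul_assoc]
        exact this
    rw [← smul_X_eq_monomial, smul_assoc, map_smul, h]
    simp [mul_assoc]

/-- Such a `φ` factors through the fibre `U / (∂ + s)U`, which the vectors of the frame span and on
which the `coef i s` are the dual basis. Applied to the middle leg of a composite, this is the
insertion of a complete set of intermediate vectors. -/
lemma Frame.expand (F : Frame k U ι) (φ : U →ₗ[k] k) (s : k)
    (h : ∀ u, φ (der k U u) = -s * φ u) : φ = ∑ i, φ (F.vec i) • F.coef i s := by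
  refine LinearMap.ext fun u => ?_
  have hu : u ∈ Submodule.span k[X] (Set.range F.vec) := F.span Submodule.mem_top
  induction hu using Submodule.span_induction with
  | mem x hx =>
    obtain ⟨j, rfl⟩ := hx
    simp [F.coef_vec]
  | zero => simp
  | add x y _ _ hx hy => rw [map_add, map_add, hx, hy]
  | smul p x _ hx =>
    rw [apply_polySmul φ _ h, hx]
    simp only [LinearMap.sum_apply, LinearMap.smul_apply, smul_eq_mul, Finset.mul_sum,
      apply_polySmul _ _ (F.coef_der _ _)]
    exact Finset.sum_congr rfl fun i _ => by ring

lemma Frame.expand_apply (F : Frame k U ι) (φ : U →ₗ[k] k) (s : k)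
    (h : ∀ u, φ (der k U u) = -s * φ u) (u : U) :
    φ u = ∑ i, F.coef i s u * φ (F.vec i) := by
  conv_lhs => rw [F.expand φ s h]
  simp [mul_comm]

/-- The function `a ↦ ∑ aᵢ(p) Nᵢ`. -/
def Frame.uni (F : Frame k U ι) (p : k) (a : U) (N : ι → k) : k := ∑ i, F.coef i p a * N i

/-- The function `(a, b) ↦ ∑ aᵢ(p) bⱼ(q) Nᵢⱼ`. -/
def Frame.bi (F : Frame k U ι) (p q : k) (a b : U) (N : ι → ι → k) : k :=
  F.uni p a fun i => F.uni q b (N i)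

/-- The function `(a, b, c) ↦ ∑ aᵢ(p) bⱼ(q) cₗ(r) Nᵢⱼₗ`. -/
def Frame.tri (F : Frame k U ι) (p q r : k) (a b c : U) (N : ι → ι → ι → k) : k :=
  F.uni p a fun i => F.bi q r b c (N i)

@[simp] lemma Frame.uni_vec (F : Frame k U ι) (p : k) (i : ι) (N : ι → k) :
    F.uni p (F.vec i) N = N i := by
  simp [Frame.uni, F.coef_vec]

@[simp] lemma Frame.bi_vec (F : Frame k U ι) (p q : k) (i j : ι) (N : ι → ι → k) :
    F.bi p q (F.vec i) (F.vec j) N = N i j := by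
  simp [Frame.bi]

@[simp] lemma Frame.tri_vec (F : Frame k U ι) (p q r : k) (i j l : ι) (N : ι → ι → ι → k) :
    F.tri p q r (F.vec i) (F.vec j) (F.vec l) N = N i j l := by
  simp [Frame.tri]

lemma Frame.uni_add (F : Frame k U ι) (p : k) (a : U) (N M : ι → k) :
    F.uni p a N + F.uni p a M = F.uni p a (fun i => N i + M i) := by
  simp [Frame.uni, mul_add, Finset.sum_add_distrib]

lemma Frame.uni_neg (F : Frame k U ι) (p : k) (a : U) (N : ι → k) :
    -F.uni p a N = F.uni p a (fun i => -N i) := by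
  simp [Frame.uni]

lemma Frame.uni_sub (F : Frame k U ι) (p : k) (a : U) (N M : ι → k) :
    F.uni p a N - F.uni p a M = F.uni p a (fun i => N i - M i) := by
  simp [Frame.uni, mul_sub, Finset.sum_sub_distrib]

lemma Frame.uni_sum (F : Frame k U ι) (p : k) (a : U) {κ : Type*} (s : Finset κ)
    (N : κ → ι → k) : ∑ m ∈ s, F.uni p a (N m) = F.uni p a (fun i => ∑ m ∈ s, N m i) := by
  simp only [Frame.uni, Finset.mul_sum]
  exact Finset.sum_comm

lemma Frame.mul_uni (F : Frame k U ι) (p : k) (a : U) (c : k) (N : ι → k) :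
    c * F.uni p a N = F.uni p a (fun i => c * N i) := by
  simp only [Frame.uni, Finset.mul_sum]
  exact Finset.sum_congr rfl fun i _ => by ring

lemma Frame.uni_mul (F : Frame k U ι) (p : k) (a : U) (c : k) (N : ι → k) :
    F.uni p a N * c = F.uni p a (fun i => N i * c) := by
  simp only [Frame.uni, Finset.sum_mul]
  exact Finset.sum_congr rfl fun i _ => by ring

lemma Frame.uni_comm (F : Frame k U ι) (p q : k) (a b : U) (N : ι → ι → k) :
    (F.uni p a fun i => F.uni q b fun j => N i j) =
      F.uni q b fun j => F.uni p a fun i => N i j := by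
  simp only [Frame.uni, Finset.mul_sum]
  rw [Finset.sum_comm]
  exact Finset.sum_congr rfl fun i _ => Finset.sum_congr rfl fun j _ => by ring

/-- The structure constants of a conformal sesquilinear map: the `m`-th coordinate of
`(eᵢ)_λ eⱼ` at `λ = p`, `∂ = -p - q`. -/
def Frame.sc (F : Frame k U ι) (B : Conf k U U U) (i j m : ι) (p q : k) : k :=
  ev (F.coef m (p + q)) p (B.1 (F.vec i) (F.vec j))

/-- The structure constants of a coproduct: the coordinate of `d(eₘ)` at `eᵢ ⊗ eⱼ`, where
`∂ ⊗ I = -p` and `I ⊗ ∂ = -q`. -/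
def Frame.dsc (F : Frame k U ι) (d : Coproduct k U) (m i j : ι) (p q : k) : k :=
  tev (F.coef i p) (F.coef j q) (d.toFun (F.vec m))

lemma ev_conf_left (B : Conf k U U U) (φ : U →ₗ[k] k) (p : k) (a b : U) :
    ev φ p (B.1 (der k U a) b) = -p * ev φ p (B.1 a b) := by
  rw [B.2.1, map_neg, ev_lam]; ring

/-- Conservation: with `λ = p` and `∂ = -(p + q)` on the result, `∂ + λ` is `-q`, which is thus the
value of `∂` on the second argument. -/
lemma ev_conf_right (B : Conf k U U U) (φ : U →ₗ[k] k) (p q : k)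
    (h : ∀ u, φ (der k U u) = -(p + q) * φ u) (a b : U) :
    ev φ p (B.1 a (der k U b)) = -q * ev φ p (B.1 a b) := by
  have hφ : φ ∘ₗ der k U = (-(p + q)) • φ := LinearMap.ext h
  rw [B.2.2, LinearMap.add_apply, map_add, ev_lam, ev_coeffwise, hφ, ev_smul]; ring

lemma Frame.ev_conf_right (F : Frame k U ι) (B : Conf k U U U) (φ : U →ₗ[k] k) (p q : k)
    (h : ∀ u, φ (der k U u) = -(p + q) * φ u) (a b : U) :
    ev φ p (B.1 a b) = F.uni q b fun j => ev φ p (B.1 a (F.vec j)) :=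
  F.expand_apply (ev φ p ∘ₗ B.1 a) q (PoissonConformal.ev_conf_right B φ p q h a) b

lemma Frame.ev_conf_left (F : Frame k U ι) (B : Conf k U U U) (φ : U →ₗ[k] k) (p : k) (a b : U) :
    ev φ p (B.1 a b) = F.uni p a fun i => ev φ p (B.1 (F.vec i) b) :=
  F.expand_apply (ev φ p ∘ₗ B.1.flip b) p (fun u => PoissonConformal.ev_conf_left B φ p u b) a

lemma Frame.ev_conf (F : Frame k U ι) (B : Conf k U U U) (m : ι) (p q : k) (a b : U) :
    ev (F.coef m (p + q)) p (B.1 a b) = F.bi p q a b fun i j => F.sc B i j m p q := by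
  rw [F.ev_conf_left, Frame.bi]
  refine congrArg _ (funext fun i => ?_)
  rw [F.ev_conf_right _ _ _ q (F.coef_der _ _)]
  rfl

lemma tev_der₂ (φ ψ : U →ₗ[k] k) (p q : k) (hφ : ∀ u, φ (der k U u) = -p * φ u)
    (hψ : ∀ u, ψ (der k U u) = -q * ψ u) (z : U ⊗[k] U) :
    tev φ ψ (der₂ k U z) = -(p + q) * tev φ ψ z := by
  induction z using TensorProduct.induction_on with
  | zero => simp
  | add x y hx hy => simp only [map_add, hx, hy]; ring
  | tmul x y => simp [der₂, hφ, hψ]; ring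

omit [Fintype ι] in
lemma Frame.tev_der₂ (F : Frame k U ι) (i j : ι) (p q : k) (z : U ⊗[k] U) :
    tev (F.coef i p) (F.coef j q) (der₂ k U z) = -(p + q) * tev (F.coef i p) (F.coef j q) z :=
  PoissonConformal.tev_der₂ _ _ _ _ (F.coef_der _ _) (F.coef_der _ _) z

lemma Frame.tev_coproduct (F : Frame k U ι) (d : Coproduct k U) (i j : ι) (p q : k) (a : U) :
    tev (F.coef i p) (F.coef j q) (d.toFun a) =
      F.uni (p + q) a fun m => F.dsc d m i j p q :=
  F.expand_apply (tev (F.coef i p) (F.coef j q) ∘ₗ d.toFun) (p + q)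
    (fun u => by
      simp only [LinearMap.comp_apply]
      rw [d.map_der, F.tev_der₂]) a

end Frame

/-! ### The axioms of Poisson conformal algebras in terms of structure constants -/

section AlgebraAxioms

variable {k : Type*} [Field k]
  {U : Type*} [AddCommGroup U] [Module k U] [Module k[X] U] [IsScalarTower k k[X] U]
  {ι : Type*} [Fintype ι] [DecidableEq ι]

omit [Module k[X] U] [IsScalarTower k k[X] U] in
lemma ev_lam₂ (φ : U →ₗ[k] k) (p q : k) (x : Lam2 U) :
    ev (ev φ q) p (lam₂ k U x) = p * ev (ev φ q) p x :=
  ev_lam _ _ _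

omit [Module k[X] U] [IsScalarTower k k[X] U] in
lemma ev_mu₂ (φ : U →ₗ[k] k) (p q : k) (x : Lam2 U) :
    ev (ev φ q) p (mu₂ k U x) = q * ev (ev φ q) p x := by
  have h : ev φ q ∘ₗ lam k U = q • ev φ q := LinearMap.ext fun x => ev_lam _ _ _
  rw [mu₂, ev_coeffwise, h, ev_smul]

omit [Module k[X] U] [IsScalarTower k k[X] U] in
lemma ev_lam₂_add_mu₂ (φ : U →ₗ[k] k) (p q : k) (x : Lam2 U) :
    ev (ev φ q) p ((lam₂ k U + mu₂ k U) x) = (p + q) * ev (ev φ q) p x := by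
  rw [LinearMap.add_apply, map_add, ev_lam₂, ev_mu₂, add_mul]

omit [Module k[X] U] [IsScalarTower k k[X] U] in
lemma ev_const₂ (φ : U →ₗ[k] k) (p q : k) : ev (ev φ q) p ∘ₗ const₂ k U = φ := by
  rw [const₂, ← LinearMap.comp_assoc, ev_const, ev_const]

lemma ev_mulAt (B : Conf k U U U) (s : Module.End k (Lam2 U)) (φ : U →ₗ[k] k) (p q t : k)
    (h : ∀ x, ev (ev φ q) p (s x) = t * ev (ev φ q) p x) (a b : U) :
    ev (ev φ q) p (mulAt B s a b) = ev φ t (B.1 a b) := by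
  change ev (ev φ q) p (subst (const₂ k U) s (B.1 a b)) = _
  rw [apply_subst _ _ _ t h, ev_const₂]

/-- At `λ = p` and `∂ = -(p + q)` the operator `-λ - ∂` has the value `q`: passing to the opposite
exchanges the scalars of the two arguments. -/
lemma ev_opp {V W : Type*} [AddCommGroup V] [Module k V] [Module k[X] V] [IsScalarTower k k[X] V]
    [AddCommGroup W] [Module k W] [Module k[X] W] [IsScalarTower k k[X] W]
    (B : Conf k U V W) (φ : W →ₗ[k] k) (p q : k)
    (h : ∀ u, φ (der k W u) = -(p + q) * φ u) (a : V) (b : U) :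
    ev φ p ((opp B).1 a b) = ev φ q (B.1 b a) := by
  change ev φ p (subst (const k W) (-lam k W - coeffwise (der k W)) (B.1 b a)) = _
  have hφ : φ ∘ₗ der k W = (-(p + q)) • φ := LinearMap.ext h
  rw [apply_subst _ _ _ q, ev_const]
  intro w
  rw [LinearMap.sub_apply, LinearMap.neg_apply, map_sub, map_neg, ev_lam, ev_coeffwise, hφ, ev_smul]
  ring

omit [Fintype ι] in
lemma Frame.sc_opp (F : Frame k U ι) (B : Conf k U U U) (i j m : ι) (p q : k) :
    F.sc (opp B) i j m p q = F.sc B j i m q p := by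
  rw [Frame.sc, ev_opp _ _ p q (F.coef_der _ _), Frame.sc, add_comm q p]

lemma Frame.tri_swap (F : Frame k U ι) (p q r : k) (a b c : U) (N : ι → ι → ι → k) :
    F.tri q p r b a c N = F.tri p q r a b c fun i j => N j i := by
  simp only [Frame.tri, Frame.bi]
  rw [F.uni_comm]

lemma Frame.ev_nestL (F : Frame k U ι) (B B' : Conf k U U U) (n : ι) (p q r : k) (a b c : U) :
    ev (ev (F.coef n (p + q + r)) q) p (nestL B B' (lam₂ k U) (lam₂ k U + mu₂ k U) a b c) =
      F.tri p q r a b c fun i j l => ∑ m, F.sc B i j m p q * F.sc B' m l n (p + q) r := by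
  rw [nestL, apply_subst (ev (ev (F.coef n (p + q + r)) q) p) _ _ p (ev_lam₂ _ _ _)]
  have h : ev (ev (F.coef n (p + q + r)) q) p ∘ₗ (mulAt B' (lam₂ k U + mu₂ k U)).flip c =
      ev (F.coef n (p + q + r)) (p + q) ∘ₗ B'.1.flip c :=
    LinearMap.ext fun u => ev_mulAt B' _ _ p q (p + q) (ev_lam₂_add_mu₂ _ p q) u c
  -- The inner product `a_λ b` carries the value `p + q` of `-∂`; its coordinates at this value are
  -- the intermediate index `m`.
  rw [h, F.expand (ev (F.coef n (p + q + r)) (p + q) ∘ₗ B'.1.flip c) (p + q)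
    fun u => PoissonConformal.ev_conf_left B' _ (p + q) u c, ev_sum]
  simp only [LinearMap.comp_apply, LinearMap.flip_apply, ev_smul, F.ev_conf, Frame.bi,
    Frame.uni_vec, Frame.mul_uni, Frame.uni_mul, Frame.uni_sum, Frame.tri]
  refine congrArg _ (funext fun i => congrArg _ (funext fun j => congrArg _ (funext fun l => ?_)))
  exact Finset.sum_congr rfl fun m _ => mul_comm _ _

/-- The operators `s`, `t` and their values `p'`, `q'` are kept general in order to cover both
`a_λ(b_μ c)` and `b_μ(a_λ c)`. -/
lemma Frame.ev_nestR (F : Frame k U ι) (B B' : Conf k U U U) (s t : Module.End k (Lam2 U))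
    (n : ι) (p q p' q' r u : k) (hu : u = p' + (q' + r))
    (hs : ∀ x, ev (ev (F.coef n u) q) p (s x) = p' * ev (ev (F.coef n u) q) p x)
    (ht : ∀ x, ev (ev (F.coef n u) q) p (t x) = q' * ev (ev (F.coef n u) q) p x)
    (a b c : U) :
    ev (ev (F.coef n u) q) p (nestR B B' s t a b c) =
      F.tri p' q' r a b c fun i j l => ∑ m, F.sc B' j l m q' r * F.sc B i m n p' (q' + r) := by
  rw [nestR, apply_subst (ev (ev (F.coef n u) q) p) _ _ q' ht]
  have h : ev (ev (F.coef n u) q) p ∘ₗ mulAt B s a = ev (F.coef n u) p' ∘ₗ B.1 a :=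
    LinearMap.ext fun u => ev_mulAt _ _ _ _ _ _ hs _ _
  rw [h, F.expand (ev (F.coef n u) p' ∘ₗ B.1 a) (q' + r)
    fun v => PoissonConformal.ev_conf_right B _ _ _ (fun w => by rw [F.coef_der, hu]) _ _, ev_sum]
  subst hu
  simp only [LinearMap.comp_apply, ev_smul, F.ev_conf, Frame.bi,
    Frame.uni_vec, Frame.mul_uni, Frame.uni_mul, Frame.uni_sum, Frame.tri]
  -- The inner product is expanded first, which leaves the sum over the coordinates of `a`
  -- innermost; `tri` wants it outermost.
  have : ∀ N : ι → ι → ι → k, (F.uni q' b fun j => F.uni r c fun l => F.uni p' a fun i => N i j l) =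
      F.uni p' a fun i => F.uni q' b fun j => F.uni r c fun l => N i j l := by
    intro N
    rw [F.uni_comm p' q']
    refine congrArg _ (funext fun j => ?_)
    rw [F.uni_comm p' r]
  rw [this]
  refine congrArg _ (funext fun i => congrArg _ (funext fun j => congrArg _ (funext fun l => ?_)))
  exact Finset.sum_congr rfl fun m _ => mul_comm _ _

lemma Frame.ev_nestR_left (F : Frame k U ι) (B B' : Conf k U U U) (n : ι) (p q r : k)
    (a b c : U) :
    ev (ev (F.coef n (p + q + r)) q) p (nestR B B' (lam₂ k U) (mu₂ k U) a b c) =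
      F.tri p q r a b c fun i j l => ∑ m, F.sc B' j l m q r * F.sc B i m n p (q + r) :=
  F.ev_nestR _ _ _ _ _ _ _ _ _ _ _ (by ring) (ev_lam₂ _ _ _) (ev_mu₂ _ _ _) _ _ _

lemma Frame.ev_nestR_right (F : Frame k U ι) (B B' : Conf k U U U) (n : ι) (p q r : k)
    (a b c : U) :
    ev (ev (F.coef n (p + q + r)) q) p (nestR B B' (mu₂ k U) (lam₂ k U) b a c) =
      F.tri p q r a b c fun i j l => ∑ m, F.sc B' i l m p r * F.sc B j m n q (p + r) :=
  (F.ev_nestR _ _ _ _ _ _ _ _ _ _ _ (by ring) (ev_mu₂ _ _ _) (ev_lam₂ _ _ _) _ _ _).trans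
    (F.tri_swap _ _ _ _ _ _ _)

variable [Infinite k]

omit [Fintype ι] in
lemma Frame.lam_ext_iff (F : Frame k U ι) {x y : Lam U} :
    x = y ↔ ∀ m p q, ev (F.coef m (p + q)) p x = ev (F.coef m (p + q)) p y := by
  refine ⟨fun h m p q => h ▸ rfl, fun h => F.separating.ev.ext ?_⟩
  rintro ⟨⟨m, s⟩, p⟩
  -- The scalars `(p, q)` parametrize the pairs `(λ, -∂) = (p, p + q)`, so any value `s` of `-∂` is
  -- reached with `q = s - p`.
  simpa using h m p (s - p)

omit [Fintype ι] in
lemma Frame.lam2_ext_iff (F : Frame k U ι) {x y : Lam2 U} :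
    x = y ↔ ∀ n p q r, ev (ev (F.coef n (p + q + r)) q) p x =
      ev (ev (F.coef n (p + q + r)) q) p y := by
  refine ⟨fun h m p q r => h ▸ rfl, fun h => F.separating.ev.ev.ext ?_⟩
  rintro ⟨⟨⟨m, s⟩, q⟩, p⟩
  simpa using h m p q (s - p - q)

/-- The pattern of all the equivalences below: both sides of an axiom are expansions with the same
coordinates of the arguments. On vectors of the frame the expansions collapse to single
coefficients, and equal coefficients give equal expansions. -/
lemma Frame.comm_iff (F : Frame k U ι) (B : Conf k U U U) :
    (∀ a b : U, B.1 a b = (opp B).1 a b) ↔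
      ∀ i j m p q, F.sc B i j m p q = F.sc B j i m q p := by
  simp only [F.lam_ext_iff, F.ev_conf, F.sc_opp]
  constructor
  · intro h i j m p q
    simpa using h (F.vec i) (F.vec j) m p q
  · intro h a b m p q
    simp only [← h]

lemma Frame.skew_iff (F : Frame k U ι) (B : Conf k U U U) :
    (∀ a b : U, B.1 a b = -(opp B).1 a b) ↔
      ∀ i j m p q, F.sc B i j m p q = -F.sc B j i m q p := by
  simp only [F.lam_ext_iff, map_neg, F.ev_conf, F.sc_opp, Frame.bi, Frame.uni_neg]
  constructor
  · intro h i j m p q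
    simpa using h (F.vec i) (F.vec j) m p q
  · intro h a b m p q
    simp only [← h]

lemma Frame.assoc_iff (F : Frame k U ι) (B : Conf k U U U) :
    IsAssocConformal B ↔ ∀ i j l n p q r, ∑ m, F.sc B i j m p q * F.sc B m l n (p + q) r =
      ∑ m, F.sc B j l m q r * F.sc B i m n p (q + r) := by
  simp only [IsAssocConformal, F.lam2_ext_iff, F.ev_nestL, F.ev_nestR_left]
  constructor
  · intro h i j l n p q r
    simpa using h (F.vec i) (F.vec j) (F.vec l) n p q r
  · intro h a b c n p q r
    simp only [h]

/-- With `B = B'` this is the Jacobi identity, with `B` a bracket and `B'` a product it is the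
Leibniz rule. -/
lemma Frame.leibniz_iff (F : Frame k U ι) (B B' : Conf k U U U) :
    (∀ a b c : U, nestR B B' (lam₂ k U) (mu₂ k U) a b c =
      nestL B B' (lam₂ k U) (lam₂ k U + mu₂ k U) a b c +
        nestR B' B (mu₂ k U) (lam₂ k U) b a c) ↔
    ∀ i j l n p q r, ∑ m, F.sc B' j l m q r * F.sc B i m n p (q + r) =
      ∑ m, F.sc B i j m p q * F.sc B' m l n (p + q) r +
        ∑ m, F.sc B i l m p r * F.sc B' j m n q (p + r) := by
  simp only [F.lam2_ext_iff, map_add, F.ev_nestL, F.ev_nestR_left, F.ev_nestR_right,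
    Frame.tri, Frame.bi, Frame.uni_add]
  constructor
  · intro h i j l n p q r
    simpa using h (F.vec i) (F.vec j) (F.vec l) n p q r
  · intro h a b c n p q r
    simp only [h]

end AlgebraAxioms

/-! ### The axioms of Poisson conformal bialgebras in terms of structure constants -/

section TensorEval

variable {k : Type*} [Field k]
  {U V W U' : Type*} [AddCommGroup U] [Module k U] [AddCommGroup V] [Module k V]
  [AddCommGroup W] [Module k W] [AddCommGroup U'] [Module k U']

lemma tev_lTensor (φ : U →ₗ[k] k) (ψ : W →ₗ[k] k) (f : V →ₗ[k] W) (z : U ⊗[k] V) :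
    tev φ ψ (f.lTensor U z) = tev φ (ψ ∘ₗ f) z := by
  induction z using TensorProduct.induction_on with
  | zero => simp
  | add x y hx hy => simp only [map_add, hx, hy]
  | tmul x y => simp

lemma tev_rTensor (φ : U →ₗ[k] k) (ψ : W →ₗ[k] k) (f : V →ₗ[k] U) (z : V ⊗[k] W) :
    tev φ ψ (f.rTensor W z) = tev (φ ∘ₗ f) ψ z := by
  induction z using TensorProduct.induction_on with
  | zero => simp
  | add x y hx hy => simp only [map_add, hx, hy]
  | tmul x y => simp

lemma tev_comm (φ : U →ₗ[k] k) (ψ : V →ₗ[k] k) (z : V ⊗[k] U) :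
    tev φ ψ (TensorProduct.comm k V U z) = tev ψ φ z := by
  induction z using TensorProduct.induction_on with
  | zero => simp
  | add x y hx hy => simp only [map_add, hx, hy]
  | tmul x y => simp [mul_comm]

lemma tev_assoc (φ : U →ₗ[k] k) (ψ : V →ₗ[k] k) (χ : W →ₗ[k] k) (z : (U ⊗[k] V) ⊗[k] W) :
    tev φ (tev ψ χ) (TensorProduct.assoc k U V W z) = tev (tev φ ψ) χ z := by
  induction z using TensorProduct.induction_on with
  | zero => simp
  | add x y hx hy => simp only [map_add, hx, hy]
  | tmul x w =>
    induction x using TensorProduct.induction_on with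
    | zero => simp
    | add x y hx hy => simp only [TensorProduct.add_tmul, map_add, hx, hy]
    | tmul u v => simp [mul_assoc]

lemma tev_swap₁₂ (φ ψ χ : U →ₗ[k] k) (z : U ⊗[k] (U ⊗[k] U)) :
    tev φ (tev ψ χ) (swap₁₂ z) = tev ψ (tev φ χ) z := by
  induction z using TensorProduct.induction_on with
  | zero => simp
  | add x y hx hy => simp only [map_add, hx, hy]
  | tmul x w =>
    induction w using TensorProduct.induction_on with
    | zero => simp
    | add x y hx hy => simp only [TensorProduct.tmul_add, map_add, hx, hy]
    | tmul u v => simp [swap₁₂, mul_left_comm]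

lemma ev_tev_finsuppLeft (φ : U →ₗ[k] k) (ψ : V →ₗ[k] k) (p : k) (z : Lam U ⊗[k] V) :
    ev (tev φ ψ) p (TensorProduct.finsuppLeft k k U V ℕ z) = tev (ev φ p) ψ z := by
  induction z using TensorProduct.induction_on with
  | zero => simp
  | add x y hx hy => simp only [map_add, hx, hy]
  | tmul x v =>
    induction x using Finsupp.induction_linear with
    | zero => simp
    | add x y hx hy => simp only [TensorProduct.add_tmul, map_add, hx, hy]
    | single n u =>
      rw [TensorProduct.finsuppLeft_apply_tmul, Finsupp.sum_single_index (by simp)]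
      simp [mul_assoc]

lemma ev_tev_finsuppRight (φ : U →ₗ[k] k) (ψ : V →ₗ[k] k) (p : k) (z : U ⊗[k] Lam V) :
    ev (tev φ ψ) p (TensorProduct.finsuppRight k k U V ℕ z) = tev φ (ev ψ p) z := by
  induction z using TensorProduct.induction_on with
  | zero => simp
  | add x y hx hy => simp only [map_add, hx, hy]
  | tmul u x =>
    induction x using Finsupp.induction_linear with
    | zero => simp
    | add x y hx hy => simp only [TensorProduct.tmul_add, map_add, hx, hy]
    | single n v =>
      rw [TensorProduct.finsuppRight_apply_tmul, Finsupp.sum_single_index (by simp)]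
      simp [mul_left_comm]

end TensorEval

/-! ### The operators of the compatibility conditions and the iterated coproducts in terms of
structure constants. -/

section ConformalTensorEval

variable {k : Type*} [Field k]
  {U : Type*} [AddCommGroup U] [Module k U] [Module k[X] U] [IsScalarTower k k[X] U]
  {ι : Type*} [Fintype ι] [DecidableEq ι]

lemma ev_onFst (B : Conf k U U U) (φ ψ : U →ₗ[k] k) (p : k) (a : U) (z : U ⊗[k] U) :
    ev (tev φ ψ) p (onFst B a z) = tev (ev φ p ∘ₗ B.1 a) ψ z := by
  rw [onFst, LinearMap.comp_apply, LinearEquiv.coe_coe, ev_tev_finsuppLeft, tev_rTensor]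

lemma ev_onSnd (B : Conf k U U U) (φ ψ : U →ₗ[k] k) (p : k) (a : U) (z : U ⊗[k] U) :
    ev (tev φ ψ) p (onSnd B a z) = tev φ (ev ψ p ∘ₗ B.1 a) z := by
  rw [onSnd, LinearMap.comp_apply, LinearEquiv.coe_coe, ev_tev_finsuppRight, tev_lTensor]

omit [Fintype ι] in
-- Here `ν = -λ - ∂^{⊗2}` takes the value `-p + (s + t)`, which is `q` by conservation. So the terms
-- with `ν` are those without it, with the roles of `a` and `b` exchanged.
lemma Frame.ev_reflect (F : Frame k U ι) (i j : ι) (p q s t : k) (h : p + q = s + t)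
    (w : Lam (U ⊗[k] U)) :
    ev (tev (F.coef i s) (F.coef j t)) p (reflect w) =
      ev (tev (F.coef i s) (F.coef j t)) q w := by
  have hd : tev (F.coef i s) (F.coef j t) ∘ₗ der₂ k U =
      (-(s + t)) • tev (F.coef i s) (F.coef j t) := LinearMap.ext (F.tev_der₂ i j s t)
  rw [reflect, apply_subst _ _ _ q, ev_const]
  intro w
  rw [LinearMap.sub_apply, LinearMap.neg_apply, map_sub, map_neg, ev_lam, ev_coeffwise, hd,
    ev_smul, ← h]
  ring

/-- The structure constants of `(u, v) ↦ (B(u)_λ ⊗ I) d(v)`. -/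
def fstTerm (c d : ι → ι → ι → k → k → k) (x y i j : ι) (p s t : k) : k :=
  ∑ m, d y m j (s - p) t * c x m i p (s - p)

/-- The structure constants of `(u, v) ↦ (I ⊗ B(u)_λ) d(v)`. -/
def sndTerm (c d : ι → ι → ι → k → k → k) (x y i j : ι) (p s t : k) : k :=
  ∑ m, d y i m s (t - p) * c x m j p (t - p)

lemma Frame.ev_onFst (F : Frame k U ι) (B : Conf k U U U) (d : Coproduct k U) (i j : ι)
    (p q s t : k) (h : p + q = s + t) (a b : U) :
    ev (tev (F.coef i s) (F.coef j t)) p (onFst B a (d.toFun b)) =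
      F.bi p q a b fun x y => fstTerm (F.sc B) (F.dsc d) x y i j p s t := by
  -- The action of `a` adds `p` to the first leg, so `d(b)` is read with `s - p` on its first leg
  -- and `t` on its second.
  obtain rfl : q = (s - p) + t := by linear_combination h
  rw [PoissonConformal.ev_onFst, F.expand (ev (F.coef i s) p ∘ₗ B.1 a) (s - p) fun v =>
    PoissonConformal.ev_conf_right B _ _ _ (fun u => by rw [F.coef_der, add_sub_cancel]) _ _,
    tev_sum_left]
  have hs : F.coef i s = F.coef i (p + (s - p)) := by rw [add_sub_cancel]
  simp only [hs, LinearMap.comp_apply, F.ev_conf, Frame.tev_coproduct, Frame.bi, Frame.uni_vec,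
    Frame.mul_uni, Frame.uni_mul, Frame.uni_sum, fstTerm]
  rw [F.uni_comm]
  refine congrArg _ (_root_.funext fun x => congrArg _ (_root_.funext fun y => ?_))
  exact Finset.sum_congr rfl fun m _ => mul_comm _ _

lemma Frame.ev_onSnd (F : Frame k U ι) (B : Conf k U U U) (d : Coproduct k U) (i j : ι)
    (p q s t : k) (h : p + q = s + t) (a b : U) :
    ev (tev (F.coef i s) (F.coef j t)) p (onSnd B a (d.toFun b)) =
      F.bi p q a b fun x y => sndTerm (F.sc B) (F.dsc d) x y i j p s t := by
  obtain rfl : q = s + (t - p) := by linear_combination h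
  rw [PoissonConformal.ev_onSnd, F.expand (ev (F.coef j t) p ∘ₗ B.1 a) (t - p) fun v =>
    PoissonConformal.ev_conf_right B _ _ _ (fun u => by rw [F.coef_der, add_sub_cancel]) _ _,
    tev_sum_right]
  have hs : F.coef j t = F.coef j (p + (t - p)) := by rw [add_sub_cancel]
  simp only [hs, LinearMap.comp_apply, F.ev_conf, Frame.tev_coproduct, Frame.bi, Frame.uni_vec,
    Frame.mul_uni, Frame.uni_mul, Frame.uni_sum, sndTerm]
  rw [F.uni_comm]
  refine congrArg _ (_root_.funext fun x => congrArg _ (_root_.funext fun y => ?_))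
  exact Finset.sum_congr rfl fun m _ => mul_comm _ _

lemma Frame.bi_swap (F : Frame k U ι) (p q : k) (a b : U) (N : ι → ι → k) :
    F.bi q p b a N = F.bi p q a b fun x y => N y x :=
  F.uni_comm q p b a N

lemma Frame.ev_reflect_onFst (F : Frame k U ι) (B : Conf k U U U) (d : Coproduct k U) (i j : ι)
    (p q s t : k) (h : p + q = s + t) (a b : U) :
    ev (tev (F.coef i s) (F.coef j t)) p (reflect (onFst B b (d.toFun a))) =
      F.bi p q a b fun x y => fstTerm (F.sc B) (F.dsc d) y x i j q s t := by
  rw [F.ev_reflect i j p q s t h, F.ev_onFst B d i j q p s t (by rw [← h, add_comm]), F.bi_swap]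

lemma Frame.ev_reflect_onSnd (F : Frame k U ι) (B : Conf k U U U) (d : Coproduct k U) (i j : ι)
    (p q s t : k) (h : p + q = s + t) (a b : U) :
    ev (tev (F.coef i s) (F.coef j t)) p (reflect (onSnd B b (d.toFun a))) =
      F.bi p q a b fun x y => sndTerm (F.sc B) (F.dsc d) y x i j q s t := by
  rw [F.ev_reflect i j p q s t h, F.ev_onSnd B d i j q p s t (by rw [← h, add_comm]), F.bi_swap]

lemma Frame.ev_coeffwise_coproduct (F : Frame k U ι) (B : Conf k U U U) (d : Coproduct k U)
    (i j : ι) (p q s t : k) (h : p + q = s + t) (a b : U) :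
    ev (tev (F.coef i s) (F.coef j t)) p (coeffwise d.toFun (B.1 a b)) =
      F.bi p q a b fun x y => ∑ m, F.sc B x y m p q * F.dsc d m i j s t := by
  have hd : tev (F.coef i s) (F.coef j t) ∘ₗ d.toFun =
      ∑ m, F.dsc d m i j s t • F.coef m (p + q) := by
    refine LinearMap.ext fun u => ?_
    rw [LinearMap.comp_apply, F.tev_coproduct, h]
    simp [Frame.uni, mul_comm]
  rw [ev_coeffwise, hd, ev_sum]
  simp only [ev_smul, F.ev_conf, Frame.bi, Frame.mul_uni, Frame.uni_sum]
  refine congrArg _ (_root_.funext fun x => congrArg _ (_root_.funext fun y => ?_))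
  exact Finset.sum_congr rfl fun m _ => mul_comm _ _

lemma Frame.tev_coR (F : Frame k U ι) (d d' : Coproduct k U) (i j l : ι) (p q r : k) (a : U) :
    tev (F.coef i p) (tev (F.coef j q) (F.coef l r)) (coR d d' a) =
      F.uni (p + q + r) a fun n => ∑ m, F.dsc d n i m p (q + r) * F.dsc d' m j l q r := by
  rw [coR, tev_lTensor, F.expand (tev (F.coef j q) (F.coef l r) ∘ₗ d'.toFun) (q + r) fun u => by
    rw [LinearMap.comp_apply, d'.map_der, F.tev_der₂, LinearMap.comp_apply], tev_sum_right]
  simp only [Frame.tev_coproduct, Frame.mul_uni, Frame.uni_sum, ← add_assoc]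
  exact congrArg _ (_root_.funext fun x => Finset.sum_congr rfl fun m _ => mul_comm _ _)

lemma Frame.tev_swap_coR (F : Frame k U ι) (d d' : Coproduct k U) (i j l : ι) (p q r : k)
    (a : U) :
    tev (F.coef i p) (tev (F.coef j q) (F.coef l r)) (swap₁₂ (coR d d' a)) =
      F.uni (p + q + r) a fun n => ∑ m, F.dsc d n j m q (p + r) * F.dsc d' m i l p r := by
  rw [tev_swap₁₂, F.tev_coR, add_comm q p]

lemma Frame.tev_coL (F : Frame k U ι) (d d' : Coproduct k U) (i j l : ι) (p q r : k) (a : U) :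
    tev (F.coef i p) (tev (F.coef j q) (F.coef l r)) (coL d d' a) =
      F.uni (p + q + r) a fun n => ∑ m, F.dsc d n m l (p + q) r * F.dsc d' m i j p q := by
  rw [coL, tev_assoc, tev_rTensor, F.expand (tev (F.coef i p) (F.coef j q) ∘ₗ d'.toFun) (p + q)
    fun u => by rw [LinearMap.comp_apply, d'.map_der, F.tev_der₂, LinearMap.comp_apply],
    tev_sum_left]
  simp only [Frame.tev_coproduct, Frame.mul_uni, Frame.uni_sum]
  exact congrArg _ (_root_.funext fun x => Finset.sum_congr rfl fun m _ => mul_comm _ _)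

variable [Infinite k]

omit [Fintype ι] [Infinite k] in
lemma Frame.tensor_ext_iff (F : Frame k U ι) {x y : U ⊗[k] U} :
    x = y ↔ ∀ i j p q, tev (F.coef i p) (F.coef j q) x = tev (F.coef i p) (F.coef j q) y := by
  refine ⟨fun h i j p q => h ▸ rfl, fun h => (F.separating.tev F.separating).ext ?_⟩
  rintro ⟨⟨i, p⟩, ⟨j, q⟩⟩
  exact h i j p q

omit [Fintype ι] [Infinite k] in
lemma Frame.tensor_ext_iff₃ (F : Frame k U ι) {x y : U ⊗[k] (U ⊗[k] U)} :
    x = y ↔ ∀ i j l p q r, tev (F.coef i p) (tev (F.coef j q) (F.coef l r)) x =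
      tev (F.coef i p) (tev (F.coef j q) (F.coef l r)) y := by
  refine ⟨fun h i j l p q r => h ▸ rfl,
    fun h => (F.separating.tev (F.separating.tev F.separating)).ext ?_⟩
  rintro ⟨⟨i, p⟩, ⟨⟨j, q⟩, ⟨l, r⟩⟩⟩
  exact h i j l p q r

omit [Fintype ι] in
lemma Frame.lam_tensor_ext_iff (F : Frame k U ι) {x y : Lam (U ⊗[k] U)} :
    x = y ↔ ∀ i j p q s t, p + q = s + t → ev (tev (F.coef i s) (F.coef j t)) p x =
      ev (tev (F.coef i s) (F.coef j t)) p y := by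
  refine ⟨fun h i j p q s t _ => h ▸ rfl, fun h => (F.separating.tev F.separating).ev.ext ?_⟩
  rintro ⟨⟨⟨i, s⟩, ⟨j, t⟩⟩, p⟩
  -- Only `p`, `s` and `t` enter the evaluation; `q` is the value on the second argument that
  -- conservation then forces.
  exact h i j p (s + t - p) s t (by ring)

end ConformalTensorEval

/-- The axioms of a Poisson conformal bialgebra for the structure constants `c` of the bracket,
`a` of the product, `d` of the cobracket and `b` of the coproduct. -/
structure IsBialgebraConstants {k ι : Type*} [Field k] [Fintype ι]
    (c a d b : ι → ι → ι → k → k → k) : Prop where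
  skew : ∀ i j m p q, c i j m p q = -c j i m q p
  comm : ∀ i j m p q, a i j m p q = a j i m q p
  coskew : ∀ m i j p q, d m i j p q = -d m j i q p
  cocomm : ∀ m i j p q, b m i j p q = b m j i q p
  jacobi : ∀ i j l n p q r, ∑ m, c j l m q r * c i m n p (q + r) =
    ∑ m, c i j m p q * c m l n (p + q) r + ∑ m, c i l m p r * c j m n q (p + r)
  assoc : ∀ i j l n p q r, ∑ m, a i j m p q * a m l n (p + q) r =
    ∑ m, a j l m q r * a i m n p (q + r)
  leibniz : ∀ i j l n p q r, ∑ m, a j l m q r * c i m n p (q + r) =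
    ∑ m, c i j m p q * a m l n (p + q) r + ∑ m, c i l m p r * a j m n q (p + r)
  cojacobi : ∀ n i j l p q r, ∑ m, d n i m p (q + r) * d m j l q r -
    ∑ m, d n j m q (p + r) * d m i l p r = ∑ m, d n m l (p + q) r * d m i j p q
  coassoc : ∀ n i j l p q r, ∑ m, b n i m p (q + r) * b m j l q r =
    ∑ m, b n m l (p + q) r * b m i j p q
  coleibniz : ∀ n i j l p q r, ∑ m, d n i m p (q + r) * b m j l q r =
    ∑ m, b n m l (p + q) r * d m i j p q + ∑ m, b n j m q (p + r) * d m i l p r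
  compat_lie : ∀ x y i j p q s t, p + q = s + t → ∑ m, c x y m p q * d m i j s t =
    (fstTerm c d x y i j p s t + sndTerm c d x y i j p s t) -
      (fstTerm c d y x i j q s t + sndTerm c d y x i j q s t)
  compat_asi : ∀ x y i j p q s t, p + q = s + t → ∑ m, a x y m p q * b m i j s t =
    sndTerm a b x y i j p s t + fstTerm a b y x i j q s t
  antisymm : ∀ x y i j p q s t, p + q = s + t →
    (fstTerm a b y x i j q s t - sndTerm a b y x i j q s t) +
      (fstTerm a b x y j i p t s - sndTerm a b x y j i p t s) = 0
  compat_mul : ∀ x y i j p q s t, p + q = s + t → ∑ m, a x y m p q * d m i j s t =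
    fstTerm a d x y i j p s t + fstTerm a d y x i j q s t + sndTerm c b x y i j p s t +
      sndTerm c b y x i j q s t
  compat_br : ∀ x y i j p q s t, p + q = s + t → ∑ m, c x y m p q * b m i j s t =
    (fstTerm c b x y i j p s t + sndTerm c b x y i j p s t) -
      sndTerm a d y x i j q s t + fstTerm a d y x i j q s t

/-! ### The bialgebra axioms as identities between structure constants. -/

section BialgebraAxioms

variable {k : Type*} [Field k]
  {U : Type*} [AddCommGroup U] [Module k U] [Module k[X] U] [IsScalarTower k k[X] U]
  {ι : Type*} [Fintype ι] [DecidableEq ι]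

lemma Frame.coskew_iff (F : Frame k U ι) (d : Coproduct k U) :
    (∀ a, d.toFun a = -TensorProduct.comm k U U (d.toFun a)) ↔
      ∀ m i j p q, F.dsc d m i j p q = -F.dsc d m j i q p := by
  simp only [F.tensor_ext_iff, map_neg, tev_comm, F.tev_coproduct, Frame.uni_neg]
  constructor
  · intro h m i j p q
    simpa using h (F.vec m) i j p q
  · intro h a i j p q
    simp only [← h, add_comm q p]

lemma Frame.cocomm_iff (F : Frame k U ι) (d : Coproduct k U) :
    (∀ a, d.toFun a = TensorProduct.comm k U U (d.toFun a)) ↔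
      ∀ m i j p q, F.dsc d m i j p q = F.dsc d m j i q p := by
  simp only [F.tensor_ext_iff, tev_comm, F.tev_coproduct]
  constructor
  · intro h m i j p q
    simpa using h (F.vec m) i j p q
  · intro h a i j p q
    simp only [← h, add_comm q p]

lemma Frame.cojacobi_iff (F : Frame k U ι) (d : Coproduct k U) :
    (∀ a, coR d d a - swap₁₂ (coR d d a) = coL d d a) ↔
      ∀ n i j l p q r, ∑ m, F.dsc d n i m p (q + r) * F.dsc d m j l q r -
        ∑ m, F.dsc d n j m q (p + r) * F.dsc d m i l p r =
          ∑ m, F.dsc d n m l (p + q) r * F.dsc d m i j p q := by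
  simp only [F.tensor_ext_iff₃, map_sub, F.tev_coR, F.tev_swap_coR, F.tev_coL, Frame.uni_sub]
  constructor
  · intro h n i j l p q r
    simpa using h (F.vec n) i j l p q r
  · intro h a i j l p q r
    simp only [h]

lemma Frame.coassoc_iff (F : Frame k U ι) (d : Coproduct k U) :
    (∀ a, coR d d a = coL d d a) ↔
      ∀ n i j l p q r, ∑ m, F.dsc d n i m p (q + r) * F.dsc d m j l q r =
          ∑ m, F.dsc d n m l (p + q) r * F.dsc d m i j p q := by
  simp only [F.tensor_ext_iff₃, F.tev_coR, F.tev_coL]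
  constructor
  · intro h n i j l p q r
    simpa using h (F.vec n) i j l p q r
  · intro h a i j l p q r
    simp only [h]

lemma Frame.coleibniz_iff (F : Frame k U ι) (d e : Coproduct k U) :
    (∀ a, coR d e a = coL e d a + swap₁₂ (coR e d a)) ↔
      ∀ n i j l p q r, ∑ m, F.dsc d n i m p (q + r) * F.dsc e m j l q r =
        ∑ m, F.dsc e n m l (p + q) r * F.dsc d m i j p q +
          ∑ m, F.dsc e n j m q (p + r) * F.dsc d m i l p r := by
  simp only [F.tensor_ext_iff₃, map_add, F.tev_coR, F.tev_coL, F.tev_swap_coR, Frame.uni_add]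
  constructor
  · intro h n i j l p q r
    simpa using h (F.vec n) i j l p q r
  · intro h a i j l p q r
    simp only [h]

variable [Infinite k]

lemma Frame.compat_lie_iff (F : Frame k U ι) (B : Conf k U U U) (d : Coproduct k U) :
    (∀ a b, coeffwise d.toFun (B.1 a b) = (onFst B a (d.toFun b) + onSnd B a (d.toFun b)) -
      reflect (onFst B b (d.toFun a) + onSnd B b (d.toFun a))) ↔
    ∀ x y i j p q s t, p + q = s + t → ∑ m, F.sc B x y m p q * F.dsc d m i j s t =
      (fstTerm (F.sc B) (F.dsc d) x y i j p s t + sndTerm (F.sc B) (F.dsc d) x y i j p s t) -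
        (fstTerm (F.sc B) (F.dsc d) y x i j q s t +
          sndTerm (F.sc B) (F.dsc d) y x i j q s t) := by
  simp only [F.lam_tensor_ext_iff, map_add, map_sub]
  constructor
  · intro h x y i j p q s t hs
    have := h (F.vec x) (F.vec y) i j p q s t hs
    rw [F.ev_coeffwise_coproduct _ _ _ _ _ _ _ _ hs, F.ev_onFst _ _ _ _ _ _ _ _ hs,
      F.ev_onSnd _ _ _ _ _ _ _ _ hs, F.ev_reflect_onFst _ _ _ _ _ _ _ _ hs,
      F.ev_reflect_onSnd _ _ _ _ _ _ _ _ hs] at this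
    simpa only [Frame.bi_vec] using this
  · intro h a b i j p q s t hs
    rw [F.ev_coeffwise_coproduct _ _ _ _ _ _ _ _ hs, F.ev_onFst _ _ _ _ _ _ _ _ hs,
      F.ev_onSnd _ _ _ _ _ _ _ _ hs, F.ev_reflect_onFst _ _ _ _ _ _ _ _ hs,
      F.ev_reflect_onSnd _ _ _ _ _ _ _ _ hs]
    simp only [Frame.bi, Frame.uni_add, Frame.uni_sub, h _ _ _ _ _ _ _ _ hs]

lemma Frame.compat_asi_iff (F : Frame k U ι) (B : Conf k U U U) (d : Coproduct k U) :
    (∀ a b, coeffwise d.toFun (B.1 a b) =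
      onSnd B a (d.toFun b) + reflect (onFst B b (d.toFun a))) ↔
    ∀ x y i j p q s t, p + q = s + t → ∑ m, F.sc B x y m p q * F.dsc d m i j s t =
      sndTerm (F.sc B) (F.dsc d) x y i j p s t + fstTerm (F.sc B) (F.dsc d) y x i j q s t := by
  simp only [F.lam_tensor_ext_iff, map_add]
  constructor
  · intro h x y i j p q s t hs
    have := h (F.vec x) (F.vec y) i j p q s t hs
    rw [F.ev_coeffwise_coproduct _ _ _ _ _ _ _ _ hs,
      F.ev_onSnd _ _ _ _ _ _ _ _ hs, F.ev_reflect_onFst _ _ _ _ _ _ _ _ hs] at this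
    simpa only [Frame.bi_vec] using this
  · intro h a b i j p q s t hs
    rw [F.ev_coeffwise_coproduct _ _ _ _ _ _ _ _ hs,
      F.ev_onSnd _ _ _ _ _ _ _ _ hs, F.ev_reflect_onFst _ _ _ _ _ _ _ _ hs]
    simp only [Frame.bi, Frame.uni_add, h _ _ _ _ _ _ _ _ hs]

lemma Frame.antisymm_iff (F : Frame k U ι) (B : Conf k U U U) (d : Coproduct k U) :
    (∀ a b, reflect (onFst B b (d.toFun a) - onSnd B b (d.toFun a)) +
      coeffwise (TensorProduct.comm k U U).toLinearMap
        (onFst B a (d.toFun b) - onSnd B a (d.toFun b)) = 0) ↔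
    ∀ x y i j p q s t, p + q = s + t →
      (fstTerm (F.sc B) (F.dsc d) y x i j q s t - sndTerm (F.sc B) (F.dsc d) y x i j q s t) +
        (fstTerm (F.sc B) (F.dsc d) x y j i p t s -
          sndTerm (F.sc B) (F.dsc d) x y j i p t s) = 0 := by
  have hc : ∀ i j : ι, ∀ s t : k, tev (F.coef i s) (F.coef j t) ∘ₗ
      (TensorProduct.comm k U U).toLinearMap = tev (F.coef j t) (F.coef i s) :=
    fun i j s t => LinearMap.ext fun z => tev_comm _ _ z
  simp only [F.lam_tensor_ext_iff, map_add, map_sub, ev_coeffwise, hc, map_zero]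
  constructor
  · intro h x y i j p q s t hs
    have := h (F.vec x) (F.vec y) i j p q s t hs
    rw [F.ev_reflect_onFst _ _ _ _ _ _ _ _ hs, F.ev_reflect_onSnd _ _ _ _ _ _ _ _ hs] at this
    -- The remaining two terms are behind the flip, so their legs come in the order `(j, t)`, `(i,
    -- s)`.
    rw [add_comm s t] at hs
    rw [F.ev_onFst _ _ _ _ _ _ _ _ hs, F.ev_onSnd _ _ _ _ _ _ _ _ hs] at this
    simpa only [Frame.bi_vec] using this
  · intro h a b i j p q s t hs
    have h' := fun x y => h x y i j p q s t hs
    rw [F.ev_reflect_onFst _ _ _ _ _ _ _ _ hs, F.ev_reflect_onSnd _ _ _ _ _ _ _ _ hs]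
    rw [add_comm s t] at hs
    rw [F.ev_onFst _ _ _ _ _ _ _ _ hs, F.ev_onSnd _ _ _ _ _ _ _ _ hs]
    simp only [Frame.bi, Frame.uni_add, Frame.uni_sub, h']
    simp [Frame.uni]

lemma Frame.compat_mul_iff (F : Frame k U ι) (B C : Conf k U U U) (d e : Coproduct k U) :
    (∀ a b, coeffwise d.toFun (C.1 a b) =
      onFst C a (d.toFun b) + reflect (onFst C b (d.toFun a)) +
        onSnd B a (e.toFun b) + reflect (onSnd B b (e.toFun a))) ↔
    ∀ x y i j p q s t, p + q = s + t → ∑ m, F.sc C x y m p q * F.dsc d m i j s t =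
      fstTerm (F.sc C) (F.dsc d) x y i j p s t + fstTerm (F.sc C) (F.dsc d) y x i j q s t +
        sndTerm (F.sc B) (F.dsc e) x y i j p s t +
          sndTerm (F.sc B) (F.dsc e) y x i j q s t := by
  simp only [F.lam_tensor_ext_iff, map_add]
  constructor
  · intro h x y i j p q s t hs
    have := h (F.vec x) (F.vec y) i j p q s t hs
    rw [F.ev_coeffwise_coproduct _ _ _ _ _ _ _ _ hs, F.ev_onFst _ _ _ _ _ _ _ _ hs,
      F.ev_onSnd _ _ _ _ _ _ _ _ hs, F.ev_reflect_onFst _ _ _ _ _ _ _ _ hs,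
      F.ev_reflect_onSnd _ _ _ _ _ _ _ _ hs] at this
    simpa only [Frame.bi_vec] using this
  · intro h a b i j p q s t hs
    rw [F.ev_coeffwise_coproduct _ _ _ _ _ _ _ _ hs, F.ev_onFst _ _ _ _ _ _ _ _ hs,
      F.ev_onSnd _ _ _ _ _ _ _ _ hs, F.ev_reflect_onFst _ _ _ _ _ _ _ _ hs,
      F.ev_reflect_onSnd _ _ _ _ _ _ _ _ hs]
    simp only [Frame.bi, Frame.uni_add, h _ _ _ _ _ _ _ _ hs]

lemma Frame.compat_br_iff (F : Frame k U ι) (B C : Conf k U U U) (d e : Coproduct k U) :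
    (∀ a b, coeffwise e.toFun (B.1 a b) = (onFst B a (e.toFun b) + onSnd B a (e.toFun b)) -
      reflect (onSnd C b (d.toFun a)) + reflect (onFst C b (d.toFun a))) ↔
    ∀ x y i j p q s t, p + q = s + t → ∑ m, F.sc B x y m p q * F.dsc e m i j s t =
      (fstTerm (F.sc B) (F.dsc e) x y i j p s t + sndTerm (F.sc B) (F.dsc e) x y i j p s t) -
        sndTerm (F.sc C) (F.dsc d) y x i j q s t +
          fstTerm (F.sc C) (F.dsc d) y x i j q s t := by
  simp only [F.lam_tensor_ext_iff, map_add, map_sub]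
  constructor
  · intro h x y i j p q s t hs
    have := h (F.vec x) (F.vec y) i j p q s t hs
    rw [F.ev_coeffwise_coproduct _ _ _ _ _ _ _ _ hs, F.ev_onFst _ _ _ _ _ _ _ _ hs,
      F.ev_onSnd _ _ _ _ _ _ _ _ hs, F.ev_reflect_onFst _ _ _ _ _ _ _ _ hs,
      F.ev_reflect_onSnd _ _ _ _ _ _ _ _ hs] at this
    simpa only [Frame.bi_vec] using this
  · intro h a b i j p q s t hs
    rw [F.ev_coeffwise_coproduct _ _ _ _ _ _ _ _ hs, F.ev_onFst _ _ _ _ _ _ _ _ hs,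
      F.ev_onSnd _ _ _ _ _ _ _ _ hs, F.ev_reflect_onFst _ _ _ _ _ _ _ _ hs,
      F.ev_reflect_onSnd _ _ _ _ _ _ _ _ hs]
    simp only [Frame.bi, Frame.uni_add, Frame.uni_sub, h _ _ _ _ _ _ _ _ hs]

/-- This is used in both directions: for a frame of `P` to extract the identities, and for a frame
of the double to assemble the conclusion. -/
theorem Frame.isPoissonConformalBialgebra_iff (F : Frame k U ι) (br mul : Conf k U U U)
    (δ Δ : Coproduct k U) :
    IsPoissonConformalBialgebra br mul δ Δ ↔
      IsBialgebraConstants (F.sc br) (F.sc mul) (F.dsc δ) (F.dsc Δ) := by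
  -- By commutativity right and left multiplication coincide, so `opp` disappears from the
  -- infinitesimal bialgebra axioms.
  have hopp : (∀ a b : U, mul.1 a b = (opp mul).1 a b) → opp mul = mul := fun h =>
    Subtype.ext (LinearMap.ext fun a => LinearMap.ext fun b => (h a b).symm)
  constructor
  · intro h
    have ho := hopp h.poisson.comm
    exact
      { skew := (F.skew_iff _).mp h.poisson.lie.skew
        comm := (F.comm_iff _).mp h.poisson.comm
        coskew := (F.coskew_iff _).mp h.copoisson.colie.coskew
        cocomm := (F.cocomm_iff _).mp h.copoisson.cocommCoassoc.cocomm
        jacobi := (F.leibniz_iff _ _).mp h.poisson.lie.jacobi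
        assoc := (F.assoc_iff _).mp h.poisson.assoc
        leibniz := (F.leibniz_iff _ _).mp h.poisson.leibniz
        cojacobi := (F.cojacobi_iff _).mp h.copoisson.colie.cojacobi
        coassoc := (F.coassoc_iff _).mp h.copoisson.cocommCoassoc.coassoc
        coleibniz := (F.coleibniz_iff _ _).mp h.copoisson.coleibniz
        compat_lie := (F.compat_lie_iff _ _).mp h.lieBialgebra.compat
        compat_asi := (F.compat_asi_iff _ _).mp (by simpa only [ho] using h.asiBialgebra.compat)
        antisymm := (F.antisymm_iff _ _).mp (by simpa only [ho] using h.asiBialgebra.antisymm)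
        compat_mul := (F.compat_mul_iff _ _ _ _).mp h.compat_mul
        compat_br := (F.compat_br_iff _ _ _ _).mp h.compat_br }
  · intro h
    have hcomm := (F.comm_iff mul).mpr h.comm
    have ho := hopp hcomm
    have lie : IsLieConformal br := ⟨(F.skew_iff _).mpr h.skew, (F.leibniz_iff _ _).mpr h.jacobi⟩
    have colie : IsLieConformalCoalgebra δ :=
      ⟨(F.coskew_iff _).mpr h.coskew, (F.cojacobi_iff _).mpr h.cojacobi⟩
    have coas : IsCocommCoassoc Δ :=
      ⟨(F.coassoc_iff _).mpr h.coassoc, (F.cocomm_iff _).mpr h.cocomm⟩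
    have assoc := (F.assoc_iff mul).mpr h.assoc
    exact
      { poisson := ⟨lie, assoc, hcomm, (F.leibniz_iff _ _).mpr h.leibniz⟩
        copoisson := ⟨colie, coas, (F.coleibniz_iff _ _).mpr h.coleibniz⟩
        lieBialgebra := ⟨lie, colie, (F.compat_lie_iff _ _).mpr h.compat_lie⟩
        asiBialgebra := ⟨assoc, hcomm, coas,
          by simpa only [ho] using (F.compat_asi_iff _ _).mpr h.compat_asi,
          by simpa only [ho] using (F.antisymm_iff _ _).mpr h.antisymm⟩
        compat_mul := (F.compat_mul_iff _ _ _ _).mpr h.compat_mul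
        compat_br := (F.compat_br_iff _ _ _ _).mpr h.compat_br }

end BialgebraAxioms

/-! ### The invariant trilinear forms of the double -/

section TrilinearForm

variable {k ι : Type*} [Field k]

/-- The invariant trilinear form on the double with a product with structure constants `c` and a
coproduct with structure constants `d`.  The index `inl i` stands for `eᵢ` and `inr i` for `eᵢ*`,
and each index comes with a value of `-∂`. -/
def triform (ε : k) (c d : ι → ι → ι → k → k → k) : (ι ⊕ ι) × k → (ι ⊕ ι) × k → (ι ⊕ ι) × k → k
  | (.inl i, p), (.inl j, q), (.inr l, _) => c i j l p q
  | (.inl i, p), (.inr j, _), (.inl l, r) => ε * c i l j p r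
  | (.inr i, _), (.inl j, q), (.inl l, r) => c j l i q r
  | (.inr i, p), (.inr j, q), (.inl l, _) => d l i j (-p) (-q)
  | (.inr i, p), (.inl j, _), (.inr l, r) => ε * d j i l (-p) (-r)
  | (.inl i, _), (.inr j, q), (.inr l, r) => d i j l (-q) (-r)
  | (.inl _, _), (.inl _, _), (.inl _, _) => 0
  | (.inr _, _), (.inr _, _), (.inr _, _) => 0

/-- A trilinear form that is multiplied by `ε` under each transposition of its arguments. -/
structure IsSignSymmetric {L : Type*} (ε : k) (T : L → L → L → k) : Prop where
  sq : ε * ε = 1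
  swap₁₂ : ∀ x y z, T y x z = ε * T x y z
  swap₂₃ : ∀ x y z, T x z y = ε * T x y z

lemma IsSignSymmetric.rotate {L : Type*} {ε : k} {T : L → L → L → k} (h : IsSignSymmetric ε T)
    (x y z : L) : T y z x = T x y z := by
  rw [h.swap₂₃, h.swap₁₂, ← mul_assoc, h.sq, one_mul]

/-- Transpositions of a vector with a covector hold by the choice of signs in `triform`. The
transposition of two vectors beside a covector is the symmetry of `c`, that of two covectors beside
a vector is the symmetry of `d`. -/
lemma triform_symm {ε : k} {c d : ι → ι → ι → k → k → k} (hε : ε * ε = 1)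
    (hc : ∀ i j m p q, c i j m p q = ε * c j i m q p)
    (hd : ∀ m i j p q, d m i j p q = ε * d m j i q p) : IsSignSymmetric ε (triform ε c d) := by
  have hε' : ∀ x : k, ε * (ε * x) = x := fun x => by rw [← mul_assoc, hε, one_mul]
  refine ⟨hε, ?_, ?_⟩
  · rintro ⟨i | i, p⟩ ⟨j | j, q⟩ ⟨l | l, r⟩ <;> simp only [triform, hε', mul_zero]
    · exact hc _ _ _ _ _
    · exact hd _ _ _ _ _
  · rintro ⟨i | i, p⟩ ⟨j | j, q⟩ ⟨l | l, r⟩ <;> simp only [triform, hε', mul_zero]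
    · exact hd _ _ _ _ _
    · exact hc _ _ _ _ _

variable [Fintype ι]

/-- The contraction of two trilinear forms along dual bases, weighted by `g`. -/
def glue (g : ι ⊕ ι → k) (S T : (ι ⊕ ι) × k → (ι ⊕ ι) × k → (ι ⊕ ι) × k → k)
    (x y z w : (ι ⊕ ι) × k) : k :=
  ∑ M, g M * (S x y (M, -(x.2 + y.2)) * T (M.swap, x.2 + y.2) z w)

variable {ε ε' : k} {S T : (ι ⊕ ι) × k → (ι ⊕ ι) × k → (ι ⊕ ι) × k → k}

lemma glue_const (c : k) (x y z w : (ι ⊕ ι) × k) :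
    glue (fun _ => c) S T x y z w = c * glue 1 S T x y z w := by
  simp only [glue, Finset.mul_sum, Pi.one_apply, one_mul]

lemma glue_add (g g' : ι ⊕ ι → k) (x y z w : (ι ⊕ ι) × k) :
    glue g S T x y z w + glue g' S T x y z w = glue (g + g') S T x y z w := by
  simp [glue, add_mul, Finset.sum_add_distrib]

lemma glue_swap_left (hS : IsSignSymmetric ε S) (g : ι ⊕ ι → k) (x y z w : (ι ⊕ ι) × k) :
    glue g S T y x z w = ε * glue g S T x y z w := by
  simp only [glue, Finset.mul_sum]
  refine Finset.sum_congr rfl fun M _ => ?_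
  rw [hS.swap₁₂, add_comm y.2]
  ring

lemma glue_swap_right (hT : IsSignSymmetric ε T) (g : ι ⊕ ι → k) (x y z w : (ι ⊕ ι) × k) :
    glue g S T x y w z = ε * glue g S T x y z w := by
  simp only [glue, Finset.mul_sum]
  refine Finset.sum_congr rfl fun M _ => ?_
  rw [hT.swap₂₃]
  ring

/-- Conservation gives the contracted leg the same pair of opposite scalars from either side.
Exchanging the factors then only replaces the summation index by its dual, which is why `g` is
composed with `Sum.swap`; rotations of the forms cost no sign. -/
lemma glue_exchange (hS : IsSignSymmetric ε S) (hT : IsSignSymmetric ε' T) (g : ι ⊕ ι → k)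
    (x y z w : (ι ⊕ ι) × k) (h : x.2 + y.2 + z.2 + w.2 = 0) :
    glue g S T z w x y = glue (g ∘ Sum.swap) T S x y z w := by
  simp only [glue]
  refine Fintype.sum_equiv (Equiv.sumComm ι ι) _ _ fun M => ?_
  have h1 : z.2 + w.2 = -(x.2 + y.2) := by linear_combination h
  simp only [Equiv.sumComm_apply, Function.comp, Sum.swap_swap, h1, neg_neg]
  rw [hT.rotate, ← hS.rotate z w, ← hS.rotate w, mul_comm (T _ _ _), ← hT.rotate x y,
    hT.rotate]

omit [Fintype ι] in
/-- A property of four legs that is invariant under permutations has to be checked for one order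
of the types of the legs only. -/
lemma leg_induction₄ {L : Type*} (R : (ι ⊕ ι) × L → (ι ⊕ ι) × L → (ι ⊕ ι) × L → (ι ⊕ ι) × L → Prop)
    (h₁₂ : ∀ x y z w, R x y z w → R y x z w) (h₂₃ : ∀ x y z w, R x y z w → R x z y w)
    (h₃₄ : ∀ x y z w, R x y z w → R x y w z)
    (h₀ : ∀ i j l n p q r s, R (.inl i, p) (.inl j, q) (.inl l, r) (.inl n, s))
    (h₁ : ∀ i j l n p q r s, R (.inl i, p) (.inl j, q) (.inl l, r) (.inr n, s))
    (h₂ : ∀ i j l n p q r s, R (.inl i, p) (.inl j, q) (.inr l, r) (.inr n, s))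
    (h₃ : ∀ i j l n p q r s, R (.inr i, p) (.inr j, q) (.inr l, r) (.inl n, s))
    (h₄ : ∀ i j l n p q r s, R (.inr i, p) (.inr j, q) (.inr l, r) (.inr n, s))
    (x y z w : (ι ⊕ ι) × L) : R x y z w := by
  obtain ⟨i | i, p⟩ := x <;> obtain ⟨j | j, q⟩ := y <;> obtain ⟨l | l, r⟩ := z <;>
    obtain ⟨n | n, s⟩ := w
  · exact h₀ _ _ _ _ _ _ _ _
  · exact h₁ _ _ _ _ _ _ _ _
  · exact h₃₄ _ _ _ _ (h₁ _ _ _ _ _ _ _ _)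
  · exact h₂ _ _ _ _ _ _ _ _
  · exact h₂₃ _ _ _ _ (h₃₄ _ _ _ _ (h₁ _ _ _ _ _ _ _ _))
  · exact h₂₃ _ _ _ _ (h₂ _ _ _ _ _ _ _ _)
  · exact h₃₄ _ _ _ _ (h₂₃ _ _ _ _ (h₂ _ _ _ _ _ _ _ _))
  · exact h₁₂ _ _ _ _ (h₂₃ _ _ _ _ (h₃₄ _ _ _ _ (h₃ _ _ _ _ _ _ _ _)))
  · exact h₁₂ _ _ _ _ (h₂₃ _ _ _ _ (h₃₄ _ _ _ _ (h₁ _ _ _ _ _ _ _ _)))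
  · exact h₁₂ _ _ _ _ (h₂₃ _ _ _ _ (h₂ _ _ _ _ _ _ _ _))
  · exact h₁₂ _ _ _ _ (h₃₄ _ _ _ _ (h₂₃ _ _ _ _ (h₂ _ _ _ _ _ _ _ _)))
  · exact h₂₃ _ _ _ _ (h₃₄ _ _ _ _ (h₃ _ _ _ _ _ _ _ _))
  · exact h₂₃ _ _ _ _ (h₃₄ _ _ _ _ (h₁₂ _ _ _ _ (h₂₃ _ _ _ _ (h₂ _ _ _ _ _ _ _ _))))
  · exact h₃₄ _ _ _ _ (h₃ _ _ _ _ _ _ _ _)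
  · exact h₃ _ _ _ _ _ _ _ _
  · exact h₄ _ _ _ _ _ _ _ _

omit [Fintype ι] in
lemma leg_induction₃ {L : Type*} (R : (ι ⊕ ι) × L → (ι ⊕ ι) × L → (ι ⊕ ι) × L → Prop)
    (h₁₂ : ∀ x y z, R x y z → R y x z) (h₂₃ : ∀ x y z, R x y z → R x z y)
    (h₀ : ∀ i j l p q r, R (.inl i, p) (.inl j, q) (.inl l, r))
    (h₁ : ∀ i j l p q r, R (.inl i, p) (.inl j, q) (.inr l, r))
    (h₂ : ∀ i j l p q r, R (.inl i, p) (.inr j, q) (.inr l, r))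
    (h₃ : ∀ i j l p q r, R (.inr i, p) (.inr j, q) (.inr l, r))
    (x y z : (ι ⊕ ι) × L) : R x y z := by
  obtain ⟨i | i, p⟩ := x <;> obtain ⟨j | j, q⟩ := y <;> obtain ⟨l | l, r⟩ := z
  · exact h₀ _ _ _ _ _ _
  · exact h₁ _ _ _ _ _ _
  · exact h₂₃ _ _ _ (h₁ _ _ _ _ _ _)
  · exact h₂ _ _ _ _ _ _
  · exact h₁₂ _ _ _ (h₂₃ _ _ _ (h₁ _ _ _ _ _ _))
  · exact h₁₂ _ _ _ (h₂ _ _ _ _ _ _)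
  · exact h₂₃ _ _ _ (h₁₂ _ _ _ (h₂ _ _ _ _ _ _))
  · exact h₃ _ _ _ _ _ _

variable {c a d b : ι → ι → ι → k → k → k}

lemma IsBialgebraConstants.symm_br (h : IsBialgebraConstants c a d b) :
    IsSignSymmetric (-1) (triform (-1) c d) :=
  triform_symm (by ring) (fun i j m p q => by rw [h.skew]; ring)
    (fun i j m p q => by rw [h.coskew]; ring)

lemma IsBialgebraConstants.symm_mul (h : IsBialgebraConstants c a d b) :
    IsSignSymmetric 1 (triform 1 a b) :=
  triform_symm (by ring) (fun i j m p q => by rw [h.comm]; ring)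
    (fun i j m p q => by rw [h.cocomm]; ring)

lemma glue_cases (S T : (ι ⊕ ι) × k → (ι ⊕ ι) × k → (ι ⊕ ι) × k → k) (x y z w : (ι ⊕ ι) × k) :
    glue 1 S T x y z w =
      ∑ m, S x y (.inl m, -(x.2 + y.2)) * T (.inr m, x.2 + y.2) z w +
        ∑ m, S x y (.inr m, -(x.2 + y.2)) * T (.inl m, x.2 + y.2) z w := by
  simp [glue]

lemma glue_one_exchange (hS : IsSignSymmetric ε S) (hT : IsSignSymmetric ε' T)
    (x y z w : (ι ⊕ ι) × k) (h : x.2 + y.2 + z.2 + w.2 = 0) :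
    glue 1 S T z w x y = glue 1 T S x y z w :=
  glue_exchange hS hT 1 x y z w h

set_option linter.unusedSimpArgs false in
-- The cyclic sum is alternating in the four legs up to exchange of the two factors, so only the
-- number of covectors matters. One covector gives the Jacobi identity, two the cocycle condition,
-- three the co-Jacobi identity; with none or four each summand contains a form with three legs of
-- one type.
theorem IsBialgebraConstants.glue_jacobi (h : IsBialgebraConstants c a d b)
    (x y z w : (ι ⊕ ι) × k) : x.2 + y.2 + z.2 + w.2 = 0 →
      glue 1 (triform (-1) c d) (triform (-1) c d) x y z w +
        glue 1 (triform (-1) c d) (triform (-1) c d) y z x w +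
          glue 1 (triform (-1) c d) (triform (-1) c d) z x y w = 0 := by
  have hT := h.symm_br
  revert x y z w
  refine leg_induction₄ _ ?_ ?_ ?_ ?_ ?_ ?_ ?_ ?_
  · intro x y z w H hs
    rw [glue_swap_left hT _ x y, glue_swap_left hT _ z x, glue_swap_left hT _ y z]
    linear_combination -H (by linear_combination hs)
  · intro x y z w H hs
    rw [glue_swap_left hT _ z x, glue_swap_left hT _ y z, glue_swap_left hT _ x y]
    linear_combination -H (by linear_combination hs)
  · intro x y z w H hs
    have H := H (by linear_combination hs)
    rw [glue_swap_right hT _ x y z w, glue_one_exchange hT hT x z y w (by linear_combination hs),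
      glue_one_exchange hT hT y z w x (by linear_combination hs), glue_swap_right hT _ y z x w,
      glue_swap_left hT _ z x]
    linear_combination -H
  · intro i j l n p q r s hs
    simp [glue_cases, triform]
  · intro i j l n p q r s hs
    obtain rfl : s = -(p + q + r) := by linear_combination hs
    have H := h.jacobi i j l n p q r
    -- Skew-symmetry puts the constants into the argument order in which `triform` unfolds in the
    -- goal; the same preparation occurs in the cases below.
    simp only [h.skew i _ n p, h.skew j _ n q, h.skew i l _ p r] at H
    simp only [glue_cases, triform, neg_neg, zero_mul, mul_zero, Finset.sum_const_zero, zero_add,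
      add_zero, one_mul, neg_mul, mul_neg, Finset.sum_neg_distrib] at H ⊢
    ring_nf at H ⊢
    linear_combination -H
  · intro i j l n p q r s hs
    obtain rfl : s = -(p + q + r) := by linear_combination hs
    have H := h.compat_lie i j l n p q (-r) (-(-(p + q + r))) (by ring)
    simp only [fstTerm, sndTerm, h.skew i _ n p, h.skew j _ n q] at H
    simp only [glue_cases, triform, neg_neg, zero_mul, mul_zero, Finset.sum_const_zero, zero_add,
      add_zero, one_mul, neg_mul, mul_neg, Finset.sum_neg_distrib] at H ⊢
    ring_nf at H ⊢
    simp only [mul_comm (d _ _ _ _ _) (c _ _ _ _ _)] at H ⊢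
    linear_combination H
  · intro i j l n p q r s hs
    have H := h.cojacobi n i j l (-p) (-q) (-r)
    simp only [h.coskew n i, h.coskew n j, h.coskew _ i l] at H
    simp only [glue_cases, triform, neg_neg, zero_mul, mul_zero, Finset.sum_const_zero, zero_add,
      add_zero, one_mul, neg_mul, mul_neg, Finset.sum_neg_distrib] at H ⊢
    ring_nf at H ⊢
    simp only [mul_comm (d n _ _ _ _)] at H ⊢
    linear_combination -H
  · intro i j l n p q r s hs
    simp [glue_cases, triform]

set_option linter.unusedSimpArgs false in
-- The three ways to pair four legs give the same value. Both equalities are stated together because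
-- permuting the legs permutes the three pairings. One covector gives associativity, two the
-- condition on `Δ(a_λ b)`, three coassociativity.
theorem IsBialgebraConstants.glue_assoc (h : IsBialgebraConstants c a d b)
    (x y z w : (ι ⊕ ι) × k) : x.2 + y.2 + z.2 + w.2 = 0 →
      glue 1 (triform 1 a b) (triform 1 a b) x y z w =
        glue 1 (triform 1 a b) (triform 1 a b) y z x w ∧
      glue 1 (triform 1 a b) (triform 1 a b) x y z w =
        glue 1 (triform 1 a b) (triform 1 a b) x z y w := by
  have hT := h.symm_mul
  -- The second equality is the first one with `x` and `y` exchanged, so each case needs one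
  -- identity in two instances.
  have key : ∀ x y z w : (ι ⊕ ι) × k, (glue 1 (triform 1 a b) (triform 1 a b) x y z w =
        glue 1 (triform 1 a b) (triform 1 a b) y z x w) →
      (glue 1 (triform 1 a b) (triform 1 a b) y x z w =
        glue 1 (triform 1 a b) (triform 1 a b) x z y w) →
      glue 1 (triform 1 a b) (triform 1 a b) x y z w =
        glue 1 (triform 1 a b) (triform 1 a b) y z x w ∧
      glue 1 (triform 1 a b) (triform 1 a b) x y z w =
        glue 1 (triform 1 a b) (triform 1 a b) x z y w := by
    intro x y z w h1 h2
    rw [glue_swap_left hT, one_mul] at h2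
    exact ⟨h1, h2⟩
  revert x y z w
  refine leg_induction₄ _ ?_ ?_ ?_ ?_ ?_ ?_ ?_ ?_
  · intro x y z w H hs
    obtain ⟨H, H'⟩ := H (by linear_combination hs)
    rw [glue_swap_left hT _ x y, one_mul]
    exact ⟨H', H⟩
  · intro x y z w H hs
    obtain ⟨H, H'⟩ := H (by linear_combination hs)
    rw [glue_swap_left hT _ y z, one_mul]
    exact ⟨H'.symm.trans H, H'.symm⟩
  · intro x y z w H hs
    obtain ⟨H, H'⟩ := H (by linear_combination hs)
    rw [glue_swap_right hT _ x y z w, glue_one_exchange hT hT x z y w (by linear_combination hs),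
      glue_one_exchange hT hT y z x w (by linear_combination hs), one_mul]
    exact ⟨H', H⟩
  · intro i j l n p q r s hs
    simp [glue_cases, triform]
  · intro i j l n p q r s hs
    have H : ∀ i j p q, ∑ m, a i j m p q * a m l n (p + q) r =
        ∑ m, a j l m q r * a m i n (q + r) p := by
      intro i j p q
      rw [h.assoc]
      exact Finset.sum_congr rfl fun m _ => by rw [h.comm i]
    refine key _ _ _ _ ?_ ?_
    · simpa [glue_cases, triform] using H i j p q
    · simpa [glue_cases, triform] using H j i q p
  · intro i j l n p q r s hs
    obtain rfl : s = -(p + q + r) := by linear_combination hs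
    have H : ∀ i j p q, ∑ m, a i j m p q * b m l n (-r) (p + q + r) =
        ∑ m, a j m l q (-(q + r)) * b i m n (-(q + r)) (p + q + r) +
          ∑ m, b j l m (-r) (q + r) * a m i n (q + r) p := by
      intro i j p q
      have H := h.compat_asi i j l n p q (-r) (p + q + r) (by ring)
      simp only [fstTerm, sndTerm, h.comm i _ n p] at H
      ring_nf at H ⊢
      simp only [mul_comm (b _ _ _ _ _) (a _ _ _ _ _)] at H ⊢
      linear_combination H
    refine key _ _ _ _ ?_ ?_
    · simpa [glue_cases, triform] using H i j p q
    · simpa [glue_cases, triform, add_comm p q] using H j i q p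
  · intro i j l n p q r s hs
    have H : ∀ i j p q, ∑ m, b m i j (-p) (-q) * b n m l (-(p + q)) (-r) =
        ∑ m, b m j l (-q) (-r) * b n m i (-(q + r)) (-p) := by
      intro i j p q
      have H := h.coassoc n i j l (-p) (-q) (-r)
      simp only [h.cocomm n i] at H
      ring_nf at H ⊢
      simp only [mul_comm (b n _ _ _ _)] at H ⊢
      linear_combination -H
    refine key _ _ _ _ ?_ ?_
    · simpa [glue_cases, triform] using H i j p q
    · simpa [glue_cases, triform] using H j i q p
  · intro i j l n p q r s hs
    simp [glue_cases, triform]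

set_option linter.unusedSimpArgs false in
-- The bracket with `x` is a derivation that preserves the form of the product. The identity is
-- symmetric in `y, z, w` only, so the type of `x` is a separate case: with two vectors and one
-- covector among `y, z, w` it is the Leibniz rule (`x` a vector) or the condition on `δ(a_λ b)`
-- (`x` a covector); with one vector and two covectors it is the condition on `Δ([a_λ b])` or the
-- co-Leibniz rule.
theorem IsBialgebraConstants.glue_leibniz (h : IsBialgebraConstants c a d b)
    (x y z w : (ι ⊕ ι) × k) : x.2 + y.2 + z.2 + w.2 = 0 →
      glue 1 (triform (-1) c d) (triform 1 a b) x y z w +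
        glue 1 (triform (-1) c d) (triform 1 a b) x z y w +
          glue 1 (triform (-1) c d) (triform 1 a b) x w y z = 0 := by
  have hS := h.symm_br
  have hT := h.symm_mul
  revert y z w
  refine leg_induction₃ _ ?_ ?_ ?_ ?_ ?_ ?_
  · intro y z w H hs
    rw [glue_swap_right hT _ x w y z]
    linear_combination H (by linear_combination hs)
  · intro y z w H hs
    rw [glue_swap_right hT _ x y z w]
    linear_combination H (by linear_combination hs)
  · intro i j l p q r hs
    obtain ⟨n | n, u⟩ := x
    · simp [glue_cases, triform]
    · obtain rfl : u = -(p + q + r) := by linear_combination hs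
      have H := h.leibniz i j l n p q r
      -- With `x` a covector and three vectors, the claim is `[i, jl] + [j, li] + [l, ij] = 0`. In
      -- the sum of the three Leibniz rules the right-hand sides cancel in pairs by skew-symmetry
      -- and commutativity.
      have H' := h.leibniz j l i n q r p
      have H'' := h.leibniz l i j n r p q
      simp only [h.skew i l, h.comm j _ n q] at H
      simp only [h.skew j i, h.comm l _ n r, h.comm l i _ r p] at H'
      simp only [h.skew l j, h.comm i _ n p] at H''
      simp only [glue_cases, triform, neg_neg, zero_mul, mul_zero, Finset.sum_const_zero, zero_add,
      add_zero, one_mul, neg_mul, mul_neg, Finset.sum_neg_distrib] at H H' H'' ⊢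
      ring_nf at H H' H'' ⊢
      simp only [mul_comm (c _ _ _ _ _) (a _ _ _ _ _)] at H H' H'' ⊢
      linear_combination H + H' + H''
  · intro i j l p q r hs
    obtain ⟨n | n, u⟩ := x
    · obtain rfl : r = -(u + p + q) := by linear_combination hs
      have H := h.leibniz n i j l u p q
      simp only [h.comm i _ l p] at H
      simp only [glue_cases, triform, neg_neg, zero_mul, mul_zero, Finset.sum_const_zero, zero_add,
      add_zero, one_mul, neg_mul, mul_neg, Finset.sum_neg_distrib] at H ⊢
      ring_nf at H ⊢
      simp only [mul_comm (c _ _ _ _ _) (a _ _ _ _ _)] at H ⊢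
      linear_combination -H
    · obtain rfl : r = -(u + p + q) := by linear_combination hs
      have H := h.compat_mul i j l n p q (u + p + q) (-u) (by ring)
      simp only [fstTerm, sndTerm, h.coskew _ l, h.coskew i _ n, h.coskew j _ n,
        h.cocomm _ l, h.comm i _ l p, h.comm j _ l q] at H
      simp only [glue_cases, triform, neg_neg, zero_mul, mul_zero, Finset.sum_const_zero, zero_add,
      add_zero, one_mul, neg_mul, mul_neg, Finset.sum_neg_distrib] at H ⊢
      ring_nf at H ⊢
      simp only [mul_comm (c _ _ _ _ _) (b _ _ _ _ _), mul_comm (d _ _ _ _ _) (a _ _ _ _ _)] at H ⊢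
      linear_combination -H
  · intro i j l p q r hs
    obtain ⟨n | n, u⟩ := x
    · obtain rfl : r = -(u + p + q) := by linear_combination hs
      have H := h.compat_br n i j l u p (-q) (u + p + q) (by ring)
      simp only [fstTerm, sndTerm, h.cocomm i j, h.comm i _ j p,
        h.comm i _ l p, h.coskew n _ l] at H
      simp only [glue_cases, triform, neg_neg, zero_mul, mul_zero, Finset.sum_const_zero, zero_add,
      add_zero, one_mul, neg_mul, mul_neg, Finset.sum_neg_distrib] at H ⊢
      ring_nf at H ⊢
      simp only [mul_comm (c _ _ _ _ _) (b _ _ _ _ _)] at H ⊢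
      linear_combination H
    · have H := h.coleibniz i n j l (-u) (-q) (-r)
      obtain rfl : p = -(u + q + r) := by linear_combination hs
      simp only [h.cocomm i j] at H
      simp only [glue_cases, triform, neg_neg, zero_mul, mul_zero, Finset.sum_const_zero, zero_add,
      add_zero, one_mul, neg_mul, mul_neg, Finset.sum_neg_distrib] at H ⊢
      ring_nf at H ⊢
      simp only [mul_comm (d _ _ _ _ _) (b _ _ _ _ _)] at H ⊢
      linear_combination -H
  · intro i j l p q r hs
    obtain ⟨n | n, u⟩ := x
    · have H := h.coleibniz n i j l (-p) (-q) (-r)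
      -- The dual situation: three co-Leibniz rules, whose right-hand sides cancel in pairs.
      have H' := h.coleibniz n j i l (-q) (-p) (-r)
      have H'' := h.coleibniz n l i j (-r) (-p) (-q)
      obtain rfl : u = -(p + q + r) := by linear_combination hs
      simp only [h.coskew _ j i] at H'
      simp only [h.coskew _ l i, h.coskew _ l j, h.cocomm n _ j] at H''
      simp only [glue_cases, triform, neg_neg, zero_mul, mul_zero, Finset.sum_const_zero, zero_add,
      add_zero, one_mul, neg_mul, mul_neg, Finset.sum_neg_distrib] at H H' H'' ⊢
      ring_nf at H H' H'' ⊢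
      linear_combination H + H' + H''
    · simp [glue_cases, triform]

end TrilinearForm

/-! ### The structure constants of the double -/

section DoubleConstants

variable {k ι : Type*} [Field k]

/-- The structure constants of the product on the double given by an invariant trilinear form. -/
def formProduct (T : (ι ⊕ ι) × k → (ι ⊕ ι) × k → (ι ⊕ ι) × k → k) (X Y Z : ι ⊕ ι) (p q : k) : k :=
  T (X, p) (Y, q) (Z.swap, -(p + q))

/-- The weight `1` for two vectors, `-1` for two covectors and `0` for a vector and a covector. -/
def typeWeight (k : Type*) [Field k] (X Y : ι ⊕ ι) : k :=
  Sum.elim (fun _ => 1) (fun _ => 0) X + Sum.elim (fun _ => 1) (fun _ => 0) Y - 1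

/-- The structure constants of the coboundary coproduct on the double given by an invariant
trilinear form. -/
def formCoproduct (T : (ι ⊕ ι) × k → (ι ⊕ ι) × k → (ι ⊕ ι) × k → k) (Z X Y : ι ⊕ ι)
    (s t : k) : k :=
  typeWeight k X Y * T (Z, s + t) (X.swap, -s) (Y.swap, -t)

lemma typeWeight_comm (X Y : ι ⊕ ι) : typeWeight k X Y = typeWeight k Y X := by
  simp only [typeWeight]; ring

/-- Exactly one of `M` and its dual is a vector, so their contributions add up to `1` and cancel one
of the two `-1`. -/
lemma typeWeight_swap (X Y M : ι ⊕ ι) :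
    typeWeight k X M + typeWeight k M.swap Y = typeWeight k X Y := by
  rcases M with m | m <;> simp [typeWeight] <;> ring

/-- The indicator function of triples of the same type. -/
def sameType (k : Type*) [Field k] (X Y Z : ι ⊕ ι) : k :=
  typeWeight k X Y * typeWeight k Y Z

lemma sameType_perm (X Y Z : ι ⊕ ι) : sameType k Y Z X = sameType k X Y Z := by
  rcases X with X | X <;> rcases Y with Y | Y <;> rcases Z with Z | Z <;>
    simp [sameType, typeWeight]

lemma sameType_swap (X Y Z : ι ⊕ ι) : sameType k Y X Z = sameType k X Y Z := by
  rcases X with X | X <;> rcases Y with Y | Y <;> rcases Z with Z | Z <;>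
    simp [sameType, typeWeight]

variable {ε ε' : k} {S T : (ι ⊕ ι) × k → (ι ⊕ ι) × k → (ι ⊕ ι) × k → k}

lemma formCoproduct_symm (hT : IsSignSymmetric ε T) (Z X Y : ι ⊕ ι) (s t : k) :
    formCoproduct T Z X Y s t = ε * formCoproduct T Z Y X t s := by
  rw [formCoproduct, formCoproduct, typeWeight_comm, hT.swap₂₃, add_comm]; ring

lemma formProduct_symm (hT : IsSignSymmetric ε T) (X Y Z : ι ⊕ ι) (s t : k) :
    formProduct T X Y Z s t = ε * formProduct T Y X Z t s := by
  rw [formProduct, formProduct, hT.swap₁₂, add_comm]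

variable [Fintype ι]

/-- A coordinate of a product is its pairing with the dual basis vector, so composing operations
contracts their forms along dual bases. -/
lemma sum_formProduct_left (S T : (ι ⊕ ι) × k → (ι ⊕ ι) × k → (ι ⊕ ι) × k → k) (x y z n : ι ⊕ ι)
    (p q r : k) :
    ∑ M, formProduct S x y M p q * formProduct T M z n (p + q) r =
      glue 1 S T (x, p) (y, q) (z, r) (n.swap, -(p + q + r)) := by
  refine Fintype.sum_equiv (Equiv.sumComm ι ι) _ _ fun M => ?_
  simp [formProduct]

lemma sum_formProduct_right (hT : IsSignSymmetric ε T) (x y z n : ι ⊕ ι) (p q r u : k)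
    (hu : u = p + (q + r)) :
    ∑ M, formProduct S y z M q r * formProduct T x M n p (q + r) =
      ε * glue 1 S T (y, q) (z, r) (x, p) (n.swap, -u) := by
  subst hu
  rw [glue, Finset.mul_sum]
  refine Fintype.sum_equiv (Equiv.sumComm ι ι) _ _ fun M => ?_
  simp only [formProduct, Equiv.sumComm_apply, Sum.swap_swap, Pi.one_apply]
  rw [hT.swap₁₂]
  ring

lemma sum_formProduct_formCoproduct (S T : (ι ⊕ ι) × k → (ι ⊕ ι) × k → (ι ⊕ ι) × k → k)
    (x y i j : ι ⊕ ι) (p q s t : k) (h : p + q = s + t) :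
    ∑ M, formProduct S x y M p q * formCoproduct T M i j s t =
      typeWeight k i j * glue 1 S T (x, p) (y, q) (i.swap, -s) (j.swap, -t) := by
  rw [glue, Finset.mul_sum]
  refine Fintype.sum_equiv (Equiv.sumComm ι ι) _ _ fun M => ?_
  simp only [formProduct, formCoproduct, Equiv.sumComm_apply, Sum.swap_swap, Pi.one_apply, h]
  ring

/-- The contracted leg is one of the two output legs of the coproduct, so the weight depends on the
summation index and stays inside the sum. It becomes constant only after pairing with a second such
term. -/
lemma fstTerm_form (hS : IsSignSymmetric ε S) (hT : IsSignSymmetric ε' T)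
    (x y i j : ι ⊕ ι) (p q s t : k) (h : p + q = s + t) :
    fstTerm (formProduct S) (formCoproduct T) x y i j p s t =
      ε * ε' * glue (fun M => typeWeight k M j) S T (x, p) (i.swap, -s) (y, q) (j.swap, -t) := by
  obtain rfl : q = s - p + t := by linear_combination h
  rw [fstTerm, glue, Finset.mul_sum]
  refine Finset.sum_congr rfl fun M _ => ?_
  simp only [formProduct, formCoproduct, add_sub_cancel]
  rw [hS.swap₂₃ (x, p) (i.swap, -s), hT.swap₁₂ (M.swap, _) (y, _)]
  rw [show -(p + -s) = s - p by ring, show -(s - p) = p + -s by ring]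
  ring

lemma sndTerm_form (hS : IsSignSymmetric ε S) (hT : IsSignSymmetric ε' T)
    (x y i j : ι ⊕ ι) (p q s t : k) (h : p + q = s + t) :
    sndTerm (formProduct S) (formCoproduct T) x y i j p s t =
      ε * glue (fun M => typeWeight k i M) S T (x, p) (j.swap, -t) (y, q) (i.swap, -s) := by
  obtain rfl : q = s + (t - p) := by linear_combination h
  rw [sndTerm, glue, Finset.mul_sum]
  refine Finset.sum_congr rfl fun M _ => ?_
  simp only [formProduct, formCoproduct, add_sub_cancel]
  rw [hS.swap₂₃ (x, p) (j.swap, -t), hT.rotate (M.swap, _) (y, _)]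
  rw [show -(p + -t) = t - p by ring, show -(t - p) = p + -t by ring]
  ring

/-- A nonzero weight forces `j` and `l` to have one type. As the form vanishes on three legs of one
type, the intermediate `M` has that type too, and then so has `i`. Hence the product of the weights
is constant on the nonzero terms. -/
lemma sum_formCoproduct_right (e e' : k) (c d c' d' : ι → ι → ι → k → k → k) (n i j l : ι ⊕ ι)
    (p q r : k) :
    ∑ M, formCoproduct (triform e c d) n i M p (q + r) *
        formCoproduct (triform e' c' d') M j l q r =
      sameType k i j l * glue 1 (triform e c d) (triform e' c' d') (n, p + q + r) (i.swap, -p)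
        (j.swap, -q) (l.swap, -r) := by
  rw [glue, Finset.mul_sum]
  refine Fintype.sum_equiv (Equiv.sumComm ι ι) _ _ fun M => ?_
  simp only [formCoproduct, Equiv.sumComm_apply, Sum.swap_swap, Pi.one_apply, one_mul,
    show p + q + r + -p = q + r by ring,
    show p + (q + r) = p + q + r by ring, sameType]
  rcases M with M | M <;> rcases j with j | j <;> rcases l with l | l <;>
    simp [typeWeight, triform] <;> ring

lemma sum_formCoproduct_left (e e' : k) (c d c' d' : ι → ι → ι → k → k → k)
    (h : IsSignSymmetric e (triform e c d)) (n i j l : ι ⊕ ι) (p q r : k) :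
    ∑ M, formCoproduct (triform e c d) n M l (p + q) r *
        formCoproduct (triform e' c' d') M i j p q =
      e * sameType k i j l * glue 1 (triform e c d) (triform e' c' d') (n, p + q + r)
        (l.swap, -r) (i.swap, -p) (j.swap, -q) := by
  have := sum_formCoproduct_right e e' c d c' d' n l i j r p q
  rw [show r + p + q = p + q + r by ring, ← sameType_perm] at this
  rw [mul_assoc, ← this, Finset.mul_sum]
  refine Finset.sum_congr rfl fun M _ => ?_
  rw [formCoproduct_symm h]
  ring

/-- This is `typeWeight_swap` summed over the contracted leg. In the compatibility conditions the
two summands come from the action of one element on a coproduct and of the other element on another.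
-/
lemma glue_typeWeight_left (i j : ι ⊕ ι) (x y z w : (ι ⊕ ι) × k) :
    glue (fun M => typeWeight k M j) S T x y z w +
      glue ((fun M => typeWeight k i M) ∘ Sum.swap) S T x y z w =
        typeWeight k i j * glue 1 S T x y z w := by
  rw [glue_add, ← glue_const]
  congr 1
  ext M
  simpa [add_comm] using typeWeight_swap (k := k) i j M.swap

lemma glue_typeWeight_right (i j : ι ⊕ ι) (x y z w : (ι ⊕ ι) × k) :
    glue (fun M => typeWeight k i M) S T x y z w +
      glue ((fun M => typeWeight k M j) ∘ Sum.swap) S T x y z w =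
        typeWeight k i j * glue 1 S T x y z w := by
  rw [glue_add, ← glue_const]
  congr 1
  ext M
  simpa using typeWeight_swap (k := k) i j M

variable {c a d b : ι → ι → ι → k → k → k}

/-- Each axiom is one of the three four-leg identities times a factor: `±1` for the algebra axioms,
`±sameType` for the coalgebra axioms and `±typeWeight` for the compatibility conditions, where
weighted terms are first combined in pairs. Antisymmetry is the difference of the two equalities of
`glue_assoc`. -/
theorem IsBialgebraConstants.double (h : IsBialgebraConstants c a d b) :
    IsBialgebraConstants (formProduct (triform (-1) c d)) (formProduct (triform 1 a b))
      (formCoproduct (triform (-1) c d)) (formCoproduct (triform 1 a b)) := by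
  have hS := h.symm_br
  have hT := h.symm_mul
  refine ⟨?_, ?_, ?_, ?_, ?_, ?_, ?_, ?_, ?_, ?_, ?_, ?_, ?_, ?_, ?_⟩
  · intro i j m p q
    rw [formProduct_symm hS]; ring
  · intro i j m p q
    rw [formProduct_symm hT]; ring
  · intro i j m p q
    rw [formCoproduct_symm hS]; ring
  · intro i j m p q
    rw [formCoproduct_symm hT]; ring
  · intro i j l n p q r
    have H := h.glue_jacobi (i, p) (j, q) (l, r) (n.swap, -(p + q + r)) (by simp)
    rw [sum_formProduct_right hS _ _ _ _ p q r (p + q + r) (by ring), sum_formProduct_left,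
      sum_formProduct_right hS _ _ _ _ q p r (p + q + r) (by ring),
      glue_swap_left hS _ (l, r) (i, p)]
    linear_combination -H
  · intro i j l n p q r
    have H := h.glue_assoc (i, p) (j, q) (l, r) (n.swap, -(p + q + r)) (by simp)
    rw [sum_formProduct_right hT _ _ _ _ p q r (p + q + r) (by ring), sum_formProduct_left]
    linear_combination H.1
  · intro i j l n p q r
    have hs : (i, p).2 + (j, q).2 + (l, r).2 + (n.swap, -(p + q + r)).2 = 0 := by simp
    have H := h.glue_leibniz (i, p) (j, q) (l, r) (n.swap, -(p + q + r)) hs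
    rw [sum_formProduct_right hS _ _ _ _ p q r (p + q + r) (by ring), sum_formProduct_left,
      sum_formProduct_right hT _ _ _ _ q p r (p + q + r) (by ring),
      glue_one_exchange hT hS (i, p) (n.swap, -(p + q + r)) (j, q) (l, r)
        (by linear_combination hs)]
    linear_combination -H
  · intro n i j l p q r
    have hs : (n, p + q + r).2 + (i.swap, -p).2 + (j.swap, -q).2 + (l.swap, -r).2 = 0 := by
      simp only; ring
    have H := h.glue_jacobi _ _ _ _ hs
    have hp : q + p + r = p + q + r := by ring
    rw [sum_formCoproduct_right, sum_formCoproduct_right, sum_formCoproduct_left _ _ _ _ _ _ hS,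
      hp, sameType_swap i j l]
    rw [glue_swap_left hS _ (n, _) (j.swap, _), glue_one_exchange hS hS (n, _) (l.swap, _)
      (i.swap, _) (j.swap, _) (by linear_combination hs)] at H
    linear_combination sameType k i j l * H
  · intro n i j l p q r
    have hs : (n, p + q + r).2 + (i.swap, -p).2 + (j.swap, -q).2 + (l.swap, -r).2 = 0 := by
      simp only; ring
    have H := (h.glue_assoc _ _ _ _ hs).1
    rw [sum_formCoproduct_right, sum_formCoproduct_left _ _ _ _ _ _ hT]
    rw [glue_one_exchange hT hT (n, _) (l.swap, _)
      (i.swap, _) (j.swap, _) (by linear_combination hs)] at H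
    linear_combination sameType k i j l * H
  · intro n i j l p q r
    -- The bracket leg of `glue_leibniz` is here the first output leg `i`, the one that all three
    -- terms attach to the cobracket.
    have hs : (i.swap, -p).2 + (n, p + q + r).2 + (j.swap, -q).2 + (l.swap, -r).2 = 0 := by
      simp only; ring
    have H := h.glue_leibniz _ _ _ _ hs
    have hp : q + p + r = p + q + r := by ring
    rw [sum_formCoproduct_right, sum_formCoproduct_right, sum_formCoproduct_left _ _ _ _ _ _ hT,
      hp, sameType_swap i j l, glue_one_exchange hT hS (i.swap, _) (j.swap, _) (n, _) (l.swap, _)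
        (by linear_combination hs), glue_one_exchange hT hS (i.swap, _) (l.swap, _) (n, _)
        (j.swap, _) (by linear_combination hs)]
    rw [glue_swap_left hS _ (n, _) (i.swap, _)] at H
    linear_combination -sameType k i j l * H
  · intro x y i j p q s t hs
    have hs' := (add_comm q p).trans hs
    have h0 : (x, p).2 + (y, q).2 + (i.swap, -s).2 + (j.swap, -t).2 = 0 := by
      linear_combination hs
    have H := h.glue_jacobi _ _ _ _ h0
    rw [glue_swap_left hS _ (x, p) (i.swap, _), glue_one_exchange hS hS (x, p) (j.swap, _) (y, q)
      (i.swap, _) (by linear_combination h0)] at H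
    rw [sum_formProduct_formCoproduct _ _ _ _ _ _ _ _ _ _ hs, fstTerm_form hS hS _ _ _ _ _ _ _ _ hs,
      sndTerm_form hS hS _ _ _ _ _ _ _ _ hs, fstTerm_form hS hS _ _ _ _ _ _ _ _ hs',
      sndTerm_form hS hS _ _ _ _ _ _ _ _ hs',
      glue_exchange hS hS _ (x, p) (j.swap, _) (y, q) (i.swap, _) (by linear_combination h0),
      glue_exchange hS hS _ (x, p) (i.swap, _) (y, q) (j.swap, _) (by linear_combination h0)]
    linear_combination typeWeight k i j * H - glue_typeWeight_left (S := triform (-1) c d)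
      (T := triform (-1) c d) i j (x, p) (i.swap, -s) (y, q) (j.swap, -t) +
      glue_typeWeight_right (S := triform (-1) c d)
      (T := triform (-1) c d) i j (x, p) (j.swap, -t) (y, q) (i.swap, -s)
  · intro x y i j p q s t hs
    have hs' := (add_comm q p).trans hs
    have h0 : (x, p).2 + (y, q).2 + (j.swap, -t).2 + (i.swap, -s).2 = 0 := by
      linear_combination hs
    have H := (h.glue_assoc _ _ _ _ h0).2
    rw [glue_swap_right hT _ (x, p) (y, q) (i.swap, _)] at H
    rw [sum_formProduct_formCoproduct _ _ _ _ _ _ _ _ _ _ hs,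
      sndTerm_form hT hT _ _ _ _ _ _ _ _ hs, fstTerm_form hT hT _ _ _ _ _ _ _ _ hs',
      glue_exchange hT hT _ (x, p) (j.swap, _) (y, q) (i.swap, _) (by linear_combination h0)]
    linear_combination typeWeight k i j * H - glue_typeWeight_right (S := triform 1 a b)
      (T := triform 1 a b) i j (x, p) (j.swap, -t) (y, q) (i.swap, -s)
  · intro x y i j p q s t hs
    have hs' := (add_comm q p).trans hs
    have hs'' := hs.trans (add_comm s t)
    have h0 : (x, p).2 + (y, q).2 + (i.swap, -s).2 + (j.swap, -t).2 = 0 := by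
      linear_combination hs
    have H := h.glue_assoc _ _ _ _ h0
    rw [glue_one_exchange hT hT (x, p) (j.swap, _) (y, q)
      (i.swap, _) (by linear_combination h0)] at H
    rw [fstTerm_form hT hT _ _ _ _ _ _ _ _ hs', sndTerm_form hT hT _ _ _ _ _ _ _ _ hs',
      fstTerm_form hT hT _ _ _ _ _ _ _ _ hs'', sndTerm_form hT hT _ _ _ _ _ _ _ _ hs'',
      glue_exchange hT hT _ (x, p) (j.swap, _) (y, q) (i.swap, _) (by linear_combination h0),
      glue_exchange hT hT _ (x, p) (i.swap, _) (y, q) (j.swap, _) (by linear_combination h0)]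
    rw [show (fun M => typeWeight k M i) = fun M => typeWeight k i M from
        _root_.funext fun M => typeWeight_comm M i,
      show (fun M => typeWeight k j M) = fun M => typeWeight k M j from
        _root_.funext fun M => typeWeight_comm j M]
    -- The four terms combine to `typeWeight i j` times `(xj|yi) - (xi|yj)`, with `i`, `j` standing
    -- for their duals, and both pairings equal `(xy|ij)`.
    have h1 := glue_typeWeight_right (S := triform 1 a b)
      (T := triform 1 a b) i j (x, p) (j.swap, -t) (y, q) (i.swap, -s)
    have h2 := glue_typeWeight_left (S := triform 1 a b)
      (T := triform 1 a b) i j (x, p) (i.swap, -s) (y, q) (j.swap, -t)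
    linear_combination h1 - h2 + typeWeight k i j * (H.2 - H.1)
  · intro x y i j p q s t hs
    have hs' := (add_comm q p).trans hs
    -- In the condition on `δ(a_λ b)` the bracket leg is the second output leg `j`; in the next
    -- condition, on `Δ([a_λ b])`, it is `x`.
    have h0 : (j.swap, -t).2 + (i.swap, -s).2 + (x, p).2 + (y, q).2 = 0 := by
      linear_combination hs
    have H := h.glue_leibniz _ _ _ _ h0
    rw [glue_swap_left hS _ (i.swap, _) (j.swap, _), glue_swap_left hS _ (x, p) (j.swap, _),
      glue_swap_left hS _ (y, q) (j.swap, _), glue_swap_right hT _ _ _ (y, q) (i.swap, _),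
      glue_swap_right hT _ _ _ (x, p) (i.swap, _)] at H
    rw [sum_formProduct_formCoproduct _ _ _ _ _ _ _ _ _ _ hs,
      fstTerm_form hT hS _ _ _ _ _ _ _ _ hs, fstTerm_form hT hS _ _ _ _ _ _ _ _ hs',
      sndTerm_form hS hT _ _ _ _ _ _ _ _ hs, sndTerm_form hS hT _ _ _ _ _ _ _ _ hs',
      glue_exchange hT hS _ (y, q) (j.swap, _) (x, p) (i.swap, _) (by linear_combination h0),
      glue_exchange hT hS _ (x, p) (j.swap, _) (y, q) (i.swap, _) (by linear_combination h0),
      glue_one_exchange hT hS (i.swap, _) (j.swap, _) (x, p) (y, q) (by linear_combination h0)]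
    linear_combination -typeWeight k i j * H +
      glue_typeWeight_right (S := triform (-1) c d) (T := triform 1 a b) i j
        (x, p) (j.swap, -t) (y, q) (i.swap, -s) +
      glue_typeWeight_right (S := triform (-1) c d) (T := triform 1 a b) i j
        (y, q) (j.swap, -t) (x, p) (i.swap, -s)
  · intro x y i j p q s t hs
    have hs' := (add_comm q p).trans hs
    have h0 : (x, p).2 + (y, q).2 + (i.swap, -s).2 + (j.swap, -t).2 = 0 := by
      linear_combination hs
    have H := h.glue_leibniz _ _ _ _ h0
    rw [sum_formProduct_formCoproduct _ _ _ _ _ _ _ _ _ _ hs,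
      fstTerm_form hS hT _ _ _ _ _ _ _ _ hs, sndTerm_form hS hT _ _ _ _ _ _ _ _ hs,
      sndTerm_form hT hS _ _ _ _ _ _ _ _ hs', fstTerm_form hT hS _ _ _ _ _ _ _ _ hs',
      glue_exchange hT hS _ (x, p) (i.swap, _) (y, q) (j.swap, _) (by linear_combination h0),
      glue_exchange hT hS _ (x, p) (j.swap, _) (y, q) (i.swap, _) (by linear_combination h0)]
    linear_combination typeWeight k i j * H +
      glue_typeWeight_left (S := triform (-1) c d) (T := triform 1 a b) i j
        (x, p) (i.swap, -s) (y, q) (j.swap, -t) +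
      glue_typeWeight_right (S := triform (-1) c d) (T := triform 1 a b) i j
        (x, p) (j.swap, -t) (y, q) (i.swap, -s)

end DoubleConstants

/-! ### Frames of a free module, of its conformal dual and of a direct sum -/

section Frames

variable {k : Type*} [Field k]
  {P : Type*} [AddCommGroup P] [Module k P] [Module k[X] P] [IsScalarTower k k[X] P]
  {Q : Type*} [AddCommGroup Q] [Module k Q] [Module k[X] Q] [IsScalarTower k k[X] Q]
  {ι κ : Type*} [DecidableEq ι] [DecidableEq κ]

/-- The functional `b ↦ f_t b`. -/
def ConformalDual.evalAt (f : ConformalDual k P) (t : k) : P →ₗ[k] k :=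
  Polynomial.leval t ∘ₗ f.toLin

lemma ConformalDual.evalAt_apply (f : ConformalDual k P) (t : k) (b : P) :
    f.evalAt t b = (f.toLin b).eval t := rfl

omit [DecidableEq ι] in
lemma dualBasis_toLin (e : Module.Basis ι k[X] P) (i : ι) (b : P) :
    (dualBasis e i).toLin b = e.coord i b := rfl

/-- The frame given by a `k[∂]`-basis. -/
def basisFrame [Infinite k] (e : Module.Basis ι k[X] P) : Frame k P ι where
  vec := e
  coef i s := (dualBasis e i).evalAt (-s)
  coef_der i s u := by
    simp [ConformalDual.evalAt_apply, ConformalDual.toLin_der]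
  coef_vec i s j := by
    by_cases h : i = j
    · simp [ConformalDual.evalAt_apply, dualBasis_toLin, h]
    · simp [ConformalDual.evalAt_apply, dualBasis_toLin, h]
  separating u hu := by
    refine e.ext_elem fun i => Polynomial.funext fun s => ?_
    have := hu (i, -s)
    simpa [ConformalDual.evalAt_apply, dualBasis_toLin] using this
  span := e.span_eq.ge

/-- The frame of the conformal dual given by a dual basis. -/
def dualFrame [Infinite k] [Fintype ι] (e : Module.Basis ι k[X] P) :
    Frame k (ConformalDual k P) ι :=
  -- On the dual `∂` acts as `-λ`, so `∂ = -s` means `λ = s`, without the sign that occurs in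
  -- `basisFrame`.
  let coef : ι → k → ConformalDual k P →ₗ[k] k := fun i s =>
    { toFun := fun f => f.evalAt s (e i)
      map_add' := fun f g => by simp [ConformalDual.evalAt_apply]
      map_smul' := fun c f => by simp [ConformalDual.evalAt_apply] }
  have coef_der : ∀ i s u, coef i s (der k _ u) = -s * coef i s u := fun i s u => by
    simp [coef, ConformalDual.evalAt_apply, der_conformalDual, dualDer_toLin]
  have coef_vec : ∀ i s j, coef i s (dualBasis e j) = if i = j then 1 else 0 := fun i s j => by
    by_cases h : i = j
    · simp [coef, ConformalDual.evalAt_apply, dualBasis_toLin, h]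
    · simp [coef, ConformalDual.evalAt_apply, dualBasis_toLin, h]
  have separating : Separating fun x : ι × k => coef x.1 x.2 := fun f hf => by
    have he : ∀ i, f.toLin (e i) = 0 := fun i => Polynomial.funext fun s => by
      simpa using show (f.toLin (e i)).eval s = 0 from hf (i, s)
    refine ConformalDual.ext fun b => ?_
    have hb : b ∈ Submodule.span k[X] (Set.range e) := e.mem_span b
    induction hb using Submodule.span_induction with
    | mem x hx =>
      obtain ⟨i, rfl⟩ := hx
      exact he i
    | zero => simp
    | add x y _ _ hx hy => rw [map_add, map_add, hx, hy]
    | smul p x _ hx => rw [ConformalDual.toLin_polySmul, ConformalDual.toLin_polySmul, hx]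
  { vec := dualBasis e
    coef := coef
    coef_der := coef_der
    coef_vec := coef_vec
    separating := separating
    span := by
      intro f _
      -- The coordinate of `f` is `f_λ(eᵢ)` written as a polynomial in `∂ = -λ`.
      have hf : f = ∑ i, ((f.toLin (e i)).comp (-X) : k[X]) • dualBasis e i := by
        refine separating.ext ?_
        rintro ⟨j, s⟩
        simp only [map_sum, apply_polySmul (coef j s) (-s) (coef_der j s), coef_vec]
        simp [coef, ConformalDual.evalAt_apply]
      rw [hf]
      exact Submodule.sum_mem _ fun i _ =>
        Submodule.smul_mem _ _ (Submodule.subset_span ⟨i, rfl⟩) }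

/-- The frame of a direct sum. -/
def Frame.prod (F : Frame k P ι) (G : Frame k Q κ) : Frame k (P × Q) (ι ⊕ κ) where
  vec := Sum.elim (fun i => (F.vec i, 0)) (fun j => (0, G.vec j))
  coef := Sum.elim (fun i s => F.coef i s ∘ₗ LinearMap.fst k P Q)
    (fun j s => G.coef j s ∘ₗ LinearMap.snd k P Q)
  coef_der := by
    rintro (i | i) s ⟨u, v⟩
    · exact F.coef_der i s u
    · exact G.coef_der i s v
  coef_vec := by
    rintro (i | i) s (j | j) <;> simp [F.coef_vec, G.coef_vec]
  separating := by
    rintro ⟨u, v⟩ h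
    refine Prod.ext (F.separating u fun x => ?_) (G.separating v fun x => ?_)
    · exact h (.inl x.1, x.2)
    · exact h (.inr x.1, x.2)
  span := by
    rintro ⟨u, v⟩ _
    have hu := Submodule.mem_map_of_mem (f := LinearMap.inl k[X] P Q)
      (F.span (Submodule.mem_top : u ∈ ⊤))
    have hv := Submodule.mem_map_of_mem (f := LinearMap.inr k[X] P Q)
      (G.span (Submodule.mem_top : v ∈ ⊤))
    rw [Submodule.map_span, ← Set.range_comp] at hu hv
    have h := Submodule.add_mem_sup hu hv
    rw [← Submodule.span_union, ← Set.Sum.elim_range] at h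
    simpa [Function.comp_def] using h

end Frames

/-! ### The structure constants of the products on the double -/

section DoubleEval

variable {k : Type*} [Field k]
  {P : Type*} [AddCommGroup P] [Module k P] [Module k[X] P] [IsScalarTower k k[X] P]
  {V : Type*} [AddCommGroup V] [Module k V] [Module k[X] V] [IsScalarTower k k[X] V]
  {Q : Type*} [AddCommGroup Q] [Module k Q] [Module k[X] Q] [IsScalarTower k k[X] Q]

/-- The evaluation of a polynomial in `λ`, `μ` at `λ = p`, `μ = s`. -/
def evalTwo (p s : k) : k[X][X] →ₗ[k] k :=
  Polynomial.leval s ∘ₗ (Polynomial.leval (C p)).restrictScalars k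

lemma evalTwo_apply (p s : k) (F : k[X][X]) : evalTwo p s F = (F.eval (C p)).eval s := rfl

lemma evalTwo_mul (p s : k) (F G : k[X][X]) :
    evalTwo p s (F * G) = evalTwo p s F * evalTwo p s G := by
  simp [evalTwo_apply]

lemma evalTwo_at (p s : k) (f : ConformalDual k V) (t : k[X][X]) :
    evalTwo p s ∘ₗ f.at t = f.evalAt (evalTwo p s t) := by
  refine LinearMap.ext fun v => ?_
  simp only [LinearMap.comp_apply, ConformalDual.at, AlgHom.toLinearMap_apply,
    ConformalDual.evalAt_apply]
  induction f.toLin v using Polynomial.induction_on' with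
  | add p q hp hq => simp only [map_add, hp, hq, eval_add]
  | monomial n c =>
    have h : ∀ n : ℕ, evalTwo p s (t ^ n) = evalTwo p s t ^ n := by
      intro n
      induction n with
      | zero => simp [evalTwo_apply]
      | succ n ih => rw [pow_succ, evalTwo_mul, ih, pow_succ]
    rw [aeval_monomial, ← Algebra.smul_def, map_smul, h]
    simp

lemma ev_eq_sum {W : Type*} [AddCommGroup W] [Module k W] (ψ : W →ₗ[k] k) (p : k) (x : Lam W) :
    ev ψ p x = x.sum fun n w => p ^ n * ψ w := by
  induction x using Finsupp.induction_linear with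
  | zero => simp
  | add x y hx hy =>
    rw [map_add, hx, hy, Finsupp.sum_add_index' (by simp) (by simp [mul_add])]
  | single n w => simp

/-- This links the two descriptions of polynomials in `λ`: finitely supported coefficient functions,
as in `Lam`, and `k[X][X]`, as in `Family`. -/
lemma ev_eq_evalTwo {W : Type*} [AddCommGroup W] [Module k W] (ψ : W →ₗ[k] k) (p s : k)
    (x : Lam W) (F : k[X][X]) (h : ∀ n, ψ (x n) = (F.coeff n).eval s) :
    ev ψ p x = evalTwo p s F := by
  have hF : F.eval (C p) = ∑ n ∈ x.support ∪ F.support, F.coeff n * C p ^ n := by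
    rw [eval_eq_sum, Polynomial.sum_def]
    exact Finset.sum_subset Finset.subset_union_right
      fun n _ hn => by rw [notMem_support_iff.mp hn, zero_mul]
  rw [ev_eq_sum, Finsupp.sum_of_support_subset _ (Finset.subset_union_left (s₂ := F.support)) _
    (by simp), evalTwo_apply, hF, eval_finsetSum]
  refine Finset.sum_congr rfl fun n _ => ?_
  rw [h, eval_mul, eval_pow, eval_C, mul_comm]

lemma ev_toLam [Module.Finite k[X] V] {ι : Type*} [DecidableEq ι] [Fintype ι] [Infinite k]
    (e : Module.Basis ι k[X] V) (F : Family k V) (m : ι) (p s : k) :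
    ev ((dualFrame e).coef m s) p (Family.toLam F) = evalTwo p s (F.1 (e m)) :=
  ev_eq_evalTwo _ _ _ _ _ fun _ => rfl

lemma ev_contraction (d : Coproduct k P) (φ : P →ₗ[k] k) (f : ConformalDual k P) (a : P) (p : k) :
    ev φ p ((contraction d).1 f a) = tev (f.evalAt p) φ (d.toFun a) := by
  change ev φ p (contractFst f (d.toFun a)) = _
  have h : ∀ (r : k[X]) (x : Lam P), ev φ p (aeval (lam k P) r x) = r.eval p * ev φ p x := by
    intro r x
    induction r using Polynomial.induction_on' with
    | add r r' hr hr' => simp only [map_add, LinearMap.add_apply, hr, hr', eval_add, add_mul]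
    | monomial n c =>
      have h : ∀ n : ℕ, ev φ p ((lam k P ^ n) x) = p ^ n * ev φ p x := by
        intro n
        induction n with
        | zero => simp
        | succ n ih => rw [pow_succ', Module.End.mul_apply, ev_lam, ih, pow_succ', mul_assoc]
      rw [aeval_monomial, Module.End.mul_apply, Module.algebraMap_end_apply, map_smul, h]
      simp [mul_assoc]
  induction d.toFun a using TensorProduct.induction_on with
  | zero => simp
  | add x y hx hy => simp only [map_add, hx, hy]
  | tmul x y =>
    rw [contractFst_tmul, h, tev_tmul, ConformalDual.evalAt_apply]
    simp [const]

lemma pull_apply {U V W U' V' W' : Type*}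
    [AddCommGroup U] [Module k U] [Module k[X] U] [IsScalarTower k k[X] U]
    [AddCommGroup V] [Module k V] [Module k[X] V] [IsScalarTower k k[X] V]
    [AddCommGroup W] [Module k W] [Module k[X] W] [IsScalarTower k k[X] W]
    [AddCommGroup U'] [Module k U'] [Module k[X] U'] [IsScalarTower k k[X] U']
    [AddCommGroup V'] [Module k V'] [Module k[X] V'] [IsScalarTower k k[X] V']
    [AddCommGroup W'] [Module k W'] [Module k[X] W'] [IsScalarTower k k[X] W']
    (f : Conf k U V W) (α : U' →ₗ[k[X]] U) (β : V' →ₗ[k[X]] V) (γ : W →ₗ[k[X]] W') (u : U')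
    (v : V') :
    (pull f α β γ).1 u v = coeffwise (γ.restrictScalars k) (f.1 (α u) (β v)) := rfl

lemma bicross_apply (ε : k) (m : Conf k P P P) (n : Conf k Q Q Q) (s : Conf k P Q Q)
    (t : Conf k Q P P) (x y : P × Q) :
    (bicross ε m n s t).1 x y =
      coeffwise ((LinearMap.inl k[X] P Q).restrictScalars k)
        (m.1 x.1 y.1 + t.1 x.2 y.1 + ε • (opp t).1 x.1 y.2) +
      coeffwise ((LinearMap.inr k[X] P Q).restrictScalars k)
        (n.1 x.2 y.2 + s.1 x.1 y.2 + ε • (opp s).1 x.2 y.1) := by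
  simp only [bicross, Submodule.coe_add, Submodule.coe_smul, LinearMap.add_apply,
    LinearMap.smul_apply, pull_apply, map_add, map_smul, LinearMap.fst_apply, LinearMap.snd_apply]

lemma ev_bicross_fst (ε : k) (m : Conf k P P P) (n : Conf k Q Q Q) (s : Conf k P Q Q)
    (t : Conf k Q P P) (φ : P →ₗ[k] k) (p : k) (x y : P × Q) :
    ev (φ ∘ₗ LinearMap.fst k P Q) p ((bicross ε m n s t).1 x y) =
      ev φ p (m.1 x.1 y.1) + ev φ p (t.1 x.2 y.1) + ε * ev φ p ((opp t).1 x.1 y.2) := by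
  have h1 : (φ ∘ₗ LinearMap.fst k P Q) ∘ₗ (LinearMap.inl k[X] P Q).restrictScalars k = φ := rfl
  have h2 : (φ ∘ₗ LinearMap.fst k P Q) ∘ₗ (LinearMap.inr k[X] P Q).restrictScalars k = 0 :=
    LinearMap.ext fun v => map_zero φ
  rw [bicross_apply, map_add, ev_coeffwise, ev_coeffwise, h1, h2, ev_zero, add_zero, map_add,
    map_add, map_smul, smul_eq_mul]

lemma ev_bicross_snd (ε : k) (m : Conf k P P P) (n : Conf k Q Q Q) (s : Conf k P Q Q)
    (t : Conf k Q P P) (φ : Q →ₗ[k] k) (p : k) (x y : P × Q) :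
    ev (φ ∘ₗ LinearMap.snd k P Q) p ((bicross ε m n s t).1 x y) =
      ev φ p (n.1 x.2 y.2) + ev φ p (s.1 x.1 y.2) + ε * ev φ p ((opp s).1 x.2 y.1) := by
  have h1 : (φ ∘ₗ LinearMap.snd k P Q) ∘ₗ (LinearMap.inl k[X] P Q).restrictScalars k = 0 :=
    LinearMap.ext fun v => map_zero φ
  have h2 : (φ ∘ₗ LinearMap.snd k P Q) ∘ₗ (LinearMap.inr k[X] P Q).restrictScalars k = φ := rfl
  rw [bicross_apply, map_add, ev_coeffwise, ev_coeffwise, h1, h2, ev_zero, zero_add, map_add,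
    map_add, map_smul, smul_eq_mul]

variable {ι : Type*} [DecidableEq ι] [Fintype ι] [Infinite k]

lemma ev_dualProduct [Module.Finite k[X] P] (e : Module.Basis ι k[X] P) (d : Coproduct k P)
    (m : ι) (f g : ConformalDual k P) (p q : k) :
    ev ((dualFrame e).coef m (p + q)) p ((dualProduct d).1 f g) =
      tev (f.evalAt p) (g.evalAt q) (d.toFun (e m)) := by
  change ev _ p (Family.toLam (dualProductFamily d f g)) = _
  rw [ev_toLam, dualProductFamily_apply]
  have h : ∀ z : P ⊗[k] P, evalTwo p (p + q) (LinearMap.mul' k k[X][X]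
      (TensorProduct.map (f.at X) (g.at (C X - X)) z)) =
        tev (evalTwo p (p + q) ∘ₗ f.at X) (evalTwo p (p + q) ∘ₗ g.at (C X - X)) z := by
    intro z
    induction z using TensorProduct.induction_on with
    | zero => simp
    | add x y hx hy => simp only [map_add, hx, hy]
    | tmul x y => simp [evalTwo_mul]
  -- At `λ = p` and `μ = p + q` the arguments `λ` and `μ - λ` of `f` and `g` become `p` and `q`.
  rw [h, evalTwo_at, evalTwo_at]
  simp [evalTwo_apply]

lemma ev_dualAction [Module.Finite k[X] V] (e : Module.Basis ι k[X] V) (B : Conf k P V V)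
    (m : ι) (u : P) (f : ConformalDual k V) (p q : k) :
    ev ((dualFrame e).coef m (p + q)) p ((dualAction B).1 u f) =
      -ev (f.evalAt q) p (B.1 u (e m)) := by
  change ev _ p (Family.toLam (dualActionFamily B u f)) = _
  rw [ev_toLam, dualActionFamily_apply, map_neg, apply_subst _ _ _ p, evalTwo_at]
  · simp [evalTwo_apply]
  · intro w
    rw [LinearMap.mulLeft_apply, evalTwo_mul]
    simp [evalTwo_apply]

/-- The frame of the double given by a basis and its dual basis. -/
abbrev doubleFrame (e : Module.Basis ι k[X] P) : Frame k (P × ConformalDual k P) (ι ⊕ ι) :=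
  (basisFrame e).prod (dualFrame e)

lemma doubleFrame_vec_inl (e : Module.Basis ι k[X] P) (i : ι) :
    (doubleFrame e).vec (.inl i) = ((basisFrame e).vec i, 0) := rfl

lemma doubleFrame_vec_inr (e : Module.Basis ι k[X] P) (i : ι) :
    (doubleFrame e).vec (.inr i) = (0, dualBasis e i) := rfl

omit [Infinite k] in
lemma evalAt_zero (t : k) : (0 : ConformalDual k P).evalAt t = 0 :=
  LinearMap.ext fun b => by simp [ConformalDual.evalAt_apply]

omit [Infinite k] in
lemma tev_zero_left {U W : Type*} [AddCommGroup U] [Module k U] [AddCommGroup W] [Module k W]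
    (ψ : W →ₗ[k] k) (z : U ⊗[k] W) : tev 0 ψ z = 0 := by
  simp [tev, TensorProduct.map_zero_left]

omit [Infinite k] in
lemma tev_zero_right {U W : Type*} [AddCommGroup U] [Module k U] [AddCommGroup W] [Module k W]
    (φ : U →ₗ[k] k) (z : U ⊗[k] W) : tev φ 0 z = 0 := by
  simp [tev, TensorProduct.map_zero_right]

/-- The signs `-ε` and `ε` of the two actions are the ones that make the pairing invariant. The sign
`ε = -1` gives `doubleBracket`, `ε = 1` gives `doubleProduct`. -/
lemma sc_double [Module.Finite k[X] P] (e : Module.Basis ι k[X] P) (ε : k) (hε : ε * ε = 1)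
    (m : Conf k P P P) (d : Coproduct k P) :
    (doubleFrame e).sc (bicross ε m (dualProduct d) (-ε • dualAction m) (ε • contraction d)) =
      formProduct (triform ε ((basisFrame e).sc m) ((basisFrame e).dsc d)) := by
  have hs : ∀ f u, (-ε • dualAction m).1 f u = -ε • (dualAction m).1 f u := fun _ _ => rfl
  have ht : ∀ f u, (ε • contraction d).1 f u = ε • (contraction d).1 f u := fun _ _ => rfl
  -- A covector with value `t` of `-∂` pairs with vectors of value `-t`; this is the origin of the
  -- minus signs in `triform`.
  have hv : ∀ i t, (dualBasis e i).evalAt t = (basisFrame e).coef i (-t) := fun i t => by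
    change _ = (dualBasis e i).evalAt (- -t)
    rw [neg_neg]
  funext X Y Z p q
  rw [Frame.sc]
  rcases Z with z | z
  · rw [show (doubleFrame e).coef (.inl z) (p + q) =
      (basisFrame e).coef z (p + q) ∘ₗ LinearMap.fst k P _ from rfl]
    rw [ev_bicross_fst, ev_opp _ _ p q ((basisFrame e).coef_der _ _), ht, ht, map_smul, map_smul,
      ev_contraction, ev_contraction]
    rcases X with x | x <;> rcases Y with y | y <;>
      simp only [doubleFrame_vec_inl, doubleFrame_vec_inr, map_zero, LinearMap.zero_apply,
        evalAt_zero, tev_zero_left, hv, smul_eq_mul, mul_zero, add_zero,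
        zero_add, neg_neg,
        formProduct, Sum.swap_inl, triform, Frame.sc, Frame.dsc]
    rw [← mul_assoc, hε, one_mul]
  · rw [show (doubleFrame e).coef (.inr z) (p + q) =
      (dualFrame e).coef z (p + q) ∘ₗ LinearMap.snd k P _ from rfl]
    have he : e z = (basisFrame e).vec z := rfl
    have h1 : p + -(p + q) = -q := by ring
    have h2 : q + -(p + q) = -p := by ring
    rw [ev_bicross_snd, ev_opp _ _ p q ((dualFrame e).coef_der _ _), hs, hs, map_smul, map_smul,
      ev_dualProduct, ev_dualAction, add_comm p q, ev_dualAction, he]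
    rcases X with x | x <;> rcases Y with y | y <;>
      simp only [doubleFrame_vec_inl, doubleFrame_vec_inr, map_zero, LinearMap.zero_apply,
        evalAt_zero, ev_zero, tev_zero_left, tev_zero_right, hv, smul_eq_mul, mul_zero, add_zero,
        zero_add, neg_neg,
        neg_zero, mul_neg, neg_mul, formProduct, Sum.swap_inr, triform, Frame.sc, Frame.dsc, h1, h2]
    rw [← mul_assoc, hε, one_mul]

end DoubleEval

/-! ### Coboundary coproducts -/

section Coboundary

variable {k : Type*} [Field k]
  {U : Type*} [AddCommGroup U] [Module k U] [Module k[X] U] [IsScalarTower k k[X] U]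

lemma onFst_add (B : Conf k U U U) (a a' : U) (z : U ⊗[k] U) :
    onFst B (a + a') z = onFst B a z + onFst B a' z := by
  simp only [onFst, map_add, LinearMap.rTensor_add, LinearMap.comp_apply, LinearMap.add_apply]

lemma onFst_smul (B : Conf k U U U) (c : k) (a : U) (z : U ⊗[k] U) :
    onFst B (c • a) z = c • onFst B a z := by
  simp only [onFst, map_smul, LinearMap.rTensor_smul, LinearMap.comp_apply, LinearMap.smul_apply]

lemma onSnd_add (B : Conf k U U U) (a a' : U) (z : U ⊗[k] U) :
    onSnd B (a + a') z = onSnd B a z + onSnd B a' z := by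
  simp only [onSnd, map_add, LinearMap.lTensor_add, LinearMap.comp_apply, LinearMap.add_apply]

lemma onSnd_smul (B : Conf k U U U) (c : k) (a : U) (z : U ⊗[k] U) :
    onSnd B (c • a) z = c • onSnd B a z := by
  simp only [onSnd, map_smul, LinearMap.lTensor_smul, LinearMap.comp_apply, LinearMap.smul_apply]

lemma finsuppLeft_lam_rTensor {V W : Type*} [AddCommGroup V] [Module k V] [AddCommGroup W]
    [Module k W] (z : Lam V ⊗[k] W) :
    TensorProduct.finsuppLeft k k V W ℕ ((lam k V).rTensor W z) =
      lam k (V ⊗[k] W) (TensorProduct.finsuppLeft k k V W ℕ z) := by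
  induction z using TensorProduct.induction_on with
  | zero => simp
  | add x y hx hy => simp only [map_add, hx, hy]
  | tmul x w =>
    induction x using Finsupp.induction_linear with
    | zero => simp
    | add x y hx hy => simp only [TensorProduct.add_tmul, map_add, hx, hy]
    | single n v =>
      rw [LinearMap.rTensor_tmul, lam_single, TensorProduct.finsuppLeft_apply_tmul,
        TensorProduct.finsuppLeft_apply_tmul, Finsupp.sum_single_index (by simp),
        Finsupp.sum_single_index (by simp), lam_single]

lemma finsuppRight_lam_lTensor {V W : Type*} [AddCommGroup V] [Module k V] [AddCommGroup W]
    [Module k W] (z : V ⊗[k] Lam W) :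
    TensorProduct.finsuppRight k k V W ℕ ((lam k W).lTensor V z) =
      lam k (V ⊗[k] W) (TensorProduct.finsuppRight k k V W ℕ z) := by
  induction z using TensorProduct.induction_on with
  | zero => simp
  | add x y hx hy => simp only [map_add, hx, hy]
  | tmul v x =>
    induction x using Finsupp.induction_linear with
    | zero => simp
    | add x y hx hy => simp only [TensorProduct.tmul_add, map_add, hx, hy]
    | single n w =>
      rw [LinearMap.lTensor_tmul, lam_single, TensorProduct.finsuppRight_apply_tmul,
        TensorProduct.finsuppRight_apply_tmul, Finsupp.sum_single_index (by simp),
        Finsupp.sum_single_index (by simp), lam_single]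

lemma onFst_der (B : Conf k U U U) (a : U) (z : U ⊗[k] U) :
    onFst B (der k U a) z = -lam k _ (onFst B a z) := by
  have h : B.1 (der k U a) = -(lam k U ∘ₗ B.1 a) := LinearMap.ext fun v => B.2.1 a v
  rw [onFst, h, LinearMap.rTensor_neg, LinearMap.rTensor_comp]
  simp only [LinearMap.comp_apply, LinearMap.neg_apply, map_neg, LinearEquiv.coe_coe,
    finsuppLeft_lam_rTensor, onFst]

lemma onSnd_der (B : Conf k U U U) (a : U) (z : U ⊗[k] U) :
    onSnd B (der k U a) z = -lam k _ (onSnd B a z) := by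
  have h : B.1 (der k U a) = -(lam k U ∘ₗ B.1 a) := LinearMap.ext fun v => B.2.1 a v
  rw [onSnd, h, LinearMap.lTensor_neg, LinearMap.lTensor_comp]
  simp only [LinearMap.comp_apply, LinearMap.neg_apply, map_neg, LinearEquiv.coe_coe,
    finsuppRight_lam_lTensor, onSnd]

/-- The coproduct `a ↦ (I ⊗ B(a)_λ + η B(a)_λ ⊗ I) r` at `λ = -∂ ⊗ I - I ⊗ ∂`. -/
def coboundary (η : k) (B : Conf k U U U) (r : U ⊗[k] U) : Coproduct k U where
  toFun :=
    { toFun := fun a => atNegDer (onSnd B a r + η • onFst B a r)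
      map_add' := fun a a' => by
        rw [onFst_add, onSnd_add, ← map_add]
        congr 1
        rw [smul_add]
        abel
      map_smul' := fun c a => by
        rw [onFst_smul, onSnd_smul, RingHom.id_apply, smul_comm η c, ← smul_add, map_smul] }
  map_der a := by
    change atNegDer _ = der₂ k U (atNegDer _)
    -- The factor `-λ` produced by `∂a` becomes `∂ ⊗ I + I ⊗ ∂` under the substitution.
    rw [onFst_der, onSnd_der, smul_neg, ← map_smul, ← neg_add, ← map_add, map_neg, atNegDer,
      subst_lam, LinearMap.neg_apply, neg_neg]

variable {ι : Type*} [DecidableEq ι]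

lemma Frame.tev_atNegDer (F : Frame k U ι) (i j : ι) (s t : k) (w : Lam (U ⊗[k] U)) :
    tev (F.coef i s) (F.coef j t) (atNegDer w) =
      ev (tev (F.coef i s) (F.coef j t)) (s + t) w := by
  rw [atNegDer, apply_subst _ _ _ (s + t), LinearMap.comp_id]
  intro w
  rw [LinearMap.neg_apply, map_neg, F.tev_der₂]
  ring

lemma Frame.tev_coboundary (F : Frame k U ι) (η : k) (B : Conf k U U U) (r : U ⊗[k] U) (i j : ι)
    (s t : k) (a : U) :
    tev (F.coef i s) (F.coef j t) ((coboundary η B r).toFun a) =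
      tev (F.coef i s) (ev (F.coef j t) (s + t) ∘ₗ B.1 a) r +
        η * tev (ev (F.coef i s) (s + t) ∘ₗ B.1 a) (F.coef j t) r := by
  change tev (F.coef i s) (F.coef j t) (atNegDer _) = _
  rw [F.tev_atNegDer, map_add, map_smul, PoissonConformal.ev_onFst,
    PoissonConformal.ev_onSnd, smul_eq_mul]

end Coboundary

/-! ### Coboundaries of the canonical tensor. -/

section CanonicalTensor

variable {k : Type*} [Field k] [Infinite k]
  {P : Type*} [AddCommGroup P] [Module k P] [Module k[X] P] [IsScalarTower k k[X] P]

lemma tev_canonicalTensor {n : ℕ} (e : Module.Basis (Fin n) k[X] P)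
    (φ ψ : P × ConformalDual k P →ₗ[k] k) :
    tev φ ψ (canonicalTensor e) =
      ∑ i, φ ((doubleFrame e).vec (.inl i)) * ψ ((doubleFrame e).vec (.inr i)) := by
  simp only [canonicalTensor, map_sum, tev_tmul]
  rfl

/-- Modulo the image of `∂ ⊗ I + I ⊗ ∂`, the canonical tensor does not depend on the basis. -/
lemma tev_canonicalTensor_eq {n n' : ℕ} (e : Module.Basis (Fin n) k[X] P)
    (e' : Module.Basis (Fin n') k[X] P) (φ ψ : P × ConformalDual k P →ₗ[k] k) (t : k)
    (hφ : ∀ u, φ (der k _ u) = t * φ u) (hψ : ∀ u, ψ (der k _ u) = -t * ψ u) :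
    tev φ ψ (canonicalTensor e') = tev φ ψ (canonicalTensor e) := by
  let α : P →ₗ[k] k := φ ∘ₗ LinearMap.inl k P (ConformalDual k P)
  let β : ConformalDual k P →ₗ[k] k := ψ ∘ₗ LinearMap.inr k P (ConformalDual k P)
  have hα : ∀ u, α (der k _ u) = -(-t) * α u := fun u => by
    rw [neg_neg, ← show φ (der k _ (u, 0)) = t * α u from hφ (u, 0)]
    exact congrArg φ (Prod.ext rfl (smul_zero _).symm)
  have hβ : ∀ u, β (der k _ u) = -t * β u := fun u => by
    rw [← show ψ (der k _ (0, u)) = -t * β u from hψ (0, u)]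
    exact congrArg ψ (Prod.ext (smul_zero _).symm rfl)
  rw [tev_canonicalTensor, tev_canonicalTensor]
  change ∑ i, α (e' i) * β (dualBasis e' i) = ∑ j, α (e j) * β (dualBasis e j)
  have h1 : ∀ i, α (e' i) = ∑ j, (basisFrame e).coef j (-t) (e' i) * α (e j) := fun i =>
    (basisFrame e).expand_apply α (-t) hα (e' i)
  -- The coordinates of `eⱼ*` with respect to the `e'ᵢ*` are its values on the `e'ᵢ`: the same
  -- matrix as in `h1`, transposed and at the same value `∂ = t` on `P`.
  have h2 : ∀ j, β (dualBasis e j) =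
      ∑ i, (basisFrame e).coef j (-t) (e' i) * β (dualBasis e' i) := fun j => by
    rw [(dualFrame e').expand_apply β t hβ (dualBasis e j)]
    refine Finset.sum_congr rfl fun i _ => ?_
    change (dualBasis e j).evalAt t (e' i) * _ = (dualBasis e j).evalAt (- -t) (e' i) * _
    rw [neg_neg]
    rfl
  simp only [h1, h2, Finset.sum_mul, Finset.mul_sum]
  rw [Finset.sum_comm]
  exact Finset.sum_congr rfl fun j _ => Finset.sum_congr rfl fun i _ => by ring

/-- The coproduct evaluates `r` at `λ = s + t`. On the acted leg, conservation leaves the value of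
`-∂` opposite to that on the other leg, as `t - (s + t) = -s` and `s - (s + t) = -t`. So
`tev_canonicalTensor_eq` applies to both terms. -/
lemma coboundary_canonicalTensor_eq (η : k)
    (B : Conf k (P × ConformalDual k P) (P × ConformalDual k P) (P × ConformalDual k P))
    {n n' : ℕ} (e : Module.Basis (Fin n) k[X] P) (e' : Module.Basis (Fin n') k[X] P)
    (a : P × ConformalDual k P) :
    (coboundary η B (canonicalTensor e')).toFun a =
      (coboundary η B (canonicalTensor e)).toFun a := by
  refine (doubleFrame e).tensor_ext_iff.mpr fun i j s t => ?_
  rw [Frame.tev_coboundary, Frame.tev_coboundary,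
    tev_canonicalTensor_eq e e' _ _ (-s) ((doubleFrame e).coef_der i s) fun u => ?_,
    tev_canonicalTensor_eq e e' _ _ t (fun u => ?_) ((doubleFrame e).coef_der j t)]
  · exact (ev_conf_right B _ (s + t) (-t)
      (fun v => by rw [(doubleFrame e).coef_der, add_neg_cancel_right]) _ _).trans
        (by rw [neg_neg]; rfl)
  · exact ev_conf_right B _ (s + t) (-s)
      (fun v => by rw [(doubleFrame e).coef_der]; ring) _ _

/-- In `r` the first factor is a vector and the second a covector. So the action on the second
factor contributes only if `X` is a vector, and the action on the first only if `Y` is a covector,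
the latter with sign `-1` after a transposition of the form. The total weight is `[X vector] - [Y
covector]`, which is `typeWeight`. -/
lemma dsc_coboundary {n : ℕ} (e : Module.Basis (Fin n) k[X] P) (ε : k)
    (B : Conf k (P × ConformalDual k P) (P × ConformalDual k P) (P × ConformalDual k P))
    (T : (Fin n ⊕ Fin n) × k → (Fin n ⊕ Fin n) × k → (Fin n ⊕ Fin n) × k → k)
    (hT : IsSignSymmetric ε T) (hB : (doubleFrame e).sc B = formProduct T) :
    (doubleFrame e).dsc (coboundary (-ε) B (canonicalTensor e)) = formCoproduct T := by
  have hB' : ∀ X Y Z p q s, s = p + q →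
      ev ((doubleFrame e).coef Z s) p (B.1 ((doubleFrame e).vec X) ((doubleFrame e).vec Y)) =
        T (X, p) (Y, q) (Z.swap, -s) := by
    rintro X Y Z p q s rfl
    exact congrFun (congrFun (congrFun (congrFun (congrFun hB X) Y) Z) p) q
  funext Z X Y s t
  have h1 : ∀ i, ev ((doubleFrame e).coef Y t) (s + t)
      (B.1 ((doubleFrame e).vec Z) ((doubleFrame e).vec (.inr i))) =
        T (Z, s + t) (.inr i, -s) (Y.swap, -t) := fun i => hB' _ _ _ _ _ _ (by ring)
  have h2 : ∀ i, ev ((doubleFrame e).coef X s) (s + t)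
      (B.1 ((doubleFrame e).vec Z) ((doubleFrame e).vec (.inl i))) =
        T (Z, s + t) (.inl i, -t) (X.swap, -s) := fun i => hB' _ _ _ _ _ _ (by ring)
  rw [Frame.dsc, Frame.tev_coboundary, tev_canonicalTensor, tev_canonicalTensor]
  simp only [LinearMap.comp_apply, Frame.coef_vec, h1, h2]
  have hε : ∀ x y, -(ε * T (Z, s + t) y x) = -T (Z, s + t) x y := fun x y => by
    rw [hT.swap₂₃ _ x y, ← mul_assoc, hT.sq, one_mul]
  rcases X with x | x <;> rcases Y with y | y <;> simp [formCoproduct, typeWeight, hε]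

end CanonicalTensor

end PoissonConformal

end

/-! ### The double construction. -/

open PoissonConformal in
theorem theorem3p13 {k : Type*} [Field k] [CharZero k]
    {P : Type*} [AddCommGroup P] [Module k P] [Module k[X] P] [IsScalarTower k k[X] P]
    [Module.Finite k[X] P] [Module.Free k[X] P]
    (br mul : PoissonConformal.Conf k P P P) (δ Δ : PoissonConformal.Coproduct k P)
    (h : PoissonConformal.IsPoissonConformalBialgebra br mul δ Δ) :
    ∃ δ' Δ' : PoissonConformal.Coproduct k (P × PoissonConformal.ConformalDual k P),
      PoissonConformal.IsPoissonConformalBialgebra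
        (PoissonConformal.doubleBracket br δ) (PoissonConformal.doubleProduct mul Δ) δ' Δ' ∧
      ∀ (n : ℕ) (e : Module.Basis (Fin n) k[X] P),
        PoissonConformal.IsCoboundaryOf
          (PoissonConformal.doubleBracket br δ) (PoissonConformal.doubleProduct mul Δ) δ' Δ'
          (PoissonConformal.canonicalTensor e) := by
  have hk : Infinite k := CharZero.infinite k
  let e := Module.finBasis k[X] P
  have hc := ((basisFrame e).isPoissonConformalBialgebra_iff br mul δ Δ).mp h
  have hbr : (doubleFrame e).sc (doubleBracket br δ) =
      formProduct (triform (-1) ((basisFrame e).sc br) ((basisFrame e).dsc δ)) := by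
    simpa [doubleBracket] using sc_double e (-1) (by ring) br δ
  have hmul : (doubleFrame e).sc (doubleProduct mul Δ) =
      formProduct (triform 1 ((basisFrame e).sc mul) ((basisFrame e).dsc Δ)) := by
    simpa [doubleProduct] using sc_double e 1 (by ring) mul Δ
  -- The coefficient is `-ε` in both cases: `ε = -1` for the bracket, `ε = 1` for the product.
  refine ⟨coboundary (- -1) (doubleBracket br δ) (canonicalTensor e),
    coboundary (-1) (doubleProduct mul Δ) (canonicalTensor e), ?_,
    fun n e' => ⟨fun a => ?_, fun a => ?_⟩⟩
  · rw [(doubleFrame e).isPoissonConformalBialgebra_iff, dsc_coboundary e (-1) _ _ hc.symm_br hbr,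
      dsc_coboundary e 1 _ _ hc.symm_mul hmul, hbr, hmul]
    exact hc.double
  -- The coproducts were built from one chosen basis; any other basis gives the same coboundary.
  · rw [← coboundary_canonicalTensor_eq _ _ e e' a]
    change atNegDer _ = _
    rw [neg_neg, one_smul, add_comm]
  · rw [← coboundary_canonicalTensor_eq _ _ e e' a]
    change atNegDer _ = _
    rw [neg_smul, one_smul, ← sub_eq_add_neg]
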